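/- **Notation.** All rings are commutative. A formal group law $F$ over a $\mathbf Z_2$-algebra is *of order two* if it is commutative and $F(x,x)=0$. Let $N_*$ be the Lazard ring for formal group laws of order two, so that an $N_*$-algebra $R$ carries a formal group law $F$ of order two. Let $\mathcal B_*=\mathbf Z_2[h_0^{\pm},h_1,h_2,\dots]$ with diagonal $\delta(h)=(h\otimes 1)\circ(1\otimes h)$, where $h(x)=\sum_n h_nx^{n+1}$, and let $\mathcal A_*=\mathbf Z_2[\xi_0^{\pm},\xi_1,\xi_2,\dots]$ with diagonal $\delta(\xi)=(\xi\otimes 1)\circ(1\otimes \xi)$, where $\xi(x)=\sum_i \xi_i x^{2^i}$; the counits send $h(x)$ and $\xi(x)$ to $x$. Let $\epsilon:\mathcal B_*\to\mathcal A_*$ be the ring homomorphism with $\epsilon(h)=\xi$. The ring $N_*$ has the left $\mathcal B_*$-coaction with $\phi(F)(x,y)=h(F(h^{-1}x,h^{-1}y))$, and $\mathbf Z_2$ is an $N_*$-algebra through the additive law $x+y$. A *$D$-ring* is an $N_*$-algebra $R$ with a ring homomorphism $D_t:R\to R[[t]]$ such that $D_0(a)=a^2$ for all $a\in R$, such that $D_t(F)=F_t$,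 where $F_t$ is the law with $F_t(xF(x,t),yF(y,t))=F(x,y)\,F(F(x,y),t)$, and such that $D_t(D_s(a))$ is symmetric in $s$ and $t$ for all $a\in R$, where $D_t$ is extended to $R[[s]]$ by $D_t(s)=sF(s,t)$. A *$Q$-ring* is a $\mathbf Z_2$-algebra $R$ with a homomorphism $Q_t:R\to R[[t]]$ with the same properties for the additive law $F(x,y)=x+y$. The category $[\mathcal B_*\mathcal N_*]^D$ has as objects the $D$-rings $R$ with a left $\mathcal B_*$-comodule structure $\phi:R\to\mathcal B_*\otimes R$ that is a ring homomorphism, for which $N_*\otimes R\to R$ is a map of comodules, and which satisfies the *Nishida relations*: $\phi(D_t(r))=D_t(\phi(r))$ in $(\mathcal B_*\otimes R)[[t]]$ for all $r\in R$, where $\phi$ is extended to $R[[t]]$ by $\phi(t)=h(t)$ and $D_t$ is extended to $\mathcal B_*\otimes R$ by $D_t(h)(xF(x,t))=h(x)\,h(F(x,t))$. The category $[\mathcal A_*]^Q$ has as objects the $Q$-rings $R$ with a left $\mathcal A_*$-comodule structure $\alpha:R\to\mathcal A_*\otimes R$ that is a ring homomorphism and satisfies the *Nishida relations*: $\alpha(Q_t(r))=Q_t(\alpha(r))$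 for all $r\in R$, where $\alpha(t)=\xi(t)$ and $Q_t(\xi)(x(x+t))=\xi(x)\,\xi(x+t)$. Morphisms in the two categories are the homomorphisms of $N_*$-algebras, respectively of $\mathbf Z_2$-algebras, that commute with the coactions and with $D_t$, respectively $Q_t$. **Proposition 2.** For every object $R$ of $[\mathcal B_*\mathcal N_*]^D$, the ring $T(R)=R\otimes_{N_*}\mathbf Z_2$, with the coaction induced by $R\xrightarrow{\phi}\mathcal B_*\otimes R\xrightarrow{\epsilon\otimes 1}\mathcal A_*\otimes R$ and with $Q_t$ induced by $D_t$, is an object of $[\mathcal A_*]^Q$. With $T(f)=f\otimes 1$ on morphisms this defines a functor $T$, and $T$ is an equivalence of categories $$[\mathcal B_*\mathcal N_*]^D\simeq[\mathcal A_*]^Q.$$ -/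

import Mathlib

open CategoryTheory
open scoped TensorProduct

universe u

noncomputable section

namespace BordismNishida

/-! ### Formal group laws of order two -/

section FormalGroups

variable {R S : Type*} [CommRing R] [CommRing S]

theorem hasSubst_pair {τ : Type*} {a b : MvPowerSeries τ S}
    (ha : a.constantCoeff = 0) (hb : b.constantCoeff = 0) :
    MvPowerSeries.HasSubst ![a, b] :=
  MvPowerSeries.hasSubst_of_constantCoeff_zero fun i => by fin_cases i <;> simp [ha, hb]

theorem constantCoeff_subst_pair {τ : Type*} {a b : MvPowerSeries τ R}
    (ha : a.constantCoeff = 0) (hb : b.constantCoeff = 0) {F : MvPowerSeries (Fin 2) R}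
    (hF : F.constantCoeff = 0) : (F.subst ![a, b]).constantCoeff = 0 :=
  MvPowerSeries.constantCoeff_subst_eq_zero (hasSubst_pair ha hb)
    (fun i => by fin_cases i <;> simp [ha, hb]) hF

theorem subst_pair_subst {τ υ : Type*} {a b : MvPowerSeries τ R} {c : τ → MvPowerSeries υ R}
    (ha : a.constantCoeff = 0) (hb : b.constantCoeff = 0) (hc : MvPowerSeries.HasSubst c)
    (F : MvPowerSeries (Fin 2) R) :
    (F.subst ![a, b]).subst c = F.subst ![a.subst c, b.subst c] := by
  rw [MvPowerSeries.subst_comp_subst_apply (hasSubst_pair ha hb) hc]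
  congr 1
  funext i
  fin_cases i <;> rfl

theorem map_subst_pair {τ : Type*} {a b : MvPowerSeries τ R}
    (ha : a.constantCoeff = 0) (hb : b.constantCoeff = 0) (f : R →+* S)
    (F : MvPowerSeries (Fin 2) R) :
    (F.subst ![a, b]).map f = (F.map f).subst ![a.map f, b.map f] := by
  rw [MvPowerSeries.map_subst (hasSubst_pair ha hb)]
  congr 1
  funext i
  fin_cases i <;> rfl

/-- A commutative one-dimensional formal group law `F` is *of order two* if `F(x, x) = 0`. -/
structure IsOrderTwo (F : FormalGroup R) : Prop where
  comm : F.toPowerSeries.subst ![MvPowerSeries.X 0, MvPowerSeries.X 1] =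
    (F.toPowerSeries.subst ![MvPowerSeries.X 1, MvPowerSeries.X 0] : MvPowerSeries (Fin 2) R)
  double : F.toPowerSeries.subst ![PowerSeries.X, PowerSeries.X] = (0 : PowerSeries R)

theorem IsOrderTwo.map {F : FormalGroup R} (hF : IsOrderTwo F) (f : R →+* S) :
    IsOrderTwo (F.map f) where
  comm := by
    have h := congrArg (MvPowerSeries.map f) hF.comm
    rw [map_subst_pair (by simp) (by simp), map_subst_pair (by simp) (by simp)] at h
    simpa using h
  double := by
    have h := congrArg (MvPowerSeries.map f) hF.double
    rw [map_subst_pair (by simp [PowerSeries.X]) (by simp [PowerSeries.X])] at h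
    simpa [PowerSeries.X] using h

theorem IsOrderTwo.subst_self {τ : Type*} {F : FormalGroup R} (hF : IsOrderTwo F)
    {a : MvPowerSeries τ R} (ha : a.constantCoeff = 0) : F.toPowerSeries.subst ![a, a] = 0 := by
  have hX : (PowerSeries.X : PowerSeries R).constantCoeff = 0 := by simp
  have hs := PowerSeries.HasSubst.const (PowerSeries.HasSubst.of_constantCoeff_zero ha)
  have hx : MvPowerSeries.subst (fun _ : Unit => a) (PowerSeries.X : PowerSeries R) = a :=
    MvPowerSeries.subst_X hs ()
  have h := congrArg (MvPowerSeries.subst (fun _ : Unit => a)) hF.double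
  rw [subst_pair_subst hX hX hs, hx] at h
  rw [h, ← MvPowerSeries.coe_substAlgHom hs]
  exact map_zero _

theorem isOrderTwo_additive [CharP R 2] : IsOrderTwo (FormalGroup.𝔾ₐ (R := R)) where
  comm := by
    simp [MvPowerSeries.subst_add MvPowerSeries.HasSubst.X_X,
      MvPowerSeries.subst_X MvPowerSeries.HasSubst.X_X, add_comm]
  double := by
    have h : MvPowerSeries.HasSubst ![(PowerSeries.X : PowerSeries R), PowerSeries.X] :=
      hasSubst_pair (by simp [PowerSeries.X]) (by simp [PowerSeries.X])
    have h2 : (2 : R) = 0 := CharTwo.two_eq_zero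
    simp only [FormalGroup.𝔾ₐ_toPowerSeries]
    rw [MvPowerSeries.subst_add h, MvPowerSeries.subst_X h, MvPowerSeries.subst_X h]
    simp only [Matrix.cons_val_zero, Matrix.cons_val_one, Matrix.cons_val_fin_one]
    rw [← two_mul]
    have : (2 : PowerSeries R) = 0 := by
      rw [← map_ofNat (PowerSeries.C (R := R)) 2, h2, map_zero]
    rw [this, zero_mul]

/-! ### The Lazard ring for formal group laws of order two -/

/-- The polynomial ring over `ℤ/2` on variables `a i j`. -/
abbrev LazardPoly : Type := MvPolynomial (ℕ × ℕ) (ZMod 2)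

/-- The generic series `∑ a i j x^i y^j`. -/
def genericTail : MvPowerSeries (Fin 2) LazardPoly :=
  fun m => MvPolynomial.X (m 0, m 1)

/-- The generic series `x + y + ∑ a i j x^(i+1) y^(j+1)`. -/
def genericLaw : MvPowerSeries (Fin 2) LazardPoly :=
  MvPowerSeries.X 0 + MvPowerSeries.X 1 + MvPowerSeries.X 0 * MvPowerSeries.X 1 * genericTail

/-- The ideal generated by the coefficients of the identities expressing that the generic series
is associative, commutative and of order two. -/
def lazardIdeal : Ideal LazardPoly :=
  Ideal.span
    (Set.range (fun m : Fin 3 →₀ ℕ => MvPowerSeries.coeff m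
        (genericLaw.subst
            ![genericLaw.subst ![MvPowerSeries.X 0, MvPowerSeries.X 1], MvPowerSeries.X 2] -
          genericLaw.subst
            ![MvPowerSeries.X 0, genericLaw.subst ![MvPowerSeries.X 1, MvPowerSeries.X 2]] :
          MvPowerSeries (Fin 3) LazardPoly)) ∪
      Set.range (fun m : Fin 2 →₀ ℕ => MvPowerSeries.coeff m
        (genericLaw.subst ![MvPowerSeries.X 0, MvPowerSeries.X 1] -
          genericLaw.subst ![MvPowerSeries.X 1, MvPowerSeries.X 0] :
          MvPowerSeries (Fin 2) LazardPoly)) ∪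
      Set.range (fun n : ℕ => PowerSeries.coeff n
        (genericLaw.subst ![PowerSeries.X, PowerSeries.X] : PowerSeries LazardPoly)))

/-- The ring `N_*`: the Lazard ring for formal group laws of order two. -/
abbrev Lazard : Type := LazardPoly ⧸ lazardIdeal

theorem constantCoeff_genericLaw : genericLaw.constantCoeff = 0 := by
  simp [genericLaw]

theorem coeff_single_zero_mul_X (G : MvPowerSeries (Fin 2) R) (i : Fin 2) :
    MvPowerSeries.coeff (Finsupp.single i 1)
      (MvPowerSeries.X 0 * MvPowerSeries.X 1 * G) = 0 := by
  have hi : (MvPowerSeries.X 0 * MvPowerSeries.X 1 * G : MvPowerSeries (Fin 2) R) =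
      MvPowerSeries.monomial (Finsupp.single 0 1 + Finsupp.single 1 1) 1 * G := by
    simp [MvPowerSeries.X, MvPowerSeries.monomial_mul_monomial]
  rw [hi, MvPowerSeries.coeff_monomial_mul, if_neg]
  intro h
  have h0 := h 0
  have h1 := h 1
  fin_cases i <;> simp at h0 h1

theorem coeff_single_genericLaw (i : Fin 2) :
    MvPowerSeries.coeff (Finsupp.single i 1) genericLaw = 1 := by
  rw [genericLaw, map_add, coeff_single_zero_mul_X, add_zero, map_add]
  fin_cases i <;> simp [MvPowerSeries.coeff_index_single_X]

/-- The universal formal group law of order two. -/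
def universalLaw : FormalGroup Lazard where
  toPowerSeries := genericLaw.map (Ideal.Quotient.mk lazardIdeal)
  zero_constantCoeff := by
    rw [MvPowerSeries.constantCoeff_map, constantCoeff_genericLaw, map_zero]
  lin_coeff_X := by rw [MvPowerSeries.coeff_map, coeff_single_genericLaw, map_one]
  lin_coeff_Y := by rw [MvPowerSeries.coeff_map, coeff_single_genericLaw, map_one]
  assoc := by
    have key : MvPowerSeries.map (Ideal.Quotient.mk lazardIdeal)
        (genericLaw.subst
          ![genericLaw.subst ![MvPowerSeries.X 0, MvPowerSeries.X 1], MvPowerSeries.X 2] :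
          MvPowerSeries (Fin 3) LazardPoly) =
        MvPowerSeries.map (Ideal.Quotient.mk lazardIdeal)
        (genericLaw.subst
          ![MvPowerSeries.X 0, genericLaw.subst ![MvPowerSeries.X 1, MvPowerSeries.X 2]]) := by
      ext m
      rw [MvPowerSeries.coeff_map, MvPowerSeries.coeff_map, Ideal.Quotient.eq, ← map_sub]
      exact Ideal.subset_span (Or.inl (Or.inl ⟨m, rfl⟩))
    rw [map_subst_pair (constantCoeff_subst_pair (by simp) (by simp) constantCoeff_genericLaw)
        (by simp),
      map_subst_pair (by simp)
        (constantCoeff_subst_pair (by simp) (by simp) constantCoeff_genericLaw),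
      map_subst_pair (by simp) (by simp), map_subst_pair (by simp) (by simp)] at key
    simpa using key

theorem isOrderTwo_universalLaw : IsOrderTwo universalLaw where
  comm := by
    have key : MvPowerSeries.map (Ideal.Quotient.mk lazardIdeal)
        (genericLaw.subst ![MvPowerSeries.X 0, MvPowerSeries.X 1] :
          MvPowerSeries (Fin 2) LazardPoly) =
        MvPowerSeries.map (Ideal.Quotient.mk lazardIdeal)
        (genericLaw.subst ![MvPowerSeries.X 1, MvPowerSeries.X 0]) := by
      ext m
      rw [MvPowerSeries.coeff_map, MvPowerSeries.coeff_map, Ideal.Quotient.eq, ← map_sub]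
      exact Ideal.subset_span (Or.inl (Or.inr ⟨m, rfl⟩))
    rw [map_subst_pair (by simp) (by simp), map_subst_pair (by simp) (by simp)] at key
    simpa [universalLaw] using key
  double := by
    have key : MvPowerSeries.map (Ideal.Quotient.mk lazardIdeal)
        (genericLaw.subst ![PowerSeries.X, PowerSeries.X] : PowerSeries LazardPoly) = 0 := by
      refine PowerSeries.ext fun m => ?_
      rw [map_zero]
      exact Ideal.Quotient.eq_zero_iff_mem.2 (Ideal.subset_span (Or.inr ⟨m, rfl⟩))
    rw [map_subst_pair (by simp [PowerSeries.X]) (by simp [PowerSeries.X])] at key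
    simpa [universalLaw, PowerSeries.X] using key

theorem finsupp_fin_two_eq (m : Fin 2 →₀ ℕ) :
    m = Finsupp.single 0 (m 0) + Finsupp.single 1 (m 1) := by
  ext i
  fin_cases i <;> simp


theorem coeff_zero_right (F : FormalGroup R) (n : ℕ) :
    F.toPowerSeries.coeff (Finsupp.single 0 n) = if n = 1 then 1 else 0 := by
  have h2 := congrArg (PowerSeries.coeff n) F.Xzero_eq_X
  rw [PowerSeries.coeff_X] at h2
  rw [← h2, FormalGroup.Xzero, PowerSeries.coeff]
  refine Eq.trans ?_ (MvPowerSeries.coeff_subst (a := ![(MvPowerSeries.X () : MvPowerSeries Unit R), 0])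
    MvPowerSeries.HasSubst.X_zero _ _).symm
  rw [finsum_eq_single _ (Finsupp.single 0 n)]
  · simp [MvPowerSeries.coeff_X_pow]
  · intro d hd
    by_cases h1 : d 1 = 0
    · have : d 0 ≠ n := fun h => hd (by rw [finsupp_fin_two_eq d, h, h1]; simp)
      simp [h1, MvPowerSeries.coeff_X_pow]
      grind
    · simp [h1]

theorem coeff_zero_left (F : FormalGroup R) (n : ℕ) :
    F.toPowerSeries.coeff (Finsupp.single 1 n) = if n = 1 then 1 else 0 := by
  have h2 := congrArg (PowerSeries.coeff n) F.zeroX_eq_X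
  rw [PowerSeries.coeff_X] at h2
  rw [← h2, FormalGroup.zeroX, PowerSeries.coeff]
  refine Eq.trans ?_ (MvPowerSeries.coeff_subst (a := ![0, (MvPowerSeries.X () : MvPowerSeries Unit R)])
    MvPowerSeries.HasSubst.zero_X _ _).symm
  rw [finsum_eq_single _ (Finsupp.single 1 n)]
  · simp [MvPowerSeries.coeff_X_pow]
  · intro d hd
    by_cases h1 : d 0 = 0
    · have : d 1 ≠ n := fun h => hd (by rw [finsupp_fin_two_eq d, h, h1]; simp)
      simp [h1, MvPowerSeries.coeff_X_pow]
      grind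
    · simp [h1]

/-- The homomorphism sending `a i j` to the coefficient of `x^(i+1) y^(j+1)` in `F`. -/
def lazardPolyEval [Algebra (ZMod 2) R] (F : FormalGroup R) : LazardPoly →ₐ[ZMod 2] R :=
  MvPolynomial.aeval fun p =>
    F.toPowerSeries.coeff (Finsupp.single 0 (p.1 + 1) + Finsupp.single 1 (p.2 + 1))

theorem map_genericLaw [Algebra (ZMod 2) R] (F : FormalGroup R) :
    genericLaw.map (lazardPolyEval F : LazardPoly →+* R) = F.toPowerSeries := by
  ext m
  have hX : (MvPowerSeries.X 0 * MvPowerSeries.X 1 * genericTail :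
      MvPowerSeries (Fin 2) LazardPoly) =
      MvPowerSeries.monomial (Finsupp.single 0 1 + Finsupp.single 1 1) 1 * genericTail := by
    simp [MvPowerSeries.X, MvPowerSeries.monomial_mul_monomial]
  rw [MvPowerSeries.coeff_map, genericLaw, hX, map_add, map_add, map_add, map_add, MvPowerSeries.coeff_monomial_mul,
    one_mul]
  obtain ⟨i, j, rfl⟩ : ∃ i j, m = Finsupp.single 0 i + Finsupp.single 1 j :=
    ⟨_, _, finsupp_fin_two_eq m⟩
  rcases i with _ | i
  · have : ¬ (Finsupp.single (0 : Fin 2) 1 + Finsupp.single 1 1 ≤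
        Finsupp.single 0 0 + Finsupp.single 1 j) := fun h => by simpa using h 0
    rw [if_neg this, map_zero, add_zero, Finsupp.single_zero, zero_add, coeff_zero_left]
    simp [MvPowerSeries.coeff_X, Finsupp.single_eq_single_iff]
  rcases j with _ | j
  · have : ¬ (Finsupp.single (0 : Fin 2) 1 + Finsupp.single 1 1 ≤
        Finsupp.single 0 (i + 1) + Finsupp.single 1 0) := fun h => by simpa using h 1
    rw [if_neg this, map_zero, add_zero, Finsupp.single_zero, add_zero, coeff_zero_right]
    have hne : Finsupp.single (0 : Fin 2) (i + 1) ≠ Finsupp.single 1 1 := fun h => by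
      simpa using DFunLike.congr_fun h 1
    rw [MvPowerSeries.coeff_X, MvPowerSeries.coeff_X, if_neg hne]
    simp
  · have h : Finsupp.single (0 : Fin 2) 1 + Finsupp.single 1 1 ≤
        Finsupp.single 0 (i + 1) + Finsupp.single 1 (j + 1) := by
      intro k; fin_cases k <;> simp
    have hne (k : Fin 2) : Finsupp.single (0 : Fin 2) (i + 1) + Finsupp.single 1 (j + 1) ≠
        Finsupp.single k 1 := by
      intro h
      have h0 := DFunLike.congr_fun h 0
      have h1 := DFunLike.congr_fun h 1
      fin_cases k <;> simp at h0 h1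
    rw [if_pos h, MvPowerSeries.coeff_X, MvPowerSeries.coeff_X, if_neg (hne _), if_neg (hne _),
      map_zero, zero_add, zero_add]
    change lazardPolyEval F (MvPolynomial.X _) = _
    rw [lazardPolyEval, MvPolynomial.aeval_X]
    simp

/-- The homomorphism `N_* → R` classifying a formal group law of order two over `R`. -/
def lazardLift [Algebra (ZMod 2) R] (F : FormalGroup R) (hF : IsOrderTwo F) :
    Lazard →ₐ[ZMod 2] R :=
  Ideal.Quotient.liftₐ lazardIdeal (lazardPolyEval F) <| by
    have hle : lazardIdeal ≤ RingHom.ker (lazardPolyEval F : LazardPoly →+* R) := by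
      have h0 := constantCoeff_genericLaw
      refine Ideal.span_le.2 ?_
      rintro _ ((⟨m, rfl⟩ | ⟨m, rfl⟩) | ⟨n, rfl⟩)
      · change (lazardPolyEval F : LazardPoly →+* R) _ = 0
        rw [← MvPowerSeries.coeff_map, map_sub,
          map_subst_pair (constantCoeff_subst_pair (by simp) (by simp) h0) (by simp),
          map_subst_pair (by simp) (constantCoeff_subst_pair (by simp) (by simp) h0),
          map_subst_pair (by simp) (by simp), map_subst_pair (by simp) (by simp),
          map_genericLaw]
        simp only [MvPowerSeries.map_X]
        rw [F.assoc, sub_self, map_zero]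
      · change (lazardPolyEval F : LazardPoly →+* R) _ = 0
        rw [← MvPowerSeries.coeff_map, map_sub,
          map_subst_pair (by simp) (by simp), map_subst_pair (by simp) (by simp),
          map_genericLaw]
        simp only [MvPowerSeries.map_X]
        rw [hF.comm, sub_self, map_zero]
      · change (lazardPolyEval F : LazardPoly →+* R) _ = 0
        have h := map_subst_pair (a := PowerSeries.X) (b := PowerSeries.X) (by simp [PowerSeries.X])
          (by simp [PowerSeries.X]) (lazardPolyEval F : LazardPoly →+* R) genericLaw
        rw [map_genericLaw] at h
        have hX : MvPowerSeries.map (lazardPolyEval F : LazardPoly →+* R)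
          (PowerSeries.X : PowerSeries LazardPoly) = (PowerSeries.X : PowerSeries R) := by
          simp [PowerSeries.X]
        rw [hX, hF.double] at h
        have h' := congrArg (PowerSeries.coeff n) h
        rwa [map_zero] at h'
    exact fun a ha => hle ha

theorem universalLaw_map_lazardLift [Algebra (ZMod 2) R] (F : FormalGroup R) (hF : IsOrderTwo F) :
    universalLaw.map (lazardLift F hF : Lazard →+* R) = F := by
  ext1
  rw [← map_genericLaw F]
  ext m
  rfl


/-! ### Change of parameter -/

theorem coeff_one_subst {f g : PowerSeries R} (hg : PowerSeries.constantCoeff g = 0) :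
    PowerSeries.coeff 1 (f.subst g) = PowerSeries.coeff 1 f * PowerSeries.coeff 1 g := by
  rw [PowerSeries.coeff_subst' (PowerSeries.HasSubst.of_constantCoeff_zero' hg),
    finsum_eq_single _ 1]
  · simp
  · intro n hn
    rcases n with _ | _ | n
    · simp [PowerSeries.coeff_one]
    · exact absurd rfl hn
    · obtain ⟨q, rfl⟩ : PowerSeries.X ∣ g := PowerSeries.X_dvd_iff.2 hg
      rw [mul_pow, PowerSeries.coeff_X_pow_mul', if_neg (by omega), smul_zero]

/-- The law `g (F (g⁻¹ x, g⁻¹ y))` obtained from `F` by an invertible change of parameter `g`, where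
`g⁻¹` is the composition inverse. -/
def conjSeries (F : FormalGroup R) (g : PowerSeries R) (hg : IsUnit (PowerSeries.coeff 1 g)) :
    MvPowerSeries (Fin 2) R :=
  g.subst (F.toPowerSeries.subst
    ![(g.substInvOfIsUnit hg).subst (MvPowerSeries.X 0 : MvPowerSeries (Fin 2) R),
      (g.substInvOfIsUnit hg).subst (MvPowerSeries.X 1 : MvPowerSeries (Fin 2) R)])

section Conj

variable {τ : Type*} (F : FormalGroup R) (g : PowerSeries R)

theorem constantCoeff_inv_subst (hg : IsUnit (PowerSeries.coeff 1 g))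
    {a : MvPowerSeries τ R} (ha : a.constantCoeff = 0) :
    ((g.substInvOfIsUnit hg).subst a).constantCoeff = 0 :=
  PowerSeries.constantCoeff_subst_eq_zero ha _ (by simp)

theorem constantCoeff_conjSeries (hg0 : PowerSeries.constantCoeff g = 0)
    (hg : IsUnit (PowerSeries.coeff 1 g)) :
    (conjSeries F g hg).constantCoeff = 0 :=
  PowerSeries.constantCoeff_subst_eq_zero
    (constantCoeff_subst_pair (constantCoeff_inv_subst g hg (by simp))
      (constantCoeff_inv_subst g hg (by simp)) F.zero_constantCoeff) _ hg0

theorem powerSeries_subst_mv_subst {υ : Type*} (f : PowerSeries R) {a : MvPowerSeries τ R}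
    (ha : a.constantCoeff = 0) {c : τ → MvPowerSeries υ R} (hc : MvPowerSeries.HasSubst c) :
    (f.subst a).subst c = f.subst (a.subst c) :=
  MvPowerSeries.subst_comp_subst_apply
    (PowerSeries.HasSubst.const (PowerSeries.HasSubst.of_constantCoeff_zero ha)) hc f

theorem conjSeries_subst (hg : IsUnit (PowerSeries.coeff 1 g))
    {a b : MvPowerSeries τ R}
    (ha : a.constantCoeff = 0) (hb : b.constantCoeff = 0) :
    (conjSeries F g hg).subst ![a, b] =
      g.subst (F.toPowerSeries.subst
        ![(g.substInvOfIsUnit hg).subst a, (g.substInvOfIsUnit hg).subst b]) := by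
  have hc := hasSubst_pair ha hb
  rw [conjSeries, powerSeries_subst_mv_subst _ (constantCoeff_subst_pair
      (constantCoeff_inv_subst g hg (by simp)) (constantCoeff_inv_subst g hg (by simp))
      F.zero_constantCoeff) hc,
    subst_pair_subst (constantCoeff_inv_subst g hg (by simp))
      (constantCoeff_inv_subst g hg (by simp)) hc,
    powerSeries_subst_mv_subst _ (by simp) hc, powerSeries_subst_mv_subst _ (by simp) hc,
    MvPowerSeries.subst_X hc, MvPowerSeries.subst_X hc]
  rfl

theorem inv_subst_subst (hg0 : PowerSeries.constantCoeff g = 0)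
    (hg : IsUnit (PowerSeries.coeff 1 g)) {a : MvPowerSeries τ R} (ha : a.constantCoeff = 0) :
    (g.substInvOfIsUnit hg).subst (g.subst a) = a := by
  have h := PowerSeries.subst_comp_subst_apply (R := R) (a := g) (b := a)
    (PowerSeries.HasSubst.of_constantCoeff_zero' hg0)
    (PowerSeries.HasSubst.of_constantCoeff_zero ha) (g.substInvOfIsUnit hg)
  rw [← h, PowerSeries.subst_substInvOfIsUnit_left g hg0 hg,
    PowerSeries.subst_X (PowerSeries.HasSubst.of_constantCoeff_zero ha)]

theorem subst_inv_subst (hg0 : PowerSeries.constantCoeff g = 0)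
    (hg : IsUnit (PowerSeries.coeff 1 g)) {a : MvPowerSeries τ R} (ha : a.constantCoeff = 0) :
    g.subst ((g.substInvOfIsUnit hg).subst a) = a := by
  have h := PowerSeries.subst_comp_subst_apply (R := R) (a := g.substInvOfIsUnit hg) (b := a)
    (PowerSeries.HasSubst.of_constantCoeff_zero' (by simp))
    (PowerSeries.HasSubst.of_constantCoeff_zero ha) g
  rw [← h, PowerSeries.subst_substInvOfIsUnit_right g hg0 hg,
    PowerSeries.subst_X (PowerSeries.HasSubst.of_constantCoeff_zero ha)]

theorem coeff_single_zero_eq (G : MvPowerSeries (Fin 2) R) :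
    MvPowerSeries.coeff (Finsupp.single 0 1) G =
      PowerSeries.coeff 1 (G.subst ![(PowerSeries.X : PowerSeries R), 0]) := by
  refine Eq.trans ?_ (MvPowerSeries.coeff_subst
    (a := ![(MvPowerSeries.X () : MvPowerSeries Unit R), 0])
    MvPowerSeries.HasSubst.X_zero _ _).symm
  rw [finsum_eq_single _ (Finsupp.single 0 1)]
  · simp
  · intro d hd
    by_cases h1 : d 1 = 0
    · have : d 0 ≠ 1 := fun h => hd (by rw [finsupp_fin_two_eq d, h, h1]; simp)
      simp [h1, MvPowerSeries.coeff_X_pow]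
      grind
    · simp [h1]

theorem coeff_single_one_eq (G : MvPowerSeries (Fin 2) R) :
    MvPowerSeries.coeff (Finsupp.single 1 1) G =
      PowerSeries.coeff 1 (G.subst ![0, (PowerSeries.X : PowerSeries R)]) := by
  refine Eq.trans ?_ (MvPowerSeries.coeff_subst
    (a := ![0, (MvPowerSeries.X () : MvPowerSeries Unit R)])
    MvPowerSeries.HasSubst.zero_X _ _).symm
  rw [finsum_eq_single _ (Finsupp.single 1 1)]
  · simp
  · intro d hd
    by_cases h1 : d 0 = 0
    · have : d 1 ≠ 1 := fun h => hd (by rw [finsupp_fin_two_eq d, h, h1]; simp)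
      simp [h1, MvPowerSeries.coeff_X_pow]
      grind
    · simp [h1]

theorem inv_subst_zero (hg : IsUnit (PowerSeries.coeff 1 g)) :
    (g.substInvOfIsUnit hg).subst (0 : MvPowerSeries τ R) = 0 :=
  PowerSeries.subst_zero_of_constantCoeff_zero (by simp)

/-- The formal group law `g (F (g⁻¹ x, g⁻¹ y))`. -/
def conjLaw (hg0 : PowerSeries.constantCoeff g = 0)
    (hg : IsUnit (PowerSeries.coeff 1 g)) : FormalGroup R where
  toPowerSeries := conjSeries F g hg
  zero_constantCoeff := constantCoeff_conjSeries F g hg0 hg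
  lin_coeff_X := by
    have hX : (PowerSeries.X : PowerSeries R).constantCoeff = 0 := by simp
    rw [coeff_single_zero_eq, conjSeries_subst F g hg hX (map_zero _), inv_subst_zero,
      F.add_zero (PowerSeries.HasSubst.of_constantCoeff_zero
        (constantCoeff_inv_subst g hg hX)), subst_inv_subst g hg0 hg hX]
    simp
  lin_coeff_Y := by
    have hX : (PowerSeries.X : PowerSeries R).constantCoeff = 0 := by simp
    rw [coeff_single_one_eq, conjSeries_subst F g hg (map_zero _) hX, inv_subst_zero,
      F.zero_add (PowerSeries.HasSubst.of_constantCoeff_zero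
        (constantCoeff_inv_subst g hg hX)), subst_inv_subst g hg0 hg hX]
    simp
  assoc := by
    have hi (i : Fin 3) := constantCoeff_inv_subst g hg
      (a := (MvPowerSeries.X i : MvPowerSeries (Fin 3) R)) (by simp)
    have hF (i j : Fin 3) := constantCoeff_subst_pair (hi i) (hi j) F.zero_constantCoeff
    have hgF (i j : Fin 3) := PowerSeries.constantCoeff_subst_eq_zero (hF i j) g hg0
    rw [conjSeries_subst F g hg (a := MvPowerSeries.X 0) (by simp) (by simp),
      conjSeries_subst F g hg (a := MvPowerSeries.X 1) (by simp) (by simp),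
      conjSeries_subst F g hg (hgF 0 1) (by simp),
      conjSeries_subst F g hg (by simp) (hgF 1 2),
      inv_subst_subst g hg0 hg (hF 0 1), inv_subst_subst g hg0 hg (hF 1 2),
      F.assoc' (PowerSeries.HasSubst.of_constantCoeff_zero (hi 0))
        (PowerSeries.HasSubst.of_constantCoeff_zero (hi 1))
        (PowerSeries.HasSubst.of_constantCoeff_zero (hi 2))]

theorem isOrderTwo_conjLaw (hg0 : PowerSeries.constantCoeff g = 0)
    (hg : IsUnit (PowerSeries.coeff 1 g)) (hF : IsOrderTwo F) : IsOrderTwo (conjLaw F g hg0 hg) where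
  comm := by
    have hi (i : Fin 2) := constantCoeff_inv_subst g hg
      (a := (MvPowerSeries.X i : MvPowerSeries (Fin 2) R)) (by simp)
    change (conjSeries F g hg).subst _ = (conjSeries F g hg).subst _
    rw [conjSeries_subst F g hg (by simp) (by simp), conjSeries_subst F g hg (by simp) (by simp)]
    have h := congrArg (MvPowerSeries.subst
      ![(g.substInvOfIsUnit hg).subst (MvPowerSeries.X 0 : MvPowerSeries (Fin 2) R),
        (g.substInvOfIsUnit hg).subst (MvPowerSeries.X 1 : MvPowerSeries (Fin 2) R)]) hF.comm
    rw [subst_pair_subst (by simp) (by simp) (hasSubst_pair (hi 0) (hi 1)),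
      subst_pair_subst (by simp) (by simp) (hasSubst_pair (hi 0) (hi 1)),
      MvPowerSeries.subst_X (hasSubst_pair (hi 0) (hi 1)),
      MvPowerSeries.subst_X (hasSubst_pair (hi 0) (hi 1))] at h
    exact congrArg (fun f => g.subst f) h
  double := by
    have hX : (PowerSeries.X : PowerSeries R).constantCoeff = 0 := by simp
    change (conjSeries F g hg).subst _ = _
    rw [conjSeries_subst F g hg hX hX]
    have hi := constantCoeff_inv_subst g hg hX
    rw [hF.subst_self hi]
    exact PowerSeries.subst_zero_of_constantCoeff_zero hg0

end Conj

end FormalGroups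

/-! ### The Hopf algebras `B_*` and `A_*` -/

/-- The ring `ℤ/2[g₀^±, g₁, g₂, …]`. -/
abbrev LaurentRing : Type :=
  Localization.Away (MvPolynomial.X 0 : MvPolynomial ℕ (ZMod 2))

/-- The generator `gₙ`. -/
def laurentGen (n : ℕ) : LaurentRing :=
  algebraMap (MvPolynomial ℕ (ZMod 2)) LaurentRing (MvPolynomial.X n)

theorem isUnit_laurentGen_zero : IsUnit (laurentGen 0) :=
  IsLocalization.Away.algebraMap_isUnit _

/-- The homomorphism with prescribed values on the generators, `g₀` going to a unit. -/
def laurentLift {S : Type*} [CommRing S] [Algebra (ZMod 2) S] (f : ℕ → S) (hf : IsUnit (f 0)) :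
    LaurentRing →ₐ[ZMod 2] S :=
  IsLocalization.Away.liftAlgHom (MvPolynomial.X 0) (f := MvPolynomial.aeval f) (by simpa using hf)

theorem laurentLift_gen {S : Type*} [CommRing S] [Algebra (ZMod 2) S] (f : ℕ → S)
    (hf : IsUnit (f 0)) (n : ℕ) : laurentLift f hf (laurentGen n) = f n := by
  simp [laurentLift, laurentGen]

theorem constantCoeff_map_eq_zero {R S : Type*} [CommRing R] [CommRing S] (f : R →+* S)
    {g : PowerSeries R} (hg : PowerSeries.constantCoeff g = 0) :
    PowerSeries.constantCoeff (g.map f) = 0 := by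
  rw [← PowerSeries.coeff_zero_eq_constantCoeff_apply, PowerSeries.coeff_map,
    PowerSeries.coeff_zero_eq_constantCoeff_apply, hg, map_zero]

/-- The composite `(f ⊗ 1) ∘ (1 ⊗ f)` of power series over `H ⊗ H`. -/
def diagSeries {H : Type*} [CommRing H] [Algebra (ZMod 2) H] (f : PowerSeries H) :
    PowerSeries (H ⊗[ZMod 2] H) :=
  (f.map (Algebra.TensorProduct.includeLeftRingHom : H →+* H ⊗[ZMod 2] H)).subst
    (f.map (Algebra.TensorProduct.includeRight : H →ₐ[ZMod 2] H ⊗[ZMod 2] H).toRingHom)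

theorem isUnit_coeff_one_diagSeries {H : Type*} [CommRing H] [Algebra (ZMod 2) H]
    {f : PowerSeries H} (h0 : PowerSeries.constantCoeff f = 0)
    (h1 : IsUnit (PowerSeries.coeff 1 f)) : IsUnit (PowerSeries.coeff 1 (diagSeries f)) := by
  rw [diagSeries, coeff_one_subst (constantCoeff_map_eq_zero _ h0),
    PowerSeries.coeff_map, PowerSeries.coeff_map]
  exact (h1.map _).mul (h1.map _)

/-- The ring of the Faà di Bruno Hopf algebra `B_* = ℤ/2[h₀^±, h₁, …]`. -/
abbrev FaaDiBruno : Type := LaurentRing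

/-- The universal invertible series `h(x) = ∑ hₙ x^(n+1)` over `B_*`. -/
def hSeries : PowerSeries FaaDiBruno :=
  PowerSeries.X * PowerSeries.mk laurentGen

theorem constantCoeff_hSeries : PowerSeries.constantCoeff hSeries = 0 := by
  simp [hSeries]

theorem coeff_succ_hSeries (n : ℕ) : PowerSeries.coeff (n + 1) hSeries = laurentGen n := by
  rw [hSeries, PowerSeries.coeff_succ_X_mul, PowerSeries.coeff_mk]

theorem isUnit_coeff_one_hSeries : IsUnit (PowerSeries.coeff 1 hSeries) := by
  rw [coeff_succ_hSeries 0]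
  exact isUnit_laurentGen_zero

/-- The diagonal of `B_*`, given by `δ(h) = (h ⊗ 1) ∘ (1 ⊗ h)`. -/
def comulB : FaaDiBruno →ₐ[ZMod 2] FaaDiBruno ⊗[ZMod 2] FaaDiBruno :=
  laurentLift (fun n => PowerSeries.coeff (n + 1) (diagSeries hSeries))
    (isUnit_coeff_one_diagSeries constantCoeff_hSeries isUnit_coeff_one_hSeries)

/-- The counit of `B_*`, sending `h(x)` to the identity series `x`. -/
def counitB : FaaDiBruno →ₐ[ZMod 2] ZMod 2 :=
  laurentLift (fun n => if n = 0 then 1 else 0) (by simp)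

/-- The ring of the Milnor Hopf algebra `A_* = ℤ/2[ξ₀^±, ξ₁, …]`. -/
abbrev Milnor : Type := LaurentRing

/-- The series `ξ(x) = ∑ ξᵢ x^(2^i)` over `A_*`. -/
def xiSeries : PowerSeries Milnor :=
  PowerSeries.mk fun k => if k = 2 ^ Nat.log 2 k then laurentGen (Nat.log 2 k) else 0

theorem constantCoeff_xiSeries : PowerSeries.constantCoeff xiSeries = 0 := by
  simp [xiSeries, ← PowerSeries.coeff_zero_eq_constantCoeff_apply]

theorem coeff_two_pow_xiSeries (i : ℕ) : PowerSeries.coeff (2 ^ i) xiSeries = laurentGen i := by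
  simp [xiSeries, Nat.log_pow]

theorem isUnit_coeff_one_xiSeries : IsUnit (PowerSeries.coeff 1 xiSeries) := by
  rw [show 1 = 2 ^ 0 from rfl, coeff_two_pow_xiSeries 0]
  exact isUnit_laurentGen_zero

/-- The diagonal of `A_*`, given by `δ(ξ) = (ξ ⊗ 1) ∘ (1 ⊗ ξ)`: both sides are additive series, so
that only the coefficients of the powers `x^(2^i)` matter. -/
def comulA : Milnor →ₐ[ZMod 2] Milnor ⊗[ZMod 2] Milnor :=
  laurentLift (fun i => PowerSeries.coeff (2 ^ i) (diagSeries xiSeries))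
    (isUnit_coeff_one_diagSeries constantCoeff_xiSeries isUnit_coeff_one_xiSeries)

/-- The counit of `A_*`, sending `ξ(x)` to the identity series `x`. -/
def counitA : Milnor →ₐ[ZMod 2] ZMod 2 :=
  laurentLift (fun i => if i = 0 then 1 else 0) (by simp)

/-- The ring homomorphism `ε : B_* → A_*` with `ε(h) = ξ`. -/
def epsilon : FaaDiBruno →ₐ[ZMod 2] Milnor :=
  laurentLift (fun n => PowerSeries.coeff (n + 1) xiSeries) isUnit_coeff_one_xiSeries

theorem map_epsilon_hSeries : hSeries.map (epsilon : FaaDiBruno →+* Milnor) = xiSeries := by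
  ext n
  rcases n with _ | n
  · simp [constantCoeff_hSeries, constantCoeff_xiSeries]
  · rw [PowerSeries.coeff_map, coeff_succ_hSeries]
    exact laurentLift_gen _ isUnit_coeff_one_xiSeries _

theorem map_comulB_hSeries :
    hSeries.map (comulB : FaaDiBruno →+* _) = diagSeries hSeries := by
  ext n
  rcases n with _ | n
  · have h : PowerSeries.constantCoeff (diagSeries hSeries) = 0 :=
      PowerSeries.constantCoeff_subst_eq_zero
        (constantCoeff_map_eq_zero _ constantCoeff_hSeries) _
        (constantCoeff_map_eq_zero _ constantCoeff_hSeries)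
    simp [constantCoeff_hSeries, h]
  · rw [PowerSeries.coeff_map, coeff_succ_hSeries]
    exact laurentLift_gen _
      (isUnit_coeff_one_diagSeries constantCoeff_hSeries isUnit_coeff_one_hSeries) _

/-- A ring homomorphism `φ : R → H ⊗ R` making `R` into a left comodule (hence a left comodule
algebra) over the bialgebra `H` with diagonal `δ` and counit `ε`. -/
structure IsCoaction {H : Type*} [CommRing H] [Algebra (ZMod 2) H]
    (δ : H →ₐ[ZMod 2] H ⊗[ZMod 2] H) (ε : H →ₐ[ZMod 2] ZMod 2)
    {R : Type*} [CommRing R] [Algebra (ZMod 2) R] (φ : R →ₐ[ZMod 2] H ⊗[ZMod 2] R) : Prop where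
  counit : ∀ r, Algebra.TensorProduct.lid (ZMod 2) R
    (Algebra.TensorProduct.map ε (AlgHom.id (ZMod 2) R) (φ r)) = r
  coassoc : ∀ r, Algebra.TensorProduct.assoc (ZMod 2) (ZMod 2) (ZMod 2) H H R
      (Algebra.TensorProduct.map δ (AlgHom.id (ZMod 2) R) (φ r)) =
    Algebra.TensorProduct.map (AlgHom.id (ZMod 2) H) φ (φ r)

/-! ### The coaction of `B_*` on `N_*` -/

section LazardCoaction

variable (H : Type*) [CommRing H] [Algebra (ZMod 2) H] (R : Type*) [CommRing R]
  [Algebra (ZMod 2) R]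

/-- The inclusion `H → H ⊗ R`. -/
abbrev inclL : H →+* H ⊗[ZMod 2] R := Algebra.TensorProduct.includeLeftRingHom

/-- The inclusion `R → H ⊗ R`. -/
abbrev inclR : R →+* H ⊗[ZMod 2] R :=
  (Algebra.TensorProduct.includeRight : R →ₐ[ZMod 2] H ⊗[ZMod 2] R).toRingHom

end LazardCoaction

/-- The coaction `N_* → B_* ⊗ N_*` with `φ(F)(x, y) = h(F(h⁻¹ x, h⁻¹ y))`. -/
def lazardCoaction : Lazard →ₐ[ZMod 2] FaaDiBruno ⊗[ZMod 2] Lazard :=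
  lazardLift
    (conjLaw (universalLaw.map (inclR FaaDiBruno Lazard)) (hSeries.map (inclL FaaDiBruno Lazard))
      (constantCoeff_map_eq_zero _ constantCoeff_hSeries)
      (by rw [PowerSeries.coeff_map]; exact isUnit_coeff_one_hSeries.map _))
    (isOrderTwo_conjLaw _ _ _ _ (isOrderTwo_universalLaw.map _))

/-- The augmentation `N_* → ℤ/2`, classifying the additive group law. -/
def lazardAugmentation : Lazard →ₐ[ZMod 2] ZMod 2 :=
  lazardLift FormalGroup.𝔾ₐ isOrderTwo_additive

/-- `ℤ/2` is an `N_*`-algebra through the augmentation. -/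
instance : Algebra Lazard (ZMod 2) := (lazardAugmentation : Lazard →+* ZMod 2).toAlgebra

/-- The formal group law of an `N_*`-algebra. -/
def lawOf (R : Type*) [CommRing R] [Algebra Lazard R] : FormalGroup R :=
  universalLaw.map (algebraMap Lazard R)

/-! ### Total squares and the Nishida relations -/

section TotalSquare

variable {R : Type*} [CommRing R] {σ : Type*}

/-- Apply `D : R → R[[t]]` to every coefficient of a power series in the variables `σ`; the variable
`t` is indexed by `none`. -/
def coeffwise (D : R →+* PowerSeries R) (f : MvPowerSeries σ R) : MvPowerSeries (Option σ) R :=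
  fun m => PowerSeries.coeff (m none) (D (MvPowerSeries.coeff m.some f))

/-- The substitution `x ↦ x F(x, t)` for every variable `x` in `σ`, with `t ↦ t`. -/
def isogenySubst (F : FormalGroup R) : Option σ → MvPowerSeries (Option σ) R
  | none => MvPowerSeries.X none
  | some i => MvPowerSeries.X (some i) *
      F.toPowerSeries.subst ![MvPowerSeries.X (some i), MvPowerSeries.X none]

/-- The extension of `D : R → R[[t]]` to power series, with `D(x) = x F(x, t)` on variables. -/
def extendSquare (F : FormalGroup R) (D : R →+* PowerSeries R) (f : MvPowerSeries σ R) :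
    MvPowerSeries (Option σ) R :=
  (coeffwise D f).subst (isogenySubst F)

/-- A ring homomorphism `D = D_t : R → R[[t]]` is a *`D`-structure* on `(R, F)` if `D_0(a) = a²`,
if `D_t` sends `F` to its Lubin quotient `F_t`, which is the law with
`F_t(x F(x, t), y F(y, t)) = F(x, y) F(F(x, y), t)`, and if `D_t (D_s a)` is symmetric in `s` and
`t`, where `D_t(s) = s F(s, t)`. -/
structure IsTotalSquare (F : FormalGroup R) (D : R →+* PowerSeries R) : Prop where
  sq : ∀ a, PowerSeries.constantCoeff (D a) = a ^ 2
  law : extendSquare F D F.toPowerSeries =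
    F.toPowerSeries.subst ![MvPowerSeries.X (some 0), MvPowerSeries.X (some 1)] *
      F.toPowerSeries.subst
        ![F.toPowerSeries.subst ![MvPowerSeries.X (some 0), MvPowerSeries.X (some 1)],
          (MvPowerSeries.X none : MvPowerSeries (Option (Fin 2)) R)]
  symm : ∀ a, (extendSquare (σ := Unit) F D (D a)).subst
      (fun i => (MvPowerSeries.X (Equiv.swap none (some ()) i) : MvPowerSeries (Option Unit) R)) =
    extendSquare (σ := Unit) F D (D a)

/-- The *Nishida relations* for a ring `R` with formal group law `F`, a homomorphism
`D : R → R[[t]]` and a coaction `φ : R → H ⊗ R`, where `u` is the universal series over `H`.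

Here `E : H ⊗ R → (H ⊗ R)[[t]]` is the `D`-structure on `H ⊗ R`, the only ring homomorphism that
extends `D` and satisfies `E(u)(x F(x, t)) = u(x) u(F(x, t))`, where the left side is the extension
of `E` to power series in `x` with `E(x) = x F(x, t)`. The relation is the commutative square
`φ(D_t(r)) = E(φ(r))`, where `φ` is extended to `R[[t]]` by `φ(t) = u(t)`. -/
def SatisfiesNishida {H : Type*} [CommRing H] [Algebra (ZMod 2) H] (u : PowerSeries H)
    [Algebra (ZMod 2) R] (F : FormalGroup R) (D : R →+* PowerSeries R)
    (φ : R →ₐ[ZMod 2] H ⊗[ZMod 2] R) : Prop :=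
  ∃ E : H ⊗[ZMod 2] R →+* PowerSeries (H ⊗[ZMod 2] R),
    (∀ r, E (inclR H R r) = (D r).map (inclR H R)) ∧
    extendSquare (σ := Unit) (F.map (inclR H R)) E (u.map (inclL H R)) =
      (u.map (inclL H R)).subst
          (MvPowerSeries.X (some ()) : MvPowerSeries (Option Unit) (H ⊗[ZMod 2] R)) *
        (u.map (inclL H R)).subst
          ((F.map (inclR H R)).toPowerSeries.subst
            ![(MvPowerSeries.X (some ()) : MvPowerSeries (Option Unit) (H ⊗[ZMod 2] R)),
              MvPowerSeries.X none]) ∧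
    ∀ r, ((D r).map (φ : R →+* H ⊗[ZMod 2] R)).subst (u.map (inclL H R)) = E (φ r)

end TotalSquare

/-! ### The two categories -/

/-- An object of `[B_* N_*]^D`: a `D`-ring with a Landweber-Novikov coaction which satisfies the
Nishida relations. -/
structure DRing where
  carrier : Type u
  [commRing : CommRing carrier]
  [algebraZMod : Algebra (ZMod 2) carrier]
  [algebraLazard : Algebra Lazard carrier]
  [isScalarTower : IsScalarTower (ZMod 2) Lazard carrier]
  square : carrier →+* PowerSeries carrier
  isTotalSquare : IsTotalSquare (lawOf carrier) square
  coaction : carrier →ₐ[ZMod 2] FaaDiBruno ⊗[ZMod 2] carrier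
  isCoaction : IsCoaction comulB counitB coaction
  coaction_smul : ∀ (n : Lazard) (r : carrier), coaction (n • r) =
    Algebra.TensorProduct.map (AlgHom.id (ZMod 2) FaaDiBruno)
      (IsScalarTower.toAlgHom (ZMod 2) Lazard carrier) (lazardCoaction n) * coaction r
  nishida : SatisfiesNishida hSeries (lawOf carrier) square coaction

namespace DRing

instance : CoeSort DRing.{u} (Type u) := ⟨carrier⟩

attribute [instance] commRing algebraZMod algebraLazard isScalarTower

/-- Morphisms of `[B_* N_*]^D`: the homomorphisms of `N_*`-algebras which commute with `D_t` and
with the coactions. -/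
@[ext]
structure Hom (R S : DRing.{u}) where
  toAlgHom : R →ₐ[Lazard] S
  square_comm : ∀ r, S.square (toAlgHom r) = (R.square r).map (toAlgHom : R →+* S)
  coaction_comm : ∀ r, S.coaction (toAlgHom r) =
    Algebra.TensorProduct.map (AlgHom.id (ZMod 2) FaaDiBruno)
      (toAlgHom.restrictScalars (ZMod 2)) (R.coaction r)

instance : Category DRing.{u} where
  Hom := Hom
  id R :=
    { toAlgHom := AlgHom.id Lazard R
      square_comm := fun r => by
        refine PowerSeries.ext fun n => ?_
        rw [PowerSeries.coeff_map]
        rfl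
      coaction_comm := fun r => by
        have h : (AlgHom.id Lazard R).restrictScalars (ZMod 2) = AlgHom.id (ZMod 2) R := rfl
        rw [h, Algebra.TensorProduct.map_id]
        rfl }
  comp {R S T} f g :=
    { toAlgHom := g.toAlgHom.comp f.toAlgHom
      square_comm := fun r => by
        rw [AlgHom.comp_apply, g.square_comm, f.square_comm]
        refine PowerSeries.ext fun n => ?_
        simp only [PowerSeries.coeff_map]
        rfl
      coaction_comm := fun r => by
        have h : (g.toAlgHom.comp f.toAlgHom).restrictScalars (ZMod 2) =
          (g.toAlgHom.restrictScalars (ZMod 2)).comp (f.toAlgHom.restrictScalars (ZMod 2)) := rfl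
        rw [AlgHom.comp_apply, g.coaction_comm, f.coaction_comm, h, ← AlgHom.comp_apply,
          ← Algebra.TensorProduct.map_comp, AlgHom.id_comp] }

end DRing

/-- An object of `[A_*]^Q`: a `Q`-ring (a `D`-ring with additive formal group law) with a Milnor
coaction which satisfies the Nishida relations. -/
structure QRing where
  carrier : Type u
  [commRing : CommRing carrier]
  [algebraZMod : Algebra (ZMod 2) carrier]
  square : carrier →+* PowerSeries carrier
  isTotalSquare : IsTotalSquare FormalGroup.𝔾ₐ square
  coaction : carrier →ₐ[ZMod 2] Milnor ⊗[ZMod 2] carrier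
  isCoaction : IsCoaction comulA counitA coaction
  nishida : SatisfiesNishida xiSeries FormalGroup.𝔾ₐ square coaction

namespace QRing

instance : CoeSort QRing.{u} (Type u) := ⟨carrier⟩

attribute [instance] commRing algebraZMod

/-- Morphisms of `[A_*]^Q`: the ring homomorphisms which commute with `Q_t` and with the
coactions. -/
@[ext]
structure Hom (R S : QRing.{u}) where
  toAlgHom : R →ₐ[ZMod 2] S
  square_comm : ∀ r, S.square (toAlgHom r) = (R.square r).map (toAlgHom : R →+* S)
  coaction_comm : ∀ r, S.coaction (toAlgHom r) =
    Algebra.TensorProduct.map (AlgHom.id (ZMod 2) Milnor) toAlgHom (R.coaction r)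

instance : Category QRing.{u} where
  Hom := Hom
  id R :=
    { toAlgHom := AlgHom.id (ZMod 2) R
      square_comm := fun r => by
        refine PowerSeries.ext fun n => ?_
        rw [PowerSeries.coeff_map]
        rfl
      coaction_comm := fun r => by
        rw [Algebra.TensorProduct.map_id]
        rfl }
  comp {R S T} f g :=
    { toAlgHom := g.toAlgHom.comp f.toAlgHom
      square_comm := fun r => by
        rw [AlgHom.comp_apply, g.square_comm, f.square_comm]
        refine PowerSeries.ext fun n => ?_
        simp only [PowerSeries.coeff_map]
        rfl
      coaction_comm := fun r => by
        rw [AlgHom.comp_apply, g.coaction_comm, f.coaction_comm, ← AlgHom.comp_apply,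
          ← Algebra.TensorProduct.map_comp, AlgHom.id_comp] }

end QRing

/-! ### The functor `T` -/

/-- The homomorphism `r ↦ e (r ⊗ 1)` from `R` to a ring identified with `R ⊗_{N_*} ℤ/2`. -/
def reduction {R : DRing.{u}} {S : QRing.{u}} (e : (R ⊗[Lazard] ZMod 2) ≃ₐ[ZMod 2] S) :
    R →ₐ[ZMod 2] S :=
  (e : (R ⊗[Lazard] ZMod 2) →ₐ[ZMod 2] S).comp Algebra.TensorProduct.includeLeft

/-- The identification `e` of rings makes `S` into the object `T(R)`: the coaction on
`S = R ⊗_{N_*} ℤ/2` is induced by the coaction on `R` pushed along `ε : B_* → A_*`, and `Q_t` is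
induced by `D_t`. Since every element of `R ⊗_{N_*} ℤ/2` has the form `r ⊗ 1`, this determines
the structure of `S`. -/
structure IsThomReduction (R : DRing.{u}) (S : QRing.{u})
    (e : (R ⊗[Lazard] ZMod 2) ≃ₐ[ZMod 2] S) : Prop where
  coaction_comm : ∀ r : R, S.coaction (e (r ⊗ₜ[Lazard] 1)) =
    Algebra.TensorProduct.map epsilon (reduction e) (R.coaction r)
  square_comm : ∀ r : R, S.square (e (r ⊗ₜ[Lazard] 1)) =
    (R.square r).map (reduction e : R →+* S)

end BordismNishida

end

open BordismNishida

noncomputable section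

namespace BordismNishida

/-! ### Ring homomorphisms out of power series rings -/

section Evaluation

variable {σ τ υ : Type*} {R S T : Type*} [CommRing R] [CommRing S] [CommRing T]

/-! In characteristic two every formal group law of order two is isomorphic to the additive one, and
the automorphisms of the additive law are the additive series. So the groupoid of such laws and
changes of parameter, corepresented by `N_*` and `B_*`, is equivalent to the group of additive
series, corepresented by `A_*`. The theorem is this equivalence on comodule algebras, together with
the check that it respects total squares.

The argument is carried out on points. A homomorphism `R →+* S` is a point of `R`. A coaction of
`B_*` is an action of the group `Param S` on the points over `S`, natural in `S` (`bAct`); a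
coaction of `A_*` is an action of the additive elements of that group (`aAct`). A total square sends
points over `S` to points over `S[[t]]` (`sqAt`). Write `N(g)` for the norm of `g`, the series over
`S[[t]]` that takes `x F(x, t)` to `g(x) g(F(x, t))`. The Nishida relation then says that `D(g ·
f)`, after `t ↦ g(t)`, is `N(g) · D(f)` (`nishida_bAct`, `nishida_aAct`). The norm exists because
the power series in `x F(x, t)` over `S[[t]]` are exactly the series invariant under the involution
`x ↦ F(x, t)` (`exists_norm`), and it is unique because evaluation at `x F(x, t)` is injective
(`isogenyEval_injective`). Uniqueness yields the cocycle rule `normParam_mul` and shows that norms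
of additive series are additive.

The logarithm is built degree by degree. The leading form of the deviation of a series from
additivity is a symmetric 2-cocycle, and the order-two condition kills its middle coefficient;
modulo two such a cocycle is a coboundary (`exists_cocycle_eq`), so that one further coefficient
corrects it. The universal logarithm is normalised to reduce to the identity under the augmentation.

The points of `T(R)` are the points of `R` whose law is additive. The Lubin quotient of the additive
law is again additive, so the total square restricts to these points. For full faithfulness, the
logarithm moves the universal point of `R'` to a point with additive law, from which a morphism out
of `R` is recovered by acting with the inverse logarithm (`IsReduction.hom_ext`,
`IsReduction.comp_lift`, `IsReduction.exists_lift`).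

For essential surjectivity, points of `N_* ⊗ P` are pairs `(g, p)` of a change of parameter and a
point of `P`, with `(g a, p)` identified with `(g, a · p)` for additive `a` (`QRing.pt_mul`,
`QRing.eq_pt`). The coaction is `k · (g, p) = (k g, p)`, and the square of `(g, p)`, after `t ↦
g(t)`, is `(N(g), Q(p))`. Symmetry of the iterated square reduces to symmetry of the iterated norm
(`doubleNorm_exchange`). -/

theorem mem_span_X_of_coeff (s : Finset σ) (f : MvPowerSeries σ R)
    (hf : ∀ d : σ →₀ ℕ, (∀ i ∈ s, d i = 0) → MvPowerSeries.coeff d f = 0) :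
    f ∈ Ideal.span (Set.range (MvPowerSeries.X : σ → MvPowerSeries σ R)) := by
  classical
  induction s using Finset.induction_on generalizing f with
  | empty =>
    have : f = 0 := by ext d; simpa using hf d (by simp)
    simp [this]
  | insert i s his ih =>
    -- The monomials of `f` free of `X i`; the remaining ones are divisible by `X i`.
    let f₂ : MvPowerSeries σ R := fun d => if d i = 0 then MvPowerSeries.coeff d f else 0
    have hc (d : σ →₀ ℕ) : MvPowerSeries.coeff d f₂ =
        if d i = 0 then MvPowerSeries.coeff d f else 0 := rfl
    have h₂ : f₂ ∈ Ideal.span (Set.range (MvPowerSeries.X : σ → MvPowerSeries σ R)) := by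
      refine ih f₂ fun d hd => ?_
      rw [hc]
      split_ifs with h
      · exact hf d fun j hj => by
          rcases Finset.mem_insert.1 hj with rfl | hj
          exacts [h, hd j hj]
      · rfl
    have h₁ : MvPowerSeries.X i ∣ f - f₂ := by
      rw [MvPowerSeries.X_dvd_iff]
      intro d hd
      rw [map_sub, hc, if_pos hd, sub_self]
    rw [← sub_add_cancel f f₂]
    refine add_mem ?_ h₂
    exact Ideal.mem_of_dvd _ h₁ (Ideal.subset_span ⟨i, rfl⟩)

theorem mem_span_X_iff [Finite σ] {f : MvPowerSeries σ R} (hf : f.constantCoeff = 0) :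
    f ∈ Ideal.span (Set.range (MvPowerSeries.X : σ → MvPowerSeries σ R)) := by
  have := Fintype.ofFinite σ
  refine mem_span_X_of_coeff Finset.univ f fun d hd => ?_
  have : d = 0 := by ext i; exact hd i (Finset.mem_univ i)
  rwa [this]

/-- Induction on the order of approximation: apart from its constant term, `f` is a combination of
variables, and approximating the coefficient of each variable gains one order. -/
theorem exists_polynomial_sub_mem [Finite σ] (f : MvPowerSeries σ R) (n : ℕ) :
    ∃ p : MvPolynomial σ R, f - p ∈
      Ideal.span (Set.range (MvPowerSeries.X : σ → MvPowerSeries σ R)) ^ n := by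
  have := Fintype.ofFinite σ
  induction n generalizing f with
  | zero => exact ⟨0, by simp⟩
  | succ n ih =>
    have h0 : f - MvPowerSeries.C f.constantCoeff ∈
        Ideal.span (Set.range (MvPowerSeries.X : σ → MvPowerSeries σ R)) :=
      mem_span_X_iff (by simp)
    obtain ⟨c, hc⟩ := (Submodule.mem_span_range_iff_exists_fun _).1 h0
    choose p hp using fun i => ih (c i)
    refine ⟨MvPolynomial.C f.constantCoeff + ∑ i, p i * MvPolynomial.X i, ?_⟩
    have : f - ((MvPolynomial.C f.constantCoeff + ∑ i, p i * MvPolynomial.X i :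
        MvPolynomial σ R) : MvPowerSeries σ R) =
        ∑ i, (c i - (p i : MvPowerSeries σ R)) * MvPowerSeries.X i := by
      have e : ((∑ i, p i * MvPolynomial.X i : MvPolynomial σ R) : MvPowerSeries σ R) =
          ∑ i, (p i : MvPowerSeries σ R) * MvPowerSeries.X i := by
        rw [← MvPolynomial.coeToMvPowerSeries.ringHom_apply, map_sum]
        simp
      rw [MvPolynomial.coe_add, e, MvPolynomial.coe_C, ← sub_sub, ← hc]
      simp [sub_mul, Finset.sum_sub_distrib]
    rw [this]
    refine Ideal.sum_mem _ fun i _ => ?_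
    rw [pow_succ]
    exact Ideal.mul_mem_mul (hp i) (Ideal.subset_span ⟨i, rfl⟩)

/-- Orders add at least under multiplication, and each factor from `J` has order at least one. -/
theorem coeff_eq_zero_of_mem_pow {J : Ideal (MvPowerSeries τ S)}
    (hJ : ∀ f ∈ J, f.constantCoeff = 0) (n : ℕ) {f : MvPowerSeries τ S} (hf : f ∈ J ^ n)
    {d : τ →₀ ℕ} (hd : d.degree < n) : MvPowerSeries.coeff d f = 0 := by
  suffices (n : ℕ∞) ≤ f.order by
    exact MvPowerSeries.coeff_of_lt_order (lt_of_lt_of_le (by exact_mod_cast hd) this)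
  clear hd
  induction n generalizing f with
  | zero => simp
  | succ n ih =>
    rw [pow_succ] at hf
    induction hf using Submodule.mul_induction_on' with
    | mem_mul_mem a ha b hb =>
      refine le_trans ?_ MvPowerSeries.le_order_mul
      push_cast
      refine add_le_add (ih ha) ?_
      rw [MvPowerSeries.one_le_order_iff_constCoeff_eq_zero]
      exact hJ b hb
    | add a _ b _ ha hb =>
      exact le_trans (le_min ha hb) MvPowerSeries.min_order_le_add

/-- Ring homomorphisms between power series rings are determined by their values on constants and
on variables. -/
theorem ringHom_ext [Finite σ] {f g : MvPowerSeries σ R →+* MvPowerSeries τ S}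
    (h0 : ∀ i, (f (MvPowerSeries.X i)).constantCoeff = 0)
    (hC : ∀ r, f (MvPowerSeries.C r) = g (MvPowerSeries.C r))
    (hX : ∀ i, f (MvPowerSeries.X i) = g (MvPowerSeries.X i)) : f = g := by
  ext a d
  have hpoly (p : MvPolynomial σ R) : f p = g p := by
    have : f.comp MvPolynomial.coeToMvPowerSeries.ringHom =
        g.comp MvPolynomial.coeToMvPowerSeries.ringHom := by
      ext i
      · simp [hC]
      · simp [hX]
    exact RingHom.congr_fun this p
  -- The two homomorphisms agree on the polynomial `p`. The remainder is sent to order greater than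
  -- the degree of `d`, because the images of the variables have no constant term.
  obtain ⟨p, hp⟩ := exists_polynomial_sub_mem a (d.degree + 1)
  have key (k : MvPowerSeries σ R →+* MvPowerSeries τ S)
      (hk : ∀ i, (k (MvPowerSeries.X i)).constantCoeff = 0) :
      MvPowerSeries.coeff d (k (a - p)) = 0 := by
    refine coeff_eq_zero_of_mem_pow (J := RingHom.ker MvPowerSeries.constantCoeff)
      (fun f hf => hf) (d.degree + 1) ?_ (Nat.lt_succ_self _)
    have h := Ideal.mem_map_of_mem k hp
    rw [Ideal.map_pow, Ideal.map_span] at h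
    refine Ideal.pow_right_mono (Ideal.span_le.2 ?_) _ h
    rintro _ ⟨_, ⟨i, rfl⟩, rfl⟩
    exact hk i
  have hf := key f h0
  have hg := key g fun i => by rw [← hX]; exact h0 i
  rw [map_sub, map_sub, sub_eq_zero] at hf hg
  rw [hf, hg, hpoly]

-- For discrete coefficients `θ` is automatically continuous and series without constant term can be
-- evaluated at topologically, so the auxiliary topologies leave no trace in the statement.
open MvPowerSeries.WithPiTopology in
theorem exists_evalHom [Finite σ] (θ : R →+* MvPowerSeries τ S) (a : σ → MvPowerSeries τ S)
    (ha : ∀ i, (a i).constantCoeff = 0) :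
    ∃ Θ : MvPowerSeries σ R →+* MvPowerSeries τ S,
      (∀ r, Θ (MvPowerSeries.C r) = θ r) ∧ ∀ i, Θ (MvPowerSeries.X i) = a i := by
  let _ : UniformSpace R := ⊥
  let _ : UniformSpace S := ⊥
  have : DiscreteUniformity R := ⟨rfl⟩
  have : DiscreteUniformity S := ⟨rfl⟩
  have h := (MvPowerSeries.hasSubst_of_constantCoeff_zero ha).hasEval
  have hθ : Continuous θ := continuous_of_discreteTopology
  refine ⟨MvPowerSeries.eval₂Hom hθ h, fun r => ?_, fun i => ?_⟩
  · rw [MvPowerSeries.coe_eval₂Hom, MvPowerSeries.eval₂_C]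
  · rw [MvPowerSeries.coe_eval₂Hom, MvPowerSeries.eval₂_X]

open Classical in
/-- The evaluation of power series at a family `a` of series without constant term, with `θ` on the
coefficients. -/
def evalHom [Finite σ] (θ : R →+* MvPowerSeries τ S) (a : σ → MvPowerSeries τ S) :
    MvPowerSeries σ R →+* MvPowerSeries τ S :=
  if ha : ∀ i, (a i).constantCoeff = 0 then (exists_evalHom θ a ha).choose
  -- With this default the value on constants is `θ` for every family `a`.
  else θ.comp MvPowerSeries.constantCoeff

variable [Finite σ] (θ : R →+* MvPowerSeries τ S) {a : σ → MvPowerSeries τ S}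

@[simp]
theorem evalHom_C (a : σ → MvPowerSeries τ S) (r : R) :
    evalHom θ a (MvPowerSeries.C r) = θ r := by
  rw [evalHom]
  split_ifs with ha
  · exact (exists_evalHom θ a ha).choose_spec.1 r
  · simp

theorem evalHom_X (ha : ∀ i, (a i).constantCoeff = 0) (i : σ) :
    evalHom θ a (MvPowerSeries.X i) = a i := by
  rw [evalHom, dif_pos ha]
  exact (exists_evalHom θ a ha).choose_spec.2 i

/-- The universal property behind most identities below: a composite of substitutions is recognised
from its values on constants and variables. -/
theorem eq_evalHom {Θ : MvPowerSeries σ R →+* MvPowerSeries τ S}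
    (ha : ∀ i, (a i).constantCoeff = 0) (hC : ∀ r, Θ (MvPowerSeries.C r) = θ r)
    (hX : ∀ i, Θ (MvPowerSeries.X i) = a i) : Θ = evalHom θ a :=
  ringHom_ext (fun i => by rw [hX, ha]) (fun r => by rw [hC, evalHom_C])
    (fun i => by rw [hX, evalHom_X θ ha])

theorem comp_evalHom (ha : ∀ i, (a i).constantCoeff = 0)
    (Θ : MvPowerSeries τ S →+* MvPowerSeries υ T)
    (h : ∀ i, (Θ (a i)).constantCoeff = 0) :
    Θ.comp (evalHom θ a) = evalHom (Θ.comp θ) fun i => Θ (a i) :=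
  eq_evalHom _ h (fun r => by simp) fun i => by simp [evalHom_X θ ha]

theorem apply_evalHom (ha : ∀ i, (a i).constantCoeff = 0)
    (Θ : MvPowerSeries τ S →+* MvPowerSeries υ T)
    (h : ∀ i, (Θ (a i)).constantCoeff = 0) (f : MvPowerSeries σ R) :
    Θ (evalHom θ a f) = evalHom (Θ.comp θ) (fun i => Θ (a i)) f := by
  rw [← comp_evalHom θ ha Θ h]
  rfl

theorem constantCoeff_evalHom (ha : ∀ i, (a i).constantCoeff = 0) (f : MvPowerSeries σ R) :
    (evalHom θ a f).constantCoeff = (θ f.constantCoeff).constantCoeff := by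
  have h : f - MvPowerSeries.C f.constantCoeff ∈
      Ideal.span (Set.range (MvPowerSeries.X : σ → MvPowerSeries σ R)) :=
    mem_span_X_iff (by simp)
  have h' : f - MvPowerSeries.C f.constantCoeff ∈
      RingHom.ker ((MvPowerSeries.constantCoeff).comp (evalHom θ a)) := by
    refine Ideal.span_le.2 ?_ h
    rintro _ ⟨i, rfl⟩
    simp [RingHom.mem_ker, evalHom_X θ ha, ha]
  rw [RingHom.mem_ker, map_sub, sub_eq_zero] at h'
  simpa using h'

theorem constantCoeff_evalHom_eq_zero (ha : ∀ i, (a i).constantCoeff = 0) {f : MvPowerSeries σ R}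
    (hf : f.constantCoeff = 0) : (evalHom θ a f).constantCoeff = 0 := by
  rw [constantCoeff_evalHom θ ha, hf, map_zero, map_zero]

theorem subst_eq_evalHom {a : σ → MvPowerSeries τ R} (ha : ∀ i, (a i).constantCoeff = 0)
    (f : MvPowerSeries σ R) : f.subst a = evalHom MvPowerSeries.C a f := by
  have hs := MvPowerSeries.hasSubst_of_constantCoeff_zero ha
  have : (MvPowerSeries.substAlgHom hs : MvPowerSeries σ R →ₐ[R] MvPowerSeries τ R).toRingHom =
      evalHom MvPowerSeries.C a :=
    eq_evalHom _ ha (fun r => by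
        simp [MvPowerSeries.subst_C])
      fun i => by simp [MvPowerSeries.subst_X hs]
  rw [← this]
  simp

theorem powerSeries_subst_eq_evalHom {a : MvPowerSeries τ R} (ha : a.constantCoeff = 0)
    (f : PowerSeries R) :
    f.subst a = evalHom (σ := Unit) MvPowerSeries.C (fun _ => a) f :=
  subst_eq_evalHom (fun _ => ha) f

theorem evalHom_map (h : R →+* S) (θ : S →+* MvPowerSeries υ T) (b : σ → MvPowerSeries υ T)
    (hb : ∀ i, (b i).constantCoeff = 0) (f : MvPowerSeries σ R) :
    evalHom θ b (f.map h) = evalHom (θ.comp h) b f := by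
  rw [← eq_evalHom (Θ := (evalHom θ b).comp (MvPowerSeries.map h)) (θ.comp h) hb]
  · rfl
  · simp
  · intro i; simp [evalHom_X _ hb]

theorem evalHom_C_X (f : MvPowerSeries σ R) :
    evalHom MvPowerSeries.C MvPowerSeries.X f = f := by
  rw [← eq_evalHom (Θ := RingHom.id _)] <;> simp

end Evaluation

/-! ### Evaluation in one variable and addition in a formal group -/

section OneVariable

variable {τ υ : Type*} {R S T : Type*} [CommRing R] [CommRing S] [CommRing T]

/-- The evaluation of power series in one variable. -/
abbrev evalP (θ : R →+* MvPowerSeries τ S) (a : MvPowerSeries τ S) :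
    PowerSeries R →+* MvPowerSeries τ S :=
  evalHom (σ := Unit) θ fun _ => a

theorem evalP_C (θ : R →+* MvPowerSeries τ S) (a : MvPowerSeries τ S) (r : R) :
    evalP θ a (PowerSeries.C r) = θ r :=
  evalHom_C θ _ r

theorem evalP_X (θ : R →+* MvPowerSeries τ S) {a : MvPowerSeries τ S}
    (ha : a.constantCoeff = 0) : evalP θ a PowerSeries.X = a :=
  evalHom_X θ (fun _ => ha) ()

theorem powerSeries_ringHom_ext {f g : PowerSeries R →+* MvPowerSeries τ S}
    (h0 : (f PowerSeries.X).constantCoeff = 0)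
    (hC : ∀ r, f (PowerSeries.C r) = g (PowerSeries.C r))
    (hX : f PowerSeries.X = g PowerSeries.X) : f = g :=
  ringHom_ext (σ := Unit) (fun _ => h0) hC fun _ => hX

theorem apply_evalP (θ : R →+* MvPowerSeries τ S) {a : MvPowerSeries τ S}
    (ha : a.constantCoeff = 0) (Θ : MvPowerSeries τ S →+* MvPowerSeries υ T)
    (h : (Θ a).constantCoeff = 0) (f : PowerSeries R) :
    Θ (evalP θ a f) = evalP (Θ.comp θ) (Θ a) f :=
  apply_evalHom θ (fun _ => ha) Θ (fun _ => h) f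

theorem evalP_map (h : R →+* S) (θ : S →+* MvPowerSeries υ T) {b : MvPowerSeries υ T}
    (hb : b.constantCoeff = 0) (f : PowerSeries R) :
    evalP θ b (f.map h) = evalP (θ.comp h) b f :=
  evalHom_map h θ (fun _ => b) (fun _ => hb) f

theorem evalP_subst (θ : R →+* MvPowerSeries υ T) {b : MvPowerSeries υ T}
    (hb : b.constantCoeff = 0) {a : PowerSeries R} (ha : PowerSeries.constantCoeff a = 0)
    (f : PowerSeries R) :
    evalP θ b (f.subst a) = evalP θ (evalP θ b a) f := by
  have h : (evalP θ b a).constantCoeff = 0 :=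
    constantCoeff_evalHom_eq_zero θ (fun _ => hb) ha
  rw [powerSeries_subst_eq_evalHom ha]
  refine (apply_evalP _ ha (evalP θ b) h f).trans ?_
  congr 2
  ext1 r
  exact evalP_C θ b r

/-- A homomorphism which restricts to `h` on coefficients commutes with substitution. -/
theorem apply_subst (Θ : MvPowerSeries τ R →+* MvPowerSeries υ S) (h : R →+* S)
    (hC : ∀ r, Θ (MvPowerSeries.C r) = MvPowerSeries.C (h r)) {a : MvPowerSeries τ R}
    (ha : a.constantCoeff = 0) (hΘ : (Θ a).constantCoeff = 0) (f : PowerSeries R) :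
    Θ (f.subst a) = (f.map h).subst (Θ a) := by
  rw [powerSeries_subst_eq_evalHom ha, powerSeries_subst_eq_evalHom hΘ]
  refine (apply_evalP _ ha Θ hΘ f).trans ((evalP_map h MvPowerSeries.C hΘ f).trans ?_).symm
  congr 2
  ext1 r
  exact (hC r).symm

/-- The sum `F(a, b)` of two series for a formal group law. -/
def fadd (F : FormalGroup R) (a b : MvPowerSeries τ R) : MvPowerSeries τ R :=
  F.toPowerSeries.subst ![a, b]

theorem constantCoeff_fadd (F : FormalGroup R) {a b : MvPowerSeries τ R}
    (ha : a.constantCoeff = 0) (hb : b.constantCoeff = 0) : (fadd F a b).constantCoeff = 0 :=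
  constantCoeff_subst_pair ha hb F.zero_constantCoeff

theorem forall_pair {a b : MvPowerSeries τ R} (ha : a.constantCoeff = 0)
    (hb : b.constantCoeff = 0) (i : Fin 2) : (![a, b] i).constantCoeff = 0 := by
  fin_cases i <;> simpa

theorem apply_fadd (Θ : MvPowerSeries τ R →+* MvPowerSeries υ S) (h : R →+* S)
    (hC : ∀ r, Θ (MvPowerSeries.C r) = MvPowerSeries.C (h r)) (F : FormalGroup R)
    {a b : MvPowerSeries τ R} (ha : a.constantCoeff = 0) (hb : b.constantCoeff = 0)
    (hΘa : (Θ a).constantCoeff = 0) (hΘb : (Θ b).constantCoeff = 0) :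
    Θ (fadd F a b) = fadd (F.map h) (Θ a) (Θ b) := by
  have hi (i : Fin 2) : (Θ (![a, b] i)).constantCoeff = 0 := by fin_cases i <;> simpa
  rw [fadd, fadd, subst_eq_evalHom (forall_pair ha hb), subst_eq_evalHom (forall_pair hΘa hΘb),
    apply_evalHom _ (forall_pair ha hb) Θ hi, FormalGroup.map_toPowerSeries,
    evalHom_map _ _ _ (forall_pair hΘa hΘb)]
  congr 2
  · ext1 r; exact hC r
  · funext i; fin_cases i <;> rfl

theorem map_fadd (h : R →+* S) (F : FormalGroup R) {a b : MvPowerSeries τ R}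
    (ha : a.constantCoeff = 0) (hb : b.constantCoeff = 0) :
    (fadd F a b).map h = fadd (F.map h) (a.map h) (b.map h) :=
  map_subst_pair ha hb h _

theorem map_id_law (F : FormalGroup R) : F.map (RingHom.id R) = F := by
  ext1; simp

theorem map_map_law (F : FormalGroup R) (f : R →+* S) (g : S →+* T) :
    (F.map f).map g = F.map (g.comp f) := by
  ext1
  ext m
  simp

theorem fadd_X_X (F : FormalGroup R) :
    fadd F (MvPowerSeries.X 0) (MvPowerSeries.X 1) = F.toPowerSeries := by
  rw [fadd, subst_eq_evalHom (by intro i; fin_cases i <;> simp)]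
  have : ![MvPowerSeries.X 0, MvPowerSeries.X 1] =
      (MvPowerSeries.X : Fin 2 → MvPowerSeries (Fin 2) R) := by
    funext i; fin_cases i <;> rfl
  rw [this, evalHom_C_X]

theorem fadd_zero (F : FormalGroup R) {a : MvPowerSeries τ R} (ha : a.constantCoeff = 0) :
    fadd F a 0 = a :=
  F.add_zero (PowerSeries.HasSubst.of_constantCoeff_zero ha)

theorem zero_fadd (F : FormalGroup R) {a : MvPowerSeries τ R} (ha : a.constantCoeff = 0) :
    fadd F 0 a = a :=
  F.zero_add (PowerSeries.HasSubst.of_constantCoeff_zero ha)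

theorem fadd_assoc (F : FormalGroup R) {a b c : MvPowerSeries τ R} (ha : a.constantCoeff = 0)
    (hb : b.constantCoeff = 0) (hc : c.constantCoeff = 0) :
    fadd F (fadd F a b) c = fadd F a (fadd F b c) :=
  F.assoc' (.of_constantCoeff_zero ha) (.of_constantCoeff_zero hb) (.of_constantCoeff_zero hc)

theorem IsOrderTwo.fadd_self {F : FormalGroup R} (hF : IsOrderTwo F)
    {a : MvPowerSeries τ R} (ha : a.constantCoeff = 0) : fadd F a a = 0 :=
  hF.subst_self ha

theorem fadd_additive {a b : MvPowerSeries τ R} (ha : a.constantCoeff = 0)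
    (hb : b.constantCoeff = 0) : fadd FormalGroup.𝔾ₐ a b = a + b := by
  rw [fadd, FormalGroup.𝔾ₐ_toPowerSeries, MvPowerSeries.subst_add (hasSubst_pair ha hb),
    MvPowerSeries.subst_X (hasSubst_pair ha hb), MvPowerSeries.subst_X (hasSubst_pair ha hb)]
  rfl

@[simp]
theorem map_additive (h : R →+* S) :
    (FormalGroup.𝔾ₐ : FormalGroup R).map h = FormalGroup.𝔾ₐ := by
  ext1; simp

theorem IsOrderTwo.fadd_comm {F : FormalGroup R} (hF : IsOrderTwo F) {a b : MvPowerSeries τ R}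
    (ha : a.constantCoeff = 0) (hb : b.constantCoeff = 0) : fadd F a b = fadd F b a := by
  have hc := hasSubst_pair ha hb
  have h := congrArg (MvPowerSeries.subst ![a, b]) hF.comm
  rw [subst_pair_subst (by simp) (by simp) hc, subst_pair_subst (by simp) (by simp) hc,
    MvPowerSeries.subst_X hc, MvPowerSeries.subst_X hc] at h
  exact h

end OneVariable

/-! ### The group of invertible changes of parameter -/

/-- An invertible change of parameter over `S`. -/
@[ext]
structure Param (S : Type*) [CommRing S] where
  toSeries : PowerSeries S
  constantCoeff_eq : PowerSeries.constantCoeff toSeries = 0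
  isUnit_coeff : IsUnit (PowerSeries.coeff 1 toSeries)

namespace Param

variable {τ υ : Type*} {R S T : Type*} [CommRing R] [CommRing S] [CommRing T]

/-- The value of a change of parameter at a series. -/
def app (g : Param S) (a : MvPowerSeries τ S) : MvPowerSeries τ S := g.toSeries.subst a

theorem constantCoeff_app (g : Param S) {a : MvPowerSeries τ S} (ha : a.constantCoeff = 0) :
    (g.app a).constantCoeff = 0 :=
  PowerSeries.constantCoeff_subst_eq_zero ha _ g.constantCoeff_eq

theorem app_X (g : Param S) : g.app (PowerSeries.X : PowerSeries S) = g.toSeries :=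
  PowerSeries.X_subst _

instance : Mul (Param S) where
  mul g k := ⟨g.toSeries.subst k.toSeries,
    PowerSeries.constantCoeff_subst_eq_zero k.constantCoeff_eq _ g.constantCoeff_eq, by
      rw [coeff_one_subst k.constantCoeff_eq]
      exact g.isUnit_coeff.mul k.isUnit_coeff⟩

instance : One (Param S) where
  one := ⟨PowerSeries.X, by simp, by simp⟩

instance : Inv (Param S) where
  inv g := ⟨g.toSeries.substInvOfIsUnit g.isUnit_coeff, by simp, by simp⟩

theorem mul_app (g k : Param S) {a : MvPowerSeries τ S} (ha : a.constantCoeff = 0) :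
    (g * k).app a = g.app (k.app a) :=
  PowerSeries.subst_comp_subst_apply (.of_constantCoeff_zero' k.constantCoeff_eq)
    (.of_constantCoeff_zero ha) g.toSeries

theorem one_app {a : MvPowerSeries τ S} (ha : a.constantCoeff = 0) :
    (1 : Param S).app a = a :=
  PowerSeries.subst_X (.of_constantCoeff_zero ha)

theorem ext_app {g k : Param S}
    (h : g.app (PowerSeries.X : PowerSeries S) = k.app (PowerSeries.X : PowerSeries S)) :
    g = k := by
  rw [app_X, app_X] at h
  exact Param.ext h

instance : Group (Param S) where
  mul_assoc g k l := ext_app <| by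
    have hX : (PowerSeries.X : PowerSeries S).constantCoeff = 0 := by simp
    rw [mul_app _ _ hX, mul_app _ _ (constantCoeff_app _ hX), mul_app _ _ hX, mul_app _ _ hX]
  one_mul g := ext_app <| by
    have hX : (PowerSeries.X : PowerSeries S).constantCoeff = 0 := by simp
    rw [mul_app _ _ hX, one_app (constantCoeff_app _ hX)]
  mul_one g := ext_app <| by
    have hX : (PowerSeries.X : PowerSeries S).constantCoeff = 0 := by simp
    rw [mul_app _ _ hX, one_app hX]
  inv_mul_cancel g := ext_app <| by
    have hX : (PowerSeries.X : PowerSeries S).constantCoeff = 0 := by simp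
    rw [mul_app _ _ hX, one_app hX]
    exact inv_subst_subst g.toSeries g.constantCoeff_eq g.isUnit_coeff hX

theorem inv_app_app (g : Param S) {a : MvPowerSeries τ S} (ha : a.constantCoeff = 0) :
    g⁻¹.app (g.app a) = a := by
  rw [← mul_app _ _ ha, inv_mul_cancel, one_app ha]

theorem toSeries_mul (g k : Param S) : (g * k).toSeries = g.toSeries.subst k.toSeries := rfl

theorem toSeries_one : (1 : Param S).toSeries = PowerSeries.X := rfl

/-- Base change of a change of parameter. -/
def map (h : R →+* S) : Param R →* Param S where
  toFun g := ⟨g.toSeries.map h, constantCoeff_map_eq_zero h g.constantCoeff_eq, by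
    rw [PowerSeries.coeff_map]; exact g.isUnit_coeff.map h⟩
  map_one' := Param.ext <| PowerSeries.map_X h
  map_mul' g k := Param.ext <| by
    simp only [toSeries_mul]
    exact PowerSeries.map_subst (.of_constantCoeff_zero' k.constantCoeff_eq) _

theorem toSeries_map (h : R →+* S) (g : Param R) : (map h g).toSeries = g.toSeries.map h := rfl

theorem map_map (f : R →+* S) (h : S →+* T) (g : Param R) :
    map h (map f g) = map (h.comp f) g := by
  ext n
  simp [toSeries_map]

theorem map_id (g : Param R) : map (RingHom.id R) g = g := by
  ext n
  simp [toSeries_map]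

theorem apply_app (Θ : MvPowerSeries τ R →+* MvPowerSeries υ S) (h : R →+* S)
    (hC : ∀ r, Θ (MvPowerSeries.C r) = MvPowerSeries.C (h r)) {a : MvPowerSeries τ R}
    (ha : a.constantCoeff = 0) (hΘ : (Θ a).constantCoeff = 0) (g : Param R) :
    Θ (g.app a) = (map h g).app (Θ a) :=
  apply_subst Θ h hC ha hΘ _

theorem map_app (h : R →+* S) {a : MvPowerSeries τ R}
    (ha : a.constantCoeff = 0) (g : Param R) :
    (g.app a).map h = (map h g).app (a.map h) :=
  apply_app (MvPowerSeries.map h) h (by simp) ha (by simp [ha]) g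

instance : MulAction (Param S) (FormalGroup S) where
  smul g F := conjLaw F g.toSeries g.constantCoeff_eq g.isUnit_coeff
  one_smul F := by
    ext1
    have hX (i : Fin 2) : (MvPowerSeries.X i : MvPowerSeries (Fin 2) S).constantCoeff = 0 := by
      simp
    rw [← fadd_X_X]
    refine (conjSeries_subst F _ _ (hX 0) (hX 1)).trans ?_
    change (1 : Param S).app (fadd F ((1 : Param S)⁻¹.app _) ((1 : Param S)⁻¹.app _)) = _
    rw [inv_one, one_app (hX 0), one_app (hX 1),
      one_app (constantCoeff_fadd _ (hX 0) (hX 1)), fadd_X_X]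
  mul_smul g k F := by
    ext1
    have hX (i : Fin 2) : (MvPowerSeries.X i : MvPowerSeries (Fin 2) S).constantCoeff = 0 := by
      simp
    rw [← fadd_X_X, ← fadd_X_X]
    refine (conjSeries_subst F _ _ (by simp) (by simp)).trans ?_
    refine Eq.trans ?_ (conjSeries_subst (conjLaw F _ k.constantCoeff_eq k.isUnit_coeff)
      g.toSeries g.isUnit_coeff (hX 0) (hX 1)).symm
    change (g * k).app (fadd F ((g * k)⁻¹.app _) ((g * k)⁻¹.app _)) = g.app _
    refine Eq.trans ?_ (congrArg g.app (conjSeries_subst F k.toSeries k.isUnit_coeff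
      (constantCoeff_app g⁻¹ (hX 0)) (constantCoeff_app g⁻¹ (hX 1))).symm)
    change _ = g.app (k.app (fadd F (k⁻¹.app (g⁻¹.app _)) (k⁻¹.app (g⁻¹.app _))))
    rw [mul_inv_rev, mul_app _ _ (hX 0), mul_app _ _ (hX 1), mul_app]
    exact constantCoeff_fadd _ (constantCoeff_app _ (constantCoeff_app _ (hX 0)))
      (constantCoeff_app _ (constantCoeff_app _ (hX 1)))

theorem fadd_smul (g : Param S) (F : FormalGroup S) {a b : MvPowerSeries τ S}
    (ha : a.constantCoeff = 0) (hb : b.constantCoeff = 0) :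
    fadd (g • F) a b = g.app (fadd F (g⁻¹.app a) (g⁻¹.app b)) :=
  conjSeries_subst F _ _ ha hb

theorem fadd_smul_app (g : Param S) (F : FormalGroup S) {a b : MvPowerSeries τ S}
    (ha : a.constantCoeff = 0) (hb : b.constantCoeff = 0) :
    fadd (g • F) (g.app a) (g.app b) = g.app (fadd F a b) := by
  rw [fadd_smul _ _ (constantCoeff_app _ ha) (constantCoeff_app _ hb), inv_app_app _ ha,
    inv_app_app _ hb]

theorem law_ext {F G : FormalGroup S}
    (h : fadd F (MvPowerSeries.X 0 : MvPowerSeries (Fin 2) S) (MvPowerSeries.X 1) =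
      fadd G (MvPowerSeries.X 0) (MvPowerSeries.X 1)) : F = G := by
  ext1
  rwa [fadd_X_X, fadd_X_X] at h

/-- The inverse of `g` drops out: an invertible `g` which is a homomorphism from `F` to `G`
transports `F` to `G`. -/
theorem smul_eq_of_fadd {g : Param S} {F G : FormalGroup S}
    (h : g.app (fadd F (MvPowerSeries.X 0 : MvPowerSeries (Fin 2) S) (MvPowerSeries.X 1)) =
      fadd G (g.app (MvPowerSeries.X 0)) (g.app (MvPowerSeries.X 1))) : g • F = G := by
  have hX (i : Fin 2) : (MvPowerSeries.X i : MvPowerSeries (Fin 2) S).constantCoeff = 0 := by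
    simp
  suffices F = g⁻¹ • G by rw [this, smul_inv_smul]
  refine law_ext ?_
  rw [fadd_smul _ _ (hX 0) (hX 1), inv_inv, ← h,
    inv_app_app _ (constantCoeff_fadd _ (hX 0) (hX 1))]

theorem map_smul (h : R →+* S) (g : Param R) (F : FormalGroup R) :
    (g • F).map h = map h g • F.map h := by
  have hX (i : Fin 2) : (MvPowerSeries.X i : MvPowerSeries (Fin 2) R).constantCoeff = 0 := by
    simp
  symm
  refine smul_eq_of_fadd ?_
  have := congrArg (MvPowerSeries.map h) (fadd_smul_app g F (hX 0) (hX 1))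
  rw [map_fadd _ _ (constantCoeff_app _ (hX 0)) (constantCoeff_app _ (hX 1)),
    map_app _ (hX 0), map_app _ (hX 1), map_app _ (constantCoeff_fadd _ (hX 0) (hX 1)),
    map_fadd _ _ (hX 0) (hX 1)] at this
  simpa using this.symm

theorem isOrderTwo_smul (g : Param S) {F : FormalGroup S} (hF : IsOrderTwo F) :
    IsOrderTwo (g • F) :=
  isOrderTwo_conjLaw F _ _ _ hF

end Param

/-! ### Total squares as evaluation homomorphisms -/

section Isogeny

variable {σ τ υ : Type*} {R S T : Type*} [CommRing R] [CommRing S] [CommRing T]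

theorem coeff_coeffwise (D : R →+* PowerSeries R) (f : MvPowerSeries σ R) (m : Option σ →₀ ℕ) :
    MvPowerSeries.coeff m (coeffwise D f) =
      PowerSeries.coeff (m none) (D (MvPowerSeries.coeff m.some f)) := rfl

theorem coeff_optionElim_coeffwise (D : R →+* PowerSeries R) (f : MvPowerSeries σ R) (n : ℕ)
    (x : σ →₀ ℕ) : MvPowerSeries.coeff (x.optionElim n) (coeffwise D f) =
      PowerSeries.coeff n (D (MvPowerSeries.coeff x f)) := by
  rw [coeff_coeffwise]
  simp

/-- `coeffwise` as a ring homomorphism. -/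
def coeffwiseHom (D : R →+* PowerSeries R) : MvPowerSeries σ R →+* MvPowerSeries (Option σ) R where
  toFun := coeffwise D
  map_one' := by
    classical
    refine (MvPowerSeries.optionEquivLeft σ R).injective ?_
    ext n x
    rw [MvPowerSeries.coeff_coeff_optionEquivLeft, coeff_optionElim_coeffwise,
      map_one (MvPowerSeries.optionEquivLeft σ R), MvPowerSeries.coeff_one, PowerSeries.coeff_one]
    split_ifs with h1 h2 h2
    · simp [h1, h2]
    · simp [h2, PowerSeries.coeff_one]
    · simp [h1, h2, MvPowerSeries.coeff_one]
    · simp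
  map_zero' := by
    ext m
    simp [coeff_coeffwise]
  map_add' f g := by
    ext m
    simp [coeff_coeffwise]
  map_mul' f g := by
    classical
    refine (MvPowerSeries.optionEquivLeft σ R).injective ?_
    ext n x
    rw [MvPowerSeries.coeff_coeff_optionEquivLeft, coeff_optionElim_coeffwise,
      map_mul (MvPowerSeries.optionEquivLeft σ R), MvPowerSeries.coeff_mul, PowerSeries.coeff_mul,
      map_sum, map_sum, map_sum]
    simp only [MvPowerSeries.coeff_mul, map_mul, PowerSeries.coeff_mul,
      MvPowerSeries.coeff_coeff_optionEquivLeft, coeff_optionElim_coeffwise]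
    exact Finset.sum_comm

theorem coeffwiseHom_C (D : R →+* PowerSeries R) (r : R) :
    coeffwiseHom (σ := σ) D (MvPowerSeries.C r) =
      evalP MvPowerSeries.C (MvPowerSeries.X none) (D r) := by
  classical
  ext m
  rw [← powerSeries_subst_eq_evalHom (by simp), PowerSeries.coeff_subst_single]
  change PowerSeries.coeff (m none) (D (MvPowerSeries.coeff m.some (MvPowerSeries.C r))) = _
  rw [MvPowerSeries.coeff_C]
  have : m.some = 0 ↔ m = Finsupp.single none (m none) := by
    refine ⟨fun h => ?_, fun h => ?_⟩
    · ext i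
      rcases i with _ | i
      · simp
      · simpa using DFunLike.congr_fun h i
    · ext i
      rw [h]
      simp
  simp only [this]
  split_ifs <;> simp

theorem coeffwiseHom_X (D : R →+* PowerSeries R) (i : σ) :
    coeffwiseHom D (MvPowerSeries.X i : MvPowerSeries σ R) = MvPowerSeries.X (some i) := by
  classical
  ext m
  change PowerSeries.coeff (m none) (D (MvPowerSeries.coeff m.some (MvPowerSeries.X i))) = _
  rw [MvPowerSeries.coeff_X, MvPowerSeries.coeff_X]
  have : m = Finsupp.single (some i) 1 ↔ m.some = Finsupp.single i 1 ∧ m none = 0 := by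
    refine ⟨?_, fun h => ?_⟩
    · rintro rfl
      refine ⟨?_, by simp⟩
      ext j
      simp [Finsupp.single_apply]
    · ext j
      rcases j with _ | j
      · simp [h.2]
      · simpa [Finsupp.single_apply] using DFunLike.congr_fun h.1 j
  simp only [this]
  by_cases h1 : m.some = Finsupp.single i 1 <;> simp [h1, PowerSeries.coeff_one]

theorem constantCoeff_isogenySubst (F : FormalGroup R) (i : Option σ) :
    (isogenySubst F i).constantCoeff = 0 := by
  rcases i with _ | i <;> simp [isogenySubst]

theorem expand_injective : Function.Injective
    (MvPowerSeries.expand 2 two_ne_zero : MvPowerSeries σ R →ₐ[R] MvPowerSeries σ R) := by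
  intro f g h
  ext m
  have := congrArg (MvPowerSeries.coeff (2 • m)) h
  rwa [MvPowerSeries.coeff_expand_smul, MvPowerSeries.coeff_expand_smul] at this

variable [Finite σ]

/-- The evaluation `t ↦ t`, `x ↦ x F(x, t)` on power series with coefficients in `R[[t]]`. -/
def isogenyEval (F : FormalGroup R) :
    MvPowerSeries σ (PowerSeries R) →+* MvPowerSeries (Option σ) R :=
  evalHom (evalP MvPowerSeries.C (MvPowerSeries.X none)) fun i => isogenySubst F (some i)

theorem isogenyEval_C (F : FormalGroup R) (c : PowerSeries R) :
    isogenyEval (σ := σ) F (MvPowerSeries.C c) =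
      evalP MvPowerSeries.C (MvPowerSeries.X none) c :=
  evalHom_C _ _ c

theorem isogenyEval_X (F : FormalGroup R) (i : σ) :
    isogenyEval F (MvPowerSeries.X i) = MvPowerSeries.X (some i) *
      fadd F (MvPowerSeries.X (some i)) (MvPowerSeries.X none) :=
  evalHom_X _ (fun i => constantCoeff_isogenySubst F (some i)) i

/-- Both sides are ring homomorphisms in `f` with the same values on constants and variables. This
replaces the coefficientwise definition by a composite to which uniqueness arguments apply. -/
theorem extendSquare_eq (F : FormalGroup R) (D : R →+* PowerSeries R) (f : MvPowerSeries σ R) :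
    extendSquare F D f = isogenyEval F (f.map D) := by
  rw [extendSquare, subst_eq_evalHom (constantCoeff_isogenySubst F), isogenyEval,
    evalHom_map _ _ _ (fun i => constantCoeff_isogenySubst F (some i))]
  change (evalHom MvPowerSeries.C (isogenySubst F)).comp (coeffwiseHom D) f = _
  congr 1
  refine eq_evalHom _ (fun i => constantCoeff_isogenySubst F (some i)) (fun r => ?_) fun i => ?_
  · rw [RingHom.comp_apply, coeffwiseHom_C]
    have h : evalHom MvPowerSeries.C (isogenySubst F) (MvPowerSeries.X (none : Option σ)) =
        MvPowerSeries.X none := evalHom_X _ (constantCoeff_isogenySubst F) none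
    rw [apply_evalP _ (by simp) _ (by simp [h]), h]
    simp only [RingHom.comp_apply]
    congr 2
    ext1 r
    simp
  · rw [RingHom.comp_apply, coeffwiseHom_X, evalHom_X _ (constantCoeff_isogenySubst F)]

/-- The reduction `t ↦ 0`. -/
def modT (σ S : Type*) [Finite σ] [CommRing S] :
    MvPowerSeries (Option σ) S →+* MvPowerSeries σ S :=
  evalHom MvPowerSeries.C fun i => i.elim 0 MvPowerSeries.X

theorem modT_none : modT σ S (MvPowerSeries.X none) = 0 :=
  evalHom_X _ (by rintro (_ | _) <;> simp) none

theorem modT_some (i : σ) : modT σ S (MvPowerSeries.X (some i)) = MvPowerSeries.X i :=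
  evalHom_X _ (by rintro (_ | _) <;> simp) (some i)

theorem modT_C (r : S) : modT σ S (MvPowerSeries.C r) = MvPowerSeries.C r := evalHom_C _ _ r

theorem modT_fadd (F : FormalGroup R) (i : σ) :
    modT σ R (fadd F (MvPowerSeries.X (some i)) (MvPowerSeries.X none)) = MvPowerSeries.X i := by
  rw [apply_fadd _ (RingHom.id R) modT_C _ (by simp) (by simp) (by simp [modT_some])
    (by simp [modT_none]), modT_some, modT_none, map_id_law, fadd_zero _ (by simp)]

theorem modT_inT (f : PowerSeries R) :
    modT σ R (evalP MvPowerSeries.C (MvPowerSeries.X none) f) =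
      MvPowerSeries.C (PowerSeries.constantCoeff f) := by
  suffices (modT σ R).comp (evalP MvPowerSeries.C (MvPowerSeries.X none)) =
    (MvPowerSeries.C).comp (PowerSeries.constantCoeff (R := R)) from RingHom.congr_fun this f
  have hX : evalP (MvPowerSeries.C (R := R)) (MvPowerSeries.X (none : Option σ)) PowerSeries.X =
    MvPowerSeries.X none := evalP_X _ (by simp)
  refine powerSeries_ringHom_ext ?_ (fun r => ?_) ?_
  · rw [RingHom.comp_apply, hX, modT_none, map_zero]
  · rw [RingHom.comp_apply, evalP_C, modT_C]
    simp
  · rw [RingHom.comp_apply, hX, modT_none]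
    simp

/-- At `t = 0` the isogeny `x F(x, t)` becomes `x · x`. -/
theorem modT_isogenyEval (F : FormalGroup R) (f : MvPowerSeries σ (PowerSeries R)) :
    modT σ R (isogenyEval F f) =
    MvPowerSeries.expand 2 two_ne_zero (f.map PowerSeries.constantCoeff) := by
  suffices (modT σ R).comp (isogenyEval F) =
      (MvPowerSeries.expand 2 two_ne_zero : MvPowerSeries σ R →ₐ[R] _).toRingHom.comp
        (MvPowerSeries.map PowerSeries.constantCoeff) from RingHom.congr_fun this f
  have hiso (i : σ) : modT σ R (isogenyEval F (MvPowerSeries.X i)) = MvPowerSeries.X i ^ 2 := by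
    rw [isogenyEval_X, map_mul, modT_fadd, modT_some, sq]
  refine ringHom_ext (fun i => ?_) (fun r => ?_) fun i => ?_
  · rw [RingHom.comp_apply, hiso]
    simp
  · rw [RingHom.comp_apply, isogenyEval_C, modT_inT]
    simp [MvPowerSeries.expand_C]
  · rw [RingHom.comp_apply, hiso]
    simp

/-- Modulo `t` the map is `x ↦ x²`, which is injective, so a series in the kernel is divisible by
`t`. Since `t` is a nonzerodivisor in the target, the quotient is again in the kernel, and the
division continues indefinitely. -/
theorem isogenyEval_injective (F : FormalGroup R) :
    Function.Injective (isogenyEval (σ := σ) F) := by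
  have step (f : MvPowerSeries σ (PowerSeries R)) (hf : isogenyEval F f = 0) :
      ∀ d, PowerSeries.constantCoeff (MvPowerSeries.coeff d f) = 0 := fun d => by
    have h := modT_isogenyEval F f
    rw [hf, map_zero] at h
    have := congrArg (MvPowerSeries.coeff (2 • d)) h
    rw [MvPowerSeries.coeff_expand_smul, MvPowerSeries.coeff_map] at this
    simpa using this.symm
  have key (k : ℕ) (f : MvPowerSeries σ (PowerSeries R)) (hf : isogenyEval F f = 0) :
      ∀ d, PowerSeries.coeff k (MvPowerSeries.coeff d f) = 0 := by
    induction k generalizing f with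
    | zero => simpa using step f hf
    | succ k ih =>
      intro d
      -- The quotient of `f` by `t`.
      let f' : MvPowerSeries σ (PowerSeries R) := fun d =>
        PowerSeries.mk fun n => PowerSeries.coeff (n + 1) (MvPowerSeries.coeff d f)
      have hc (d) : MvPowerSeries.coeff d f' =
        PowerSeries.mk fun n => PowerSeries.coeff (n + 1) (MvPowerSeries.coeff d f) := rfl
      have hff : f = MvPowerSeries.C PowerSeries.X * f' := by
        ext d n
        rw [MvPowerSeries.coeff_C_mul, hc]
        rcases n with _ | n
        · simpa using step f hf d
        · rw [PowerSeries.coeff_succ_X_mul, PowerSeries.coeff_mk]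
      have h0 : isogenyEval F f' = 0 := by
        rw [hff, map_mul, isogenyEval_C, evalP_X _ (by simp)] at hf
        exact (mem_nonZeroDivisors_iff.1 MvPowerSeries.X_mem_nonzeroDivisors).1 _ hf
      have := ih f' h0 d
      rwa [hc, PowerSeries.coeff_mk] at this
  rw [injective_iff_map_eq_zero]
  intro f hf
  ext d k
  simpa using key k f hf d

end Isogeny

/-! ### Squaring in characteristic two -/

section Frobenius

variable (S : Type*) [CommRing S] [Algebra (ZMod 2) S]

theorem two_eq_zero_of_algebra : (2 : S) = 0 := by
  have h := map_ofNat (algebraMap (ZMod 2) S) 2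
  rw [show (OfNat.ofNat 2 : ZMod 2) = 0 from rfl, map_zero] at h
  exact h.symm

/-- The squaring homomorphism of a `ℤ/2`-algebra. -/
def square : S →+* S where
  toFun a := a ^ 2
  map_one' := by simp
  map_zero' := by simp
  map_mul' a b := by ring
  map_add' a b := by
    linear_combination a * b * two_eq_zero_of_algebra S

variable {S} {σ : Type*}

theorem square_apply (a : S) : square S a = a ^ 2 := rfl

theorem add_self_eq_zero (a : S) : a + a = 0 := by
  linear_combination a * two_eq_zero_of_algebra S

/-- Squaring a series is additive in characteristic two, and it acts as Frobenius on coefficients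
and as `x ↦ x²` on variables. -/
theorem expand_map_square [Finite σ] (f : MvPowerSeries σ S) :
    MvPowerSeries.expand 2 two_ne_zero (f.map (square S)) = f ^ 2 := by
  suffices (MvPowerSeries.expand 2 two_ne_zero : MvPowerSeries σ S →ₐ[S] _).toRingHom.comp
      (MvPowerSeries.map (square S)) = square (MvPowerSeries σ S) from RingHom.congr_fun this f
  refine ringHom_ext (fun i => ?_) (fun r => ?_) fun i => ?_
  · simp
  · simp [square_apply, MvPowerSeries.expand_C]
  · simp [square_apply]

end Frobenius

/-! ### The norm of a change of parameter along the isogeny `x ↦ x F(x, t)` -/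

section Norm

variable {τ υ : Type*} {R S T : Type*} [CommRing R] [CommRing S] [CommRing T]

/-- The series `x` in `S[[x, t]]`. -/
abbrev serX (S : Type*) [CommRing S] : MvPowerSeries (Option Unit) S := MvPowerSeries.X (some ())

/-- The series `t` in `S[[x, t]]`. -/
abbrev serT (S : Type*) [CommRing S] : MvPowerSeries (Option Unit) S := MvPowerSeries.X none

@[simp]
theorem constantCoeff_powerSeries_X :
    MvPowerSeries.constantCoeff (PowerSeries.X : PowerSeries S) = 0 :=
  MvPowerSeries.constantCoeff_X ()

/-- The inclusion of `S[[t]]` in `S[[x, t]]`. -/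
def inT (S : Type*) [CommRing S] : PowerSeries S →+* MvPowerSeries (Option Unit) S :=
  evalP MvPowerSeries.C (serT S)

/-- The restriction of a series in `x` and `t` to `x = 0`. -/
def atZero (S : Type*) [CommRing S] : MvPowerSeries (Option Unit) S →+* PowerSeries S :=
  evalHom (τ := Unit) MvPowerSeries.C fun i => i.elim PowerSeries.X fun _ => 0

/-- The substitution `x ↦ F(x, t)`. -/
def translate (F : FormalGroup S) :
    MvPowerSeries (Option Unit) S →+* MvPowerSeries (Option Unit) S :=
  evalHom MvPowerSeries.C fun i => i.elim (serT S) fun _ => fadd F (serX S) (serT S)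

theorem constantCoeff_fadd_X_T (F : FormalGroup S) :
    (fadd F (serX S) (serT S)).constantCoeff = 0 :=
  constantCoeff_fadd F (by simp) (by simp)

theorem inT_X : inT S PowerSeries.X = serT S := evalP_X _ (by simp)

theorem inT_C (r : S) : inT S (PowerSeries.C r) = MvPowerSeries.C r := evalP_C _ _ r

theorem atZero_X : atZero S (serX S) = 0 :=
  evalHom_X (τ := Unit) _ (by rintro (_ | _) <;> simp) (some ())

theorem atZero_T : atZero S (serT S) = PowerSeries.X :=
  evalHom_X (τ := Unit) _ (by rintro (_ | _) <;> simp) none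

theorem atZero_C (r : S) : atZero S (MvPowerSeries.C r) = PowerSeries.C r := evalHom_C _ _ r

theorem translate_X (F : FormalGroup S) : translate F (serX S) = fadd F (serX S) (serT S) :=
  evalHom_X _ (by rintro (_ | _) <;> simp [constantCoeff_fadd_X_T]) (some ())

theorem translate_T (F : FormalGroup S) : translate F (serT S) = serT S :=
  evalHom_X _ (by rintro (_ | _) <;> simp [constantCoeff_fadd_X_T]) none

theorem translate_C (F : FormalGroup S) (r : S) :
    translate F (MvPowerSeries.C r) = MvPowerSeries.C r := evalHom_C _ _ r

theorem atZero_inT (f : PowerSeries S) : atZero S (inT S f) = f := by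
  have : (atZero S).comp (inT S) = RingHom.id _ :=
    powerSeries_ringHom_ext (by simp [inT_X, atZero_T]) (by simp [inT_C, atZero_C])
      (by simp [inT_X, atZero_T])
  exact RingHom.congr_fun this f

theorem translate_inT (F : FormalGroup S) (f : PowerSeries S) :
    translate F (inT S f) = inT S f := by
  have : (translate F).comp (inT S) = inT S :=
    powerSeries_ringHom_ext (by simp [inT_X, translate_T]) (by simp [inT_C, translate_C])
      (by simp [inT_X, translate_T])
  exact RingHom.congr_fun this f

/-- Associativity and `F(t, t) = 0` give `F(F(x, t), t) = x`; translation by `t` is therefore an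
involution. -/
theorem translate_fadd {F : FormalGroup S} (hF : IsOrderTwo F) :
    translate F (fadd F (serX S) (serT S)) = serX S := by
  have hx : (serX S).constantCoeff = 0 := by simp
  have ht : (serT S).constantCoeff = 0 := by simp
  rw [apply_fadd _ (RingHom.id S) (translate_C F) _ hx ht
      (by rw [translate_X, constantCoeff_fadd_X_T]) (by rw [translate_T, ht]), map_id_law,
    translate_X, translate_T, fadd_assoc F hx ht ht, hF.fadd_self ht, fadd_zero F hx]

theorem translate_translate {F : FormalGroup S} (hF : IsOrderTwo F)
    (v : MvPowerSeries (Option Unit) S) : translate F (translate F v) = v := by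
  have h : ∀ i, translate F (translate F (MvPowerSeries.X i)) = MvPowerSeries.X i := by
    rintro (_ | _)
    · rw [translate_T, translate_T]
    · exact (congrArg (translate F) (translate_X F)).trans (translate_fadd hF)
  have : (translate F).comp (translate F) = RingHom.id _ :=
    ringHom_ext (fun i => by simp [h]) (fun r => by simp [translate_C]) fun i => by simp [h]
  exact RingHom.congr_fun this v

theorem atZero_fadd (F : FormalGroup S) :
    atZero S (fadd F (serX S) (serT S)) = PowerSeries.X := by
  rw [apply_fadd (υ := Unit) _ (RingHom.id S) atZero_C F (MvPowerSeries.constantCoeff_X _)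
      (MvPowerSeries.constantCoeff_X _) (by rw [atZero_X, map_zero]) (by rw [atZero_T]; simp),
    map_id_law, atZero_X, atZero_T, zero_fadd (τ := Unit) F (by simp)]

theorem serX_dvd_of_atZero {v : MvPowerSeries (Option Unit) S} (hv : atZero S v = 0) :
    serX S ∣ v := by
  classical
  -- The part of `v` free of `x`; it vanishes once `v` vanishes at `x = 0`.
  let w : PowerSeries S := PowerSeries.mk fun n =>
    MvPowerSeries.coeff (Finsupp.single none n) v
  have h : serX S ∣ v - inT S w := by
    rw [MvPowerSeries.X_dvd_iff]
    intro m hm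
    rw [map_sub, inT, ← powerSeries_subst_eq_evalHom (by simp), PowerSeries.coeff_subst_single,
      sub_eq_zero]
    have : m = Finsupp.single none (m none) := by
      ext i
      rcases i with _ | i
      · simp
      · simpa using hm
    rw [if_pos this, PowerSeries.coeff_mk, ← this]
  obtain ⟨q, hq⟩ := h
  have h2 := congrArg (atZero S) hq
  rw [map_sub, map_mul, atZero_X, zero_mul, atZero_inT, hv, zero_sub, neg_eq_zero] at h2
  exact ⟨q, by rw [← hq, h2, map_zero, sub_zero]⟩

theorem isLeftRegular_serX : IsLeftRegular (serX S) := fun a b h => by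
  rw [← sub_eq_zero, ← mul_sub] at h
  exact sub_eq_zero.1 ((mem_nonZeroDivisors_iff.1 MvPowerSeries.X_mem_nonzeroDivisors).1 _ h)

/-- Translation is an automorphism exchanging `F(x, t)` with the variable `x`, which is regular. -/
theorem isLeftRegular_fadd {F : FormalGroup S} (hF : IsOrderTwo F) :
    IsLeftRegular (fadd F (serX S) (serT S)) := fun a b h => by
  have := congrArg (translate F) h
  simp only [map_mul, translate_fadd hF] at this
  have := congrArg (translate F) (isLeftRegular_serX this)
  rwa [translate_translate hF, translate_translate hF] at this

/-- An invariant series that vanishes at `x = 0` is divisible by `x`, hence by its translate `F(x,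
t)`, and in fact by the product. The quotient is invariant because the product is invariant and both
its factors are regular. This is one step of the expansion in powers of `x F(x, t)`. -/
theorem exists_invariant_quotient {F : FormalGroup S} (hF : IsOrderTwo F)
    {v : MvPowerSeries (Option Unit) S} (hv : translate F v = v) :
    ∃ q, translate F q = q ∧
      v = inT S (atZero S v) + serX S * fadd F (serX S) (serT S) * q := by
  obtain ⟨a, ha⟩ := serX_dvd_of_atZero (v := v - inT S (atZero S v)) (by simp [atZero_inT])
  have h1 := congrArg (translate F) ha
  rw [map_sub, translate_inT, hv, ha, map_mul, translate_X] at h1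
  -- At `x = 0` the relation `x a = F(x, t) · translate a` reads `0 = t · (translate a)(0)`, so
  -- `translate a` is again divisible by `x`.
  have h2 := congrArg (atZero S) h1
  rw [map_mul, map_mul, atZero_X, zero_mul, atZero_fadd] at h2
  obtain ⟨b, hb⟩ := serX_dvd_of_atZero (v := translate F a)
    (PowerSeries.X_mul_cancel (h2.symm.trans (mul_zero _).symm))
  have h3 := congrArg (translate F) hb
  rw [translate_translate hF, map_mul, translate_X] at h3
  rw [h3, ← mul_assoc] at ha
  refine ⟨translate F b, ?_, by rw [← ha]; ring⟩
  have h4 := congrArg (translate F) ha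
  simp only [map_mul, map_sub, translate_inT, hv, translate_X, translate_fadd hF] at h4
  rw [ha, mul_assoc, mul_assoc, mul_left_comm (fadd F _ _)] at h4
  exact (isLeftRegular_fadd hF (isLeftRegular_serX h4)).symm

/-- Iterating the division, the values at `x = 0` of the successive quotients are the coefficients
of the expansion in `x F(x, t)`. -/
theorem exists_isogenyEval_eq {F : FormalGroup S} (hF : IsOrderTwo F)
    {v : MvPowerSeries (Option Unit) S} (hv : translate F v = v) :
    ∃ n : PowerSeries (PowerSeries S), isogenyEval (σ := Unit) F n = v := by
  choose q hq hvq using fun v : {v // translate F v = v} => exists_invariant_quotient hF v.2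
  let Q (n : ℕ) : {v // translate F v = v} := (fun v => ⟨q v, hq v⟩)^[n] ⟨v, hv⟩
  have hQ (n : ℕ) : (Q n : MvPowerSeries (Option Unit) S) = inT S (atZero S (Q n)) +
      serX S * fadd F (serX S) (serT S) * Q (n + 1) := by
    refine (hvq (Q n)).trans ?_
    simp only [Q, Function.iterate_succ_apply']
  let G (n : ℕ) : PowerSeries (PowerSeries S) := PowerSeries.mk fun k => atZero S (Q (k + n))
  have hG (n : ℕ) : G n = PowerSeries.C (atZero S (Q n)) + PowerSeries.X * G (n + 1) := by
    refine PowerSeries.ext fun k => ?_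
    rcases k with _ | k
    · simp [G]
    · simp [G, PowerSeries.coeff_succ_X_mul, add_right_comm, add_assoc]
  -- The error at stage `n` is `x F(x, t)` times the error at stage `n + 1`, so it is divisible by
  -- every power of `x`.
  have hstep (n : ℕ) : isogenyEval (σ := Unit) F (G n) - Q n = serX S *
      (fadd F (serX S) (serT S) * (isogenyEval (σ := Unit) F (G (n + 1)) - Q (n + 1))) := by
    have h1 : isogenyEval (σ := Unit) F (PowerSeries.C (atZero S (Q n))) =
        inT S (atZero S (Q n)) := isogenyEval_C F _
    have h2 : isogenyEval (σ := Unit) F (PowerSeries.X : PowerSeries (PowerSeries S)) =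
        serX S * fadd F (serX S) (serT S) := isogenyEval_X F ()
    rw [hQ n, hG n, map_add, map_mul, h1, h2]
    ring
  have hdvd (m : ℕ) : ∀ n, serX S ^ m ∣ isogenyEval (σ := Unit) F (G n) - Q n := by
    induction m with
    | zero => simp
    | succ m ih =>
      intro n
      rw [hstep, pow_succ']
      exact mul_dvd_mul_left _ ((ih (n + 1)).mul_left _)
  refine ⟨G 0, sub_eq_zero.1 ?_⟩
  ext d
  exact MvPowerSeries.X_pow_dvd_iff.1 (hdvd (d (some ()) + 1) 0) d (Nat.lt_succ_self _)

/-- The series `g(x) g(F(x, t))`. -/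
def normProd (F : FormalGroup S) (g : Param S) : MvPowerSeries (Option Unit) S :=
  g.app (serX S) * g.app (fadd F (serX S) (serT S))

theorem modT_normProd (F : FormalGroup S) (g : Param S) :
    modT Unit S (normProd F g) = g.toSeries ^ 2 := by
  have hx : modT Unit S (serX S) = PowerSeries.X := modT_some ()
  have hxt : modT Unit S (fadd F (serX S) (serT S)) = PowerSeries.X := modT_fadd F ()
  rw [normProd, map_mul, g.apply_app (υ := Unit) _ (RingHom.id S) modT_C
    (MvPowerSeries.constantCoeff_X _) (by rw [hx]; simp),
    g.apply_app (υ := Unit) _ (RingHom.id S) modT_C (constantCoeff_fadd_X_T F)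
    (by rw [hxt]; simp), hx, hxt, Param.map_id, Param.app_X, sq]

variable [Algebra (ZMod 2) S]

/-- At `t = 0` the defining equation of the norm reads `n₀(x²) = g(x)²`, so `n₀` is the Frobenius
twist of `g`. This is what makes the condition `D_0(a) = a²` compatible with changes of parameter.
-/
theorem map_constantCoeff_of_isogenyEval {F : FormalGroup S} {g : Param S}
    {n : PowerSeries (PowerSeries S)} (h : isogenyEval (σ := Unit) F n = normProd F g) :
    PowerSeries.map PowerSeries.constantCoeff n = PowerSeries.map (square S) g.toSeries := by
  refine expand_injective (σ := Unit) ?_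
  refine ((modT_isogenyEval (σ := Unit) F n).symm.trans ?_).trans
    (expand_map_square (σ := Unit) _).symm
  rw [h, modT_normProd]

/-- Translation exchanges the two factors of `g(x) g(F(x, t))`, so the product is invariant and
hence a series in `x F(x, t)`. -/
theorem exists_norm {F : FormalGroup S} (hF : IsOrderTwo F) (g : Param S) :
    ∃ n : Param (PowerSeries S), isogenyEval (σ := Unit) F n.toSeries = normProd F g := by
  have hx : (serX S).constantCoeff = 0 := by simp
  have hxt := constantCoeff_fadd_X_T F
  have hinv : translate F (normProd F g) = normProd F g := by
    rw [normProd, map_mul, g.apply_app _ (RingHom.id S) (translate_C F) hx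
      (by rw [translate_X, hxt]), g.apply_app _ (RingHom.id S) (translate_C F) hxt
      (by rw [translate_fadd hF, hx]), translate_X, translate_fadd hF, Param.map_id, mul_comm]
  obtain ⟨n, hn⟩ := exists_isogenyEval_eq hF hinv
  have h0 : PowerSeries.constantCoeff n = 0 := by
    -- At `x = 0` the right side contains the factor `g(0) = 0`, while only the constant term of `n`
    -- survives on the left.
    have h := congrArg (atZero S) hn
    rw [normProd, map_mul, g.apply_app (υ := Unit) _ (RingHom.id S) atZero_C hx
      (by rw [atZero_X, map_zero]), atZero_X] at h
    have h2 : Param.app (Param.map (RingHom.id S) g) (0 : PowerSeries S) = 0 :=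
      PowerSeries.subst_zero_of_constantCoeff_zero (Param.constantCoeff_eq _)
    rw [h2, zero_mul] at h
    rw [← h]
    have : (atZero S).comp (isogenyEval (σ := Unit) F) =
        (PowerSeries.constantCoeff (R := PowerSeries S) :
          PowerSeries (PowerSeries S) →+* PowerSeries S) := by
      have hX : isogenyEval (σ := Unit) F (PowerSeries.X : PowerSeries (PowerSeries S)) =
        serX S * fadd F (serX S) (serT S) := isogenyEval_X F ()
      refine powerSeries_ringHom_ext ?_ (fun c => ?_) ?_
      · rw [RingHom.comp_apply, hX, map_mul, atZero_X, zero_mul, map_zero]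
      · rw [PowerSeries.constantCoeff_C]
        refine (congrArg (atZero S) (isogenyEval_C (σ := Unit) F c)).trans (atZero_inT c)
      · rw [RingHom.comp_apply, hX, map_mul, atZero_X, zero_mul, PowerSeries.constantCoeff_X]
    exact (RingHom.congr_fun this n).symm
  -- A series in `t` is a unit as soon as its constant term is; here that is the square of the
  -- linear coefficient of `g`.
  refine ⟨⟨n, h0, PowerSeries.isUnit_iff_constantCoeff.2 ?_⟩, hn⟩
  have h := map_constantCoeff_of_isogenyEval hn
  have h1 := congrArg (PowerSeries.coeff 1) h
  rw [PowerSeries.coeff_map, PowerSeries.coeff_map] at h1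
  rw [h1]
  exact g.isUnit_coeff.map _

end Norm

/-! ### Reparametrisation, the norm cocycle and Lubin quotients -/

section NormProperties

variable {σ τ υ : Type*} {R S T : Type*} [CommRing R] [CommRing S] [CommRing T]

/-- The change of variable `t ↦ g(t)` on `S[[t]]`. -/
def reparam (g : Param S) : PowerSeries S →+* PowerSeries S :=
  evalP (τ := Unit) MvPowerSeries.C g.toSeries

theorem reparam_apply (g : Param S) (f : PowerSeries S) : reparam g f = f.subst g.toSeries :=
  (powerSeries_subst_eq_evalHom (τ := Unit) g.constantCoeff_eq f).symm

theorem reparam_C (g : Param S) (r : S) : reparam g (PowerSeries.C r) = PowerSeries.C r :=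
  evalP_C (τ := Unit) _ _ r

theorem reparam_X (g : Param S) : reparam g PowerSeries.X = g.toSeries :=
  evalP_X (τ := Unit) _ g.constantCoeff_eq

/-- Substitution is contravariant: `t ↦ g(k(t))` first replaces `t` by `g(t)` and then the new
variable by `k(t)`. -/
theorem reparam_mul (g k : Param S) : reparam (g * k) = (reparam k).comp (reparam g) := by
  refine powerSeries_ringHom_ext (τ := Unit) ?_ (fun r => ?_) ?_
  · rw [reparam_X]; exact (g * k).constantCoeff_eq
  · rw [RingHom.comp_apply, reparam_C, reparam_C, reparam_C]
  · rw [RingHom.comp_apply, reparam_X, reparam_X, reparam_apply, Param.toSeries_mul]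

theorem reparam_one : reparam (1 : Param S) = RingHom.id _ :=
  powerSeries_ringHom_ext (τ := Unit) (by rw [reparam_X]; exact (1 : Param S).constantCoeff_eq)
    (fun r => reparam_C 1 r) (reparam_X 1)

theorem reparam_inv_comp (g : Param S) : (reparam g⁻¹).comp (reparam g) = RingHom.id _ := by
  rw [← reparam_mul, mul_inv_cancel, reparam_one]

theorem reparam_comp_inv (g : Param S) : (reparam g).comp (reparam g⁻¹) = RingHom.id _ := by
  rw [← reparam_mul, inv_mul_cancel, reparam_one]

theorem constantCoeff_reparam (g : Param S) (f : PowerSeries S) :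
    PowerSeries.constantCoeff (reparam g f) = PowerSeries.constantCoeff f :=
  (constantCoeff_evalHom (σ := Unit) (τ := Unit) _ (fun _ => g.constantCoeff_eq) f).trans
    (MvPowerSeries.constantCoeff_C _)

theorem map_reparam (h : R →+* S) (g : Param R) (f : PowerSeries R) :
    PowerSeries.map h (reparam g f) = reparam (Param.map h g) (PowerSeries.map h f) := by
  rw [reparam_apply, reparam_apply]
  exact PowerSeries.map_subst (.of_constantCoeff_zero' g.constantCoeff_eq) f

theorem map_comp_reparam (h : R →+* S) (g : Param R) :
    (PowerSeries.map h).comp (reparam g) = (reparam (Param.map h g)).comp (PowerSeries.map h) :=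
  RingHom.ext (map_reparam h g)

theorem map_isogenyEval [Finite σ] (h : R →+* S) (F : FormalGroup R)
    (f : MvPowerSeries σ (PowerSeries R)) :
    (isogenyEval F f).map h = isogenyEval (F.map h) (f.map (PowerSeries.map h)) := by
  have hc (i : σ) := constantCoeff_isogenySubst F (some i)
  have hX (i : σ) : (isogenyEval F (MvPowerSeries.X i)).map h =
      isogenyEval (F.map h) (MvPowerSeries.X i) := by
    rw [isogenyEval_X, isogenyEval_X, map_mul, map_fadd h F (by simp) (by simp)]
    simp
  suffices (MvPowerSeries.map h).comp (isogenyEval (σ := σ) F) =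
      (isogenyEval (F.map h)).comp (MvPowerSeries.map (PowerSeries.map h)) from
    RingHom.congr_fun this f
  refine ringHom_ext (fun i => ?_) (fun c => ?_) fun i => ?_
  · rw [RingHom.comp_apply, isogenyEval_X, map_mul]
    simp
  · rw [RingHom.comp_apply, RingHom.comp_apply, MvPowerSeries.map_C, isogenyEval_C,
      isogenyEval_C, ← powerSeries_subst_eq_evalHom (by simp),
      ← powerSeries_subst_eq_evalHom (by simp),
      apply_subst (MvPowerSeries.map h) h (by simp) (by simp) (by simp)]
    simp
  · rw [RingHom.comp_apply, RingHom.comp_apply, hX]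
    simp

theorem map_normProd (h : R →+* S) (F : FormalGroup R) (g : Param R) :
    (normProd F g).map h = normProd (F.map h) (Param.map h g) := by
  rw [normProd, normProd, map_mul, Param.map_app h (by simp),
    Param.map_app h (constantCoeff_fadd_X_T F), map_fadd h F (by simp) (by simp)]
  simp

/-- Evaluation of a series over `S[[t]]` at `t = b` and at a series `a`. -/
theorem evalP_evalP_of_isogenyEval {F : FormalGroup S} {n : PowerSeries (PowerSeries S)}
    {g : Param S} (h : isogenyEval (σ := Unit) F n = normProd F g)
    {a b : MvPowerSeries τ S} (ha : a.constantCoeff = 0) (hb : b.constantCoeff = 0) :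
    evalP (evalP MvPowerSeries.C b) (a * fadd F a b) n = g.app a * g.app (fadd F a b) := by
  have h0 : ∀ i : Option Unit, (i.elim b fun _ => a).constantCoeff = 0 := by
    rintro (_ | _) <;> simpa
  let Θ : MvPowerSeries (Option Unit) S →+* MvPowerSeries τ S :=
    evalHom MvPowerSeries.C fun i => i.elim b fun _ => a
  have hx : Θ (serX S) = a := evalHom_X _ h0 (some ())
  have ht : Θ (serT S) = b := evalHom_X _ h0 none
  have hC (r : S) : Θ (MvPowerSeries.C r) = MvPowerSeries.C (RingHom.id S r) := evalHom_C _ _ r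
  have hxt : Θ (fadd F (serX S) (serT S)) = fadd F a b := by
    rw [apply_fadd Θ (RingHom.id S) hC F (by simp) (by simp) (by rwa [hx]) (by rwa [ht]), hx, ht,
      map_id_law]
  have hl := congrArg Θ h
  rw [normProd, map_mul, g.apply_app Θ (RingHom.id S) hC (by simp) (by rwa [hx]),
    g.apply_app Θ (RingHom.id S) hC (constantCoeff_fadd_X_T F)
      (by rw [hxt, constantCoeff_fadd F ha hb]), hxt, hx, Param.map_id] at hl
  rw [← hl]
  have hX : isogenyEval (σ := Unit) F (PowerSeries.X : PowerSeries (PowerSeries S)) =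
    serX S * fadd F (serX S) (serT S) := isogenyEval_X F ()
  suffices evalP (evalP MvPowerSeries.C b) (a * fadd F a b) = Θ.comp (isogenyEval (σ := Unit) F)
    from RingHom.congr_fun this n
  have hab : (a * fadd F a b).constantCoeff = 0 := by rw [map_mul, ha, zero_mul]
  refine powerSeries_ringHom_ext (by rwa [evalP_X _ hab]) (fun c => ?_) ?_
  · rw [evalP_C]
    refine Eq.trans ?_ (congrArg Θ (isogenyEval_C (σ := Unit) F c).symm)
    rw [apply_evalP _ (by simp) Θ (by rw [ht, hb]), ht]
    congr 2
    ext1 r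
    exact (hC r).symm
  · rw [evalP_X _ hab, RingHom.comp_apply, hX, map_mul, hx, hxt]

variable [Algebra (ZMod 2) S] [Algebra (ZMod 2) T]

/-- The norm of a change of parameter `g`, the series over `S[[t]]` which takes `x F(x, t)` to
`g(x) g(F(x, t))`. -/
def normParam {F : FormalGroup S} (hF : IsOrderTwo F) (g : Param S) : Param (PowerSeries S) :=
  (exists_norm hF g).choose

theorem isogenyEval_normParam {F : FormalGroup S} (hF : IsOrderTwo F) (g : Param S) :
    isogenyEval (σ := Unit) F (normParam hF g).toSeries = normProd F g :=
  (exists_norm hF g).choose_spec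

/-- Uniqueness follows from injectivity of evaluation at the isogeny; base change, normalisation and
the cocycle rule for norms are all deduced from it. -/
theorem eq_normParam {F : FormalGroup S} (hF : IsOrderTwo F) {g : Param S}
    {n : PowerSeries (PowerSeries S)} (h : isogenyEval (σ := Unit) F n = normProd F g) :
    n = (normParam hF g).toSeries :=
  isogenyEval_injective (σ := Unit) F (h.trans (isogenyEval_normParam hF g).symm)

theorem evalP_normParam {F : FormalGroup S} (hF : IsOrderTwo F) (g : Param S)
    {a b : MvPowerSeries τ S} (ha : a.constantCoeff = 0) (hb : b.constantCoeff = 0) :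
    evalP (evalP MvPowerSeries.C b) (a * fadd F a b) (normParam hF g).toSeries =
      g.app a * g.app (fadd F a b) :=
  evalP_evalP_of_isogenyEval (isogenyEval_normParam hF g) ha hb

theorem map_normParam (h : S →+* T) {F : FormalGroup S} (hF : IsOrderTwo F) (g : Param S) :
    Param.map (PowerSeries.map h) (normParam hF g) = normParam (hF.map h) (Param.map h g) := by
  refine Param.ext (eq_normParam (hF.map h) ?_)
  rw [← map_normProd, ← isogenyEval_normParam hF]
  exact (map_isogenyEval (σ := Unit) h F _).symm

theorem map_constantCoeff_normParam {F : FormalGroup S} (hF : IsOrderTwo F) (g : Param S) :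
    Param.map PowerSeries.constantCoeff (normParam hF g) = Param.map (square S) g :=
  Param.ext (map_constantCoeff_of_isogenyEval (isogenyEval_normParam hF g))

theorem normParam_one {F : FormalGroup S} (hF : IsOrderTwo F) :
    normParam hF (1 : Param S) = 1 := by
  refine (Param.ext (eq_normParam hF ?_)).symm
  rw [normProd, Param.one_app (by simp), Param.one_app (constantCoeff_fadd_X_T F)]
  exact isogenyEval_X F ()

/-- The substitution of `g(x)` for every variable `x`. -/
def appHom (σ : Type*) [Finite σ] (g : Param S) : MvPowerSeries σ S →+* MvPowerSeries σ S :=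
  evalHom MvPowerSeries.C fun i => g.app (MvPowerSeries.X i)

section AppHom

omit [Algebra (ZMod 2) S]

variable [Finite σ]

theorem appHom_C (g : Param S) (r : S) :
    appHom σ g (MvPowerSeries.C r) = MvPowerSeries.C (RingHom.id S r) := evalHom_C _ _ r

theorem appHom_X (g : Param S) (i : σ) :
    appHom σ g (MvPowerSeries.X i) = g.app (MvPowerSeries.X i) :=
  evalHom_X _ (fun _ => g.constantCoeff_app (by simp)) i

theorem constantCoeff_appHom (g : Param S) {a : MvPowerSeries σ S} (ha : a.constantCoeff = 0) :
    (appHom σ g a).constantCoeff = 0 :=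
  constantCoeff_evalHom_eq_zero _ (fun _ => g.constantCoeff_app (by simp)) ha

theorem appHom_app (g k : Param S) {a : MvPowerSeries σ S} (ha : a.constantCoeff = 0) :
    appHom σ g (k.app a) = k.app (appHom σ g a) := by
  rw [k.apply_app _ (RingHom.id S) (appHom_C g) ha (constantCoeff_appHom g ha), Param.map_id]

theorem appHom_fadd (g : Param S) (F : FormalGroup S) {a b : MvPowerSeries σ S}
    (ha : a.constantCoeff = 0) (hb : b.constantCoeff = 0) :
    appHom σ g (fadd F a b) = fadd F (appHom σ g a) (appHom σ g b) := by
  rw [apply_fadd _ (RingHom.id S) (appHom_C g) F ha hb (constantCoeff_appHom g ha)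
    (constantCoeff_appHom g hb), map_id_law]

theorem appHom_comp (g k : Param S) : (appHom σ k).comp (appHom σ g) = appHom σ (g * k) := by
  refine eq_evalHom _ (fun i => Param.constantCoeff_app _ (by simp)) (fun r => ?_) fun i => ?_
  · rw [RingHom.comp_apply, appHom_C, appHom_C]; rfl
  · rw [RingHom.comp_apply, appHom_X, appHom_app _ _ (by simp), appHom_X, Param.mul_app _ _ (by simp)]

theorem appHom_one : appHom σ (1 : Param S) = RingHom.id _ := by
  refine (eq_evalHom _ (fun i => Param.constantCoeff_app _ (by simp)) (fun r => rfl)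
    fun i => ?_).symm
  rw [Param.one_app (by simp)]; rfl

theorem appHom_injective (g : Param S) : Function.Injective (appHom σ g) := by
  refine Function.LeftInverse.injective (g := appHom σ g⁻¹) fun f => ?_
  rw [← RingHom.comp_apply, appHom_comp, mul_inv_cancel, appHom_one]
  rfl

end AppHom

/-- The defining property of the norm, with the variable `x` replaced by an arbitrary series `b`
without constant term. -/
theorem isogenyEval_app_normParam [Finite σ] {F : FormalGroup S} (hF : IsOrderTwo F)
    (g : Param S) (a : MvPowerSeries σ (PowerSeries S)) (ha : a.constantCoeff = 0)
    {b : MvPowerSeries (Option σ) S} (hb : b.constantCoeff = 0)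
    (hab : isogenyEval F a = b * fadd F b (MvPowerSeries.X none)) :
    isogenyEval F ((normParam hF g).app a) = g.app b * g.app (fadd F b (MvPowerSeries.X none)) := by
  rw [Param.app, powerSeries_subst_eq_evalHom ha, apply_evalP _ ha, hab,
    ← evalP_normParam hF g hb (by simp)]
  · congr 2
    ext1 c
    exact isogenyEval_C F c
  · rw [hab, map_mul, hb, zero_mul]

/-- The behaviour of `isogenyEval` under a change of parameter. -/
theorem appHom_isogenyEval [Finite σ] {F : FormalGroup S} (hF : IsOrderTwo F) (g : Param S)
    (f : MvPowerSeries σ (PowerSeries S)) :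
    appHom (Option σ) g (isogenyEval (g • F) f) =
      isogenyEval F (appHom σ (normParam hF g) (f.map (reparam g))) := by
  suffices (appHom (Option σ) g).comp (isogenyEval (g • F)) =
      ((isogenyEval F).comp (appHom σ (normParam hF g))).comp (MvPowerSeries.map (reparam g)) from
    RingHom.congr_fun this f
  refine ringHom_ext (fun i => ?_) (fun c => ?_) fun i => ?_
  · rw [RingHom.comp_apply, isogenyEval_X]
    exact constantCoeff_appHom _ (by simp)
  · rw [RingHom.comp_apply, RingHom.comp_apply, RingHom.comp_apply, MvPowerSeries.map_C, appHom_C,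
      RingHom.id_apply, isogenyEval_C, isogenyEval_C, reparam_apply,
      evalP_subst _ (by simp) g.constantCoeff_eq, apply_evalP _ (by simp), appHom_X, Param.app,
      powerSeries_subst_eq_evalHom (by simp)]
    · congr 2
      ext1 r
      exact appHom_C g r
    · exact constantCoeff_appHom _ (by simp)
  -- Since `g` is an isomorphism from `F` to `g • F`, the isogeny of `g • F` at `(g(x), g(t))` is
  -- `g(x) g(F(x, t))`, which is the norm of `g` at `x F(x, t)`.
  · rw [RingHom.comp_apply, RingHom.comp_apply, RingHom.comp_apply, MvPowerSeries.map_X, appHom_X,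
      isogenyEval_X, map_mul, appHom_fadd _ _ (by simp) (by simp), appHom_X, appHom_X,
      Param.fadd_smul_app _ _ (by simp) (by simp),
      isogenyEval_app_normParam hF g _ (by simp) (by simp) (isogenyEval_X F i)]

/-- Both sides take `x F(x, t)` to `k(g(x)) k(g(F(x, t)))`. The norm of `k` is formed for `g • F`,
whose isogeny has parameter `g(t)`; this accounts for the `reparam g`. -/
theorem normParam_mul {F : FormalGroup S} (hF : IsOrderTwo F) (k g : Param S) :
    normParam hF (k * g) =
      Param.map (reparam g) (normParam (Param.isOrderTwo_smul g hF) k) * normParam hF g := by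
  refine (Param.ext (eq_normParam hF ?_)).symm
  have h := appHom_isogenyEval (σ := Unit) hF g (normParam (Param.isOrderTwo_smul g hF) k).toSeries
  have hx : (serX S).constantCoeff = 0 := by simp
  have ht : (serT S).constantCoeff = 0 := by simp
  rw [isogenyEval_normParam, normProd, map_mul, appHom_app _ _ hx,
    appHom_app _ _ (constantCoeff_fadd_X_T _), appHom_fadd _ _ hx ht, appHom_X, appHom_X,
    Param.fadd_smul_app _ _ hx ht, ← Param.mul_app _ _ hx,
    ← Param.mul_app _ _ (constantCoeff_fadd_X_T F)] at h
  refine Eq.trans ?_ h.symm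
  congr 1
  refine (powerSeries_subst_eq_evalHom (normParam hF g).constantCoeff_eq _).trans ?_
  have h2 : (normParam hF g).app (MvPowerSeries.X () : MvPowerSeries Unit (PowerSeries S)) =
    (normParam hF g).toSeries := (normParam hF g).app_X
  simp only [appHom, h2]
  rfl

/-- The law `G` over `S[[t]]` is the Lubin quotient of `F`. -/
def IsQuotientLaw (F : FormalGroup S) (G : FormalGroup (PowerSeries S)) : Prop :=
  isogenyEval F G.toPowerSeries =
    fadd F (MvPowerSeries.X (some 0)) (MvPowerSeries.X (some 1)) *
      fadd F (fadd F (MvPowerSeries.X (some 0)) (MvPowerSeries.X (some 1)))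
        (MvPowerSeries.X none : MvPowerSeries (Option (Fin 2)) S)

omit [Algebra (ZMod 2) S] in
theorem IsQuotientLaw.unique {F : FormalGroup S} {G G' : FormalGroup (PowerSeries S)}
    (h : IsQuotientLaw F G) (h' : IsQuotientLaw F G') : G = G' :=
  FormalGroup.ext (isogenyEval_injective F (h.trans h'.symm))

/-- The identity is `x(x + t) + y(y + t) = (x + y)(x + y + t)`, where the cross term `2xy` vanishes.
-/
theorem isQuotientLaw_additive : IsQuotientLaw (FormalGroup.𝔾ₐ : FormalGroup S) FormalGroup.𝔾ₐ := by
  have h (i : Fin 2) : (MvPowerSeries.X (some i) : MvPowerSeries (Option (Fin 2)) S).constantCoeff = 0 := by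
    simp
  have ht : (MvPowerSeries.X none : MvPowerSeries (Option (Fin 2)) S).constantCoeff = 0 := by
    simp
  rw [IsQuotientLaw, FormalGroup.𝔾ₐ_toPowerSeries, map_add, isogenyEval_X, isogenyEval_X,
    fadd_additive (h 0) ht, fadd_additive (h 1) ht, fadd_additive (h 0) (h 1),
    fadd_additive (by rw [map_add, h, h, add_zero]) ht]
  linear_combination (- MvPowerSeries.X (some 0) * MvPowerSeries.X (some 1)) *
    two_eq_zero_of_algebra (MvPowerSeries (Option (Fin 2)) S)

/-- Substituting `g` for all variables is injective and, by `appHom_isogenyEval`, turns the claim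
for `g • F` into the one for `F` with the norm of `g` applied. -/
theorem IsQuotientLaw.smul {F : FormalGroup S} (hF : IsOrderTwo F)
    {G : FormalGroup (PowerSeries S)} (h : IsQuotientLaw F G) (g : Param S) :
    IsQuotientLaw (g • F) ((normParam hF g • G).map (reparam g⁻¹)) := by
  have hx (i : Fin 2) : (MvPowerSeries.X (some i) : MvPowerSeries (Option (Fin 2)) S).constantCoeff = 0 := by
    simp
  have ht : (MvPowerSeries.X none : MvPowerSeries (Option (Fin 2)) S).constantCoeff = 0 := by
    simp
  have hX (i : Fin 2) : (MvPowerSeries.X i : MvPowerSeries (Fin 2) (PowerSeries S)).constantCoeff = 0 := by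
    simp
  have hxy := constantCoeff_fadd F (hx 0) (hx 1)
  have hxy' := constantCoeff_fadd (g • F) (hx 0) (hx 1)
  refine appHom_injective g ?_
  rw [appHom_isogenyEval hF, ← FormalGroup.map_toPowerSeries, map_map_law, reparam_comp_inv,
    map_id_law, ← fadd_X_X, appHom_fadd _ _ (hX 0) (hX 1), appHom_X, appHom_X,
    Param.fadd_smul_app _ _ (hX 0) (hX 1), fadd_X_X,
    isogenyEval_app_normParam hF g _ G.zero_constantCoeff hxy h, map_mul,
    appHom_fadd _ _ hxy' ht, appHom_fadd _ _ (hx 0) (hx 1), appHom_X, appHom_X, appHom_X,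
    Param.fadd_smul_app _ _ (hx 0) (hx 1), Param.fadd_smul_app _ _ hxy ht]

/-- When `g` fixes the additive law, transport along its norm gives a second Lubin quotient of that
law; quotients are unique and the additive law is its own quotient. -/
theorem normParam_additive {g : Param S} (h : g • (FormalGroup.𝔾ₐ : FormalGroup S) = FormalGroup.𝔾ₐ)
    (hF : IsOrderTwo (FormalGroup.𝔾ₐ : FormalGroup S)) :
    normParam hF g • (FormalGroup.𝔾ₐ : FormalGroup (PowerSeries S)) = FormalGroup.𝔾ₐ := by
  have h1 := (isQuotientLaw_additive (S := S)).smul hF g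
  rw [h] at h1
  have h2 := congrArg (FormalGroup.map · (reparam g)) (h1.unique isQuotientLaw_additive)
  simpa only [map_map_law, reparam_comp_inv, map_id_law, map_additive] using h2

end NormProperties

/-! ### Symmetric 2-cocycles modulo two -/

section Binomial

/-- Lucas: modulo two, this binomial coefficient is the binary digit of `x` in position `u`. -/
theorem choose_two_pow_mod_two (x u : ℕ) : x.choose (2 ^ u) ≡ x / 2 ^ u [MOD 2] := by
  induction u generalizing x with
  | zero => simp [Nat.ModEq.refl]
  | succ u ih =>
    have : Fact (Nat.Prime 2) := ⟨Nat.prime_two⟩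
    have h := Choose.choose_modEq_choose_mod_mul_choose_div_nat (n := x) (k := 2 ^ (u + 1)) (p := 2)
    have h1 : 2 ^ (u + 1) % 2 = 0 := by simp [pow_succ]
    have h2 : 2 ^ (u + 1) / 2 = 2 ^ u := by simp [pow_succ]
    rw [h1, h2, Nat.choose_zero_right, one_mul] at h
    refine h.trans ((ih (x / 2)).trans ?_)
    rw [Nat.div_div_eq_div_mul, pow_succ']

variable {R : Type*} [CommRing R]

theorem natCast_of_even (h2 : (2 : R) = 0) {n : ℕ} (h : n ≡ 0 [MOD 2]) : (n : R) = 0 := by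
  obtain ⟨k, rfl⟩ := (Nat.modEq_zero_iff_dvd).1 h
  push_cast
  rw [h2, zero_mul]

theorem natCast_of_odd (h2 : (2 : R) = 0) {n : ℕ} (h : n ≡ 1 [MOD 2]) : (n : R) = 1 := by
  have h' : n % 2 = 1 := h
  rw [← Nat.div_add_mod n 2, h']
  push_cast
  rw [h2, zero_mul, zero_add]

theorem eq_zero_of_choose_two_pow (h2 : (2 : R) = 0) {x u : ℕ} {a : R}
    (hx : x / 2 ^ u ≡ 1 [MOD 2]) (h : (x.choose (2 ^ u) : R) * a = 0) : a = 0 := by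
  rwa [natCast_of_odd h2 ((choose_two_pow_mod_two x u).trans hx), one_mul] at h

/-- A symmetric cocycle of degree `n` modulo `2` without middle term, which vanishes in a suitable
bidegree, is zero. -/
theorem cocycle_eq_zero (h2 : (2 : R) = 0) {n s m : ℕ} (hn : n = 2 ^ s * m)
    (hm : 2 ≤ m) (hm' : m % 2 = 1 ∨ m = 2) {b : ℕ → R}
    (hsymm : ∀ i j, i + j = n → b i = b j)
    (hco : ∀ i j k, 0 < i → 0 < j → 0 < k → i + j + k = n →
      ((i + j).choose i : R) * b (i + j) = ((j + k).choose j : R) * b i)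
    (hq : b (2 ^ s) = 0) : ∀ i, 0 < i → i < n → b i = 0 := by
  -- If the binary digit of `i` in position `s` is 1, the cocycle relation for `2 ^ s + (i - 2 ^ s)`
  -- expresses `b i`, with an odd coefficient, through `b (2 ^ s) = 0`.
  have hA (i : ℕ) (hi : i < n) (hodd : i / 2 ^ s ≡ 1 [MOD 2]) : b i = 0 := by
    have hle : 2 ^ s ≤ i := by
      by_contra hlt
      rw [Nat.div_eq_of_lt (by omega)] at hodd
      exact absurd hodd (by decide)
    rcases hle.eq_or_lt with h | h
    · rwa [← h]
    · have := hco (2 ^ s) (i - 2 ^ s) (n - i) (by positivity) (by omega) (by omega) (by omega)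
      rw [hq, mul_zero, show 2 ^ s + (i - 2 ^ s) = i by omega] at this
      exact eq_zero_of_choose_two_pow h2 hodd this
  intro i hi0 hi
  by_cases hdvd : 2 ^ s ∣ i
  · obtain ⟨i', rfl⟩ := hdvd
    have hi' : i' < m := by
      rw [hn] at hi
      exact lt_of_mul_lt_mul_left hi (by positivity)
    have hi0' : 0 < i' := Nat.pos_of_mul_pos_left hi0 |> fun _ => by
      rcases Nat.eq_zero_or_pos i' with h | h
      · simp [h] at hi0
      · exact h
    have hpos : 0 < 2 ^ s := by positivity
    rcases Nat.mod_two_eq_zero_or_one i' with h | h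
    -- For odd `m` symmetry exchanges even and odd multiples of `2 ^ s`; for `m = 2` no even `i'`
    -- lies strictly between 0 and `m`.
    · have hmi : (m - i') % 2 = 1 := by omega
      rw [hsymm (2 ^ s * i') (2 ^ s * (m - i')) (by rw [hn, ← mul_add]; congr 1; omega)]
      refine hA _ ?_ ?_
      · rw [hn]
        exact Nat.mul_lt_mul_of_pos_left (by omega) hpos
      · rw [Nat.mul_div_cancel_left _ hpos]
        exact hmi
    · refine hA _ hi ?_
      rw [Nat.mul_div_cancel_left _ hpos]
      exact h
  -- Now the lowest binary digit of `i` is in a position `u < s`, and `2 ^ u` takes over the role of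
  -- `2 ^ s`.
  · obtain ⟨u, r, hr, hir⟩ := Nat.exists_eq_two_pow_mul_odd hi0.ne'
    have hus : u < s := by
      by_contra hus
      exact hdvd (hir ▸ (pow_dvd_pow 2 (by omega)).mul_right r)
    have hpu : 0 < 2 ^ u := by positivity
    have hlt : 2 ^ (u + 1) < n := by
      rw [hn]
      calc 2 ^ (u + 1) ≤ 2 ^ s := Nat.pow_le_pow_right (by norm_num) hus
        _ < 2 ^ s * m := lt_mul_of_one_lt_right (by positivity) (by omega)
    -- In the relation for `(2 ^ u, 2 ^ u, n - 2 ^ (u + 1))` the left binomial coefficient is even.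
    -- The right one is odd, because `n - 2 ^ u` is an odd multiple of `2 ^ u`.
    have hbu : b (2 ^ u) = 0 := by
      have hp : 2 ^ (u + 1) = 2 ^ u + 2 ^ u := by ring
      have := hco (2 ^ u) (2 ^ u) (n - 2 ^ (u + 1)) hpu hpu (by omega) (by omega)
      rw [← hp, natCast_of_even h2 ((choose_two_pow_mod_two _ u).trans (by
        rw [pow_succ, Nat.mul_div_cancel_left _ hpu]; rfl)), zero_mul] at this
      refine eq_zero_of_choose_two_pow h2 ?_ this.symm
      obtain ⟨d, rfl⟩ : ∃ d, s = u + 1 + d := ⟨s - (u + 1), by omega⟩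
      have hd : 1 ≤ 2 ^ d * m := Nat.mul_pos (by positivity) (by omega)
      have : 2 ^ u + (n - 2 ^ (u + 1)) = 2 ^ u * (2 * (2 ^ d * m - 1) + 1) := by
        obtain ⟨w, hw⟩ := Nat.exists_eq_add_of_le hd
        have hnw : n = 2 ^ (u + 1) * (1 + w) := by
          rw [hn, ← hw]; ring
        rw [hw, hnw, mul_add, mul_one, Nat.add_sub_cancel_left, Nat.add_sub_cancel_left]
        ring
      rw [this, Nat.mul_div_cancel_left _ hpu]
      simp [Nat.ModEq]
    have hodd : i / 2 ^ u ≡ 1 [MOD 2] := by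
      rw [hir, Nat.mul_div_cancel_left _ hpu]
      exact Nat.odd_iff.1 hr
    have hle : 2 ^ u ≤ i := by
      rw [hir]
      exact Nat.le_mul_of_pos_right _ hr.pos
    rcases hle.eq_or_lt with h | h
    · rwa [← h]
    · have := hco (2 ^ u) (i - 2 ^ u) (n - i) hpu (by omega) (by omega) (by omega)
      rw [hbu, mul_zero, show 2 ^ u + (i - 2 ^ u) = i by omega] at this
      exact eq_zero_of_choose_two_pow h2 hodd this

/-- A symmetric cocycle modulo `2` without middle term is a coboundary. -/
theorem exists_cocycle_eq (h2 : (2 : R) = 0) {n : ℕ} (hn : 2 ≤ n) {b : ℕ → R}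
    (hsymm : ∀ i j, i + j = n → b i = b j)
    (hco : ∀ i j k, 0 < i → 0 < j → 0 < k → i + j + k = n →
      ((i + j).choose i : R) * b (i + j) = ((j + k).choose j : R) * b i)
    (hhalf : ∀ i, i + i = n → b i = 0) :
    ∃ c : R, ∀ i, 0 < i → i < n → b i = c * (n.choose i : R) := by
  obtain ⟨s, m, hm, hnm⟩ := Nat.exists_eq_two_pow_mul_odd (show n ≠ 0 by omega)
  by_cases hm1 : m = 1
  -- When `n` is a power of two all middle binomial coefficients are even, so coboundaries vanish.
  -- The value that must vanish separately is the one at `n / 2`, which is the hypothesis `hhalf`.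
  · refine ⟨0, fun i hi0 hi => ?_⟩
    rw [zero_mul]
    obtain ⟨s, rfl⟩ : ∃ s', s = s' + 1 := by
      refine Nat.exists_eq_succ_of_ne_zero ?_
      rintro rfl
      simp [hm1] at hnm
      omega
    have hs : n = 2 ^ s * 2 := by rw [hnm, hm1, pow_succ, mul_one]
    exact cocycle_eq_zero h2 hs le_rfl (Or.inr rfl) hsymm hco (hhalf _ (by omega)) i hi0 hi
  · have hm3 : 2 ≤ m := by have := hm.pos; omega
    -- Since `n.choose (2 ^ s)` is congruent to the odd number `m`, this multiple of the coboundary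
    -- agrees with `b` at `2 ^ s`.
    refine ⟨b (2 ^ s), fun i hi0 hi => sub_eq_zero.1 ?_⟩
    refine cocycle_eq_zero (b := fun i => b i - b (2 ^ s) * (n.choose i : R)) h2 hnm hm3
      (Or.inl (Nat.odd_iff.1 hm)) (fun i j hij => ?_) (fun i j k h1 h2 h3 hijk => ?_) ?_ i hi0 hi
    · have : n.choose i = n.choose j := Nat.choose_symm_of_eq_add hij.symm
      simp only [hsymm i j hij, this]
    · have e : n.choose (i + j) * (i + j).choose i = n.choose i * (j + k).choose j := by
        rw [Nat.choose_mul (by omega), show n - i = j + k by omega,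
          show i + j - i = j by omega]
      have e' : (n.choose (i + j) : R) * ((i + j).choose i : R) =
          (n.choose i : R) * ((j + k).choose j : R) := by exact_mod_cast congrArg (Nat.cast (R := R)) e
      have := hco i j k h1 h2 h3 hijk
      linear_combination this - b (2 ^ s) * e'
    · have : n.choose (2 ^ s) ≡ 1 [MOD 2] := by
        refine (choose_two_pow_mod_two n s).trans ?_
        rw [hnm, Nat.mul_div_cancel_left _ (by positivity)]
        exact Nat.odd_iff.1 hm
      simp only [natCast_of_odd h2 this, mul_one, sub_self]

end Binomial

/-! ### Formal group laws of order two have a logarithm -/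

section Logarithm

variable {R S : Type*} [CommRing R] [CommRing S] {τ : Type*}

/-- The ideal generated by the variables. -/
abbrev varIdeal (τ R : Type*) [CommRing R] : Ideal (MvPowerSeries τ R) :=
  Ideal.span (Set.range (MvPowerSeries.X : τ → MvPowerSeries τ R))

theorem constantCoeff_of_mem_varIdeal {f : MvPowerSeries τ R} (hf : f ∈ varIdeal τ R) :
    f.constantCoeff = 0 := by
  have : varIdeal τ R ≤ RingHom.ker MvPowerSeries.constantCoeff := by
    refine Ideal.span_le.2 ?_
    rintro _ ⟨i, rfl⟩
    simp [RingHom.mem_ker]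
  exact this hf

/-- For the converse, a polynomial approximating `f` modulo the same power has no terms of degree
below `n`, and for polynomials the criterion is known. -/
theorem mem_varIdeal_pow_iff [Finite τ] {f : MvPowerSeries τ R} {n : ℕ} :
    f ∈ varIdeal τ R ^ n ↔ ∀ d : τ →₀ ℕ, d.degree < n → MvPowerSeries.coeff d f = 0 := by
  refine ⟨fun hf d hd => coeff_eq_zero_of_mem_pow
    (fun _ => constantCoeff_of_mem_varIdeal) n hf hd, fun hf => ?_⟩
  obtain ⟨p, hp⟩ := exists_polynomial_sub_mem f n
  have hp' : p ∈ MvPolynomial.idealOfVars τ R ^ n := by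
    rw [MvPolynomial.mem_pow_idealOfVars_iff']
    intro d hd
    have := coeff_eq_zero_of_mem_pow (fun _ => constantCoeff_of_mem_varIdeal) n hp hd
    rw [map_sub, hf d hd, zero_sub, neg_eq_zero] at this
    rwa [← MvPolynomial.coeff_coe]
  have := Ideal.mem_map_of_mem (MvPolynomial.coeToMvPowerSeries.ringHom (R := R) (σ := τ)) hp'
  rw [Ideal.map_pow, MvPolynomial.idealOfVars, Ideal.map_span, ← Set.range_comp] at this
  rw [← sub_add_cancel f p]
  refine add_mem hp ?_
  have hX : ⇑MvPolynomial.coeToMvPowerSeries.ringHom ∘ MvPolynomial.X =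
      (MvPowerSeries.X : τ → MvPowerSeries τ R) := by
    funext i
    simp
  rwa [hX] at this

/-- The coefficients of the part of degree `n` of a series in two variables. -/
def formCoeff (E : MvPowerSeries (Fin 2) R) (n i : ℕ) : R :=
  MvPowerSeries.coeff (Finsupp.single 0 i + Finsupp.single 1 (n - i)) E

theorem formCoeff_add (E E' : MvPowerSeries (Fin 2) R) (n i : ℕ) :
    formCoeff (E + E') n i = formCoeff E n i + formCoeff E' n i := map_add _ _ _

theorem formCoeff_map (h : R →+* S) (E : MvPowerSeries (Fin 2) R) (n i : ℕ) :
    formCoeff (E.map h) n i = h (formCoeff E n i) := MvPowerSeries.coeff_map _ _ _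

theorem degree_finTwo (d : Fin 2 →₀ ℕ) : d.degree = d 0 + d 1 := by
  rw [Finsupp.degree_eq_sum, Fin.sum_univ_two]

theorem mem_varIdeal_pow_succ {E : MvPowerSeries (Fin 2) R} {n : ℕ}
    (hE : E ∈ varIdeal (Fin 2) R ^ n) (h : ∀ i ≤ n, formCoeff E n i = 0) :
    E ∈ varIdeal (Fin 2) R ^ (n + 1) := by
  rw [mem_varIdeal_pow_iff] at hE ⊢
  intro d hd
  rcases Nat.lt_succ_iff_lt_or_eq.1 hd with hd | hd
  · exact hE d hd
  · rw [degree_finTwo] at hd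
    have := h (d 0) (by omega)
    rwa [formCoeff, show n - d 0 = d 1 by omega, ← finsupp_fin_two_eq] at this

theorem coeff_finTwo_monomial (a b i j : ℕ) (r : R) : MvPowerSeries.coeff
    (Finsupp.single 0 i + Finsupp.single 1 j)
      (MvPowerSeries.C r * MvPowerSeries.X 0 ^ a * MvPowerSeries.X 1 ^ b :
        MvPowerSeries (Fin 2) R) = if i = a ∧ j = b then r else 0 := by
  classical
  rw [mul_assoc, MvPowerSeries.coeff_C_mul, MvPowerSeries.X_pow_eq, MvPowerSeries.X_pow_eq,
    MvPowerSeries.monomial_mul_monomial, MvPowerSeries.coeff_monomial]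
  have : Finsupp.single (0 : Fin 2) i + Finsupp.single 1 j =
      Finsupp.single 0 a + Finsupp.single 1 b ↔ i = a ∧ j = b := by
    refine ⟨fun h => ⟨?_, ?_⟩, fun h => by rw [h.1, h.2]⟩
    · simpa using DFunLike.congr_fun h 0
    · simpa using DFunLike.congr_fun h 1
  simp [this]

/-- The leading form of a series in two variables, evaluated at series in one variable. -/
theorem coeff_subst_pair {E : MvPowerSeries (Fin 2) R} {n : ℕ}
    (hE : E ∈ varIdeal (Fin 2) R ^ n) {a b : PowerSeries R}
    (ha : PowerSeries.constantCoeff a = 0) (hb : PowerSeries.constantCoeff b = 0) :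
    PowerSeries.coeff n (E.subst ![a, b] : PowerSeries R) = ∑ i ∈ Finset.range (n + 1),
      formCoeff E n i * PowerSeries.coeff 1 a ^ i * PowerSeries.coeff 1 b ^ (n - i) := by
  have hab := forall_pair ha hb
  obtain ⟨a, rfl⟩ := PowerSeries.X_dvd_iff.2 ha
  obtain ⟨b, rfl⟩ := PowerSeries.X_dvd_iff.2 hb
  set L : MvPowerSeries (Fin 2) R := ∑ i ∈ Finset.range (n + 1),
    MvPowerSeries.C (formCoeff E n i) * MvPowerSeries.X 0 ^ i * MvPowerSeries.X 1 ^ (n - i)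
    with hL
  have hX (i : Fin 2) : (MvPowerSeries.X i : MvPowerSeries (Fin 2) R) ∈ varIdeal (Fin 2) R :=
    Ideal.subset_span ⟨i, rfl⟩
  -- `L` is the form of degree `n` in `E`; the difference becomes divisible by `X ^ (n + 1)` after
  -- substitution and does not affect the coefficient in degree `n`.
  have hLE : E - L ∈ varIdeal (Fin 2) R ^ (n + 1) := by
    refine mem_varIdeal_pow_succ (sub_mem hE (sum_mem fun i hi => ?_)) fun i hi => ?_
    · have hi' : i + (n - i) = n := by have := Finset.mem_range.1 hi; omega
      rw [mul_assoc]
      refine Ideal.mul_mem_left _ _ ?_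
      have := Ideal.mul_mem_mul (Ideal.pow_mem_pow (hX 0) i) (Ideal.pow_mem_pow (hX 1) (n - i))
      rwa [← pow_add, hi'] at this
    · rw [formCoeff, map_sub, hL, map_sum, Finset.sum_eq_single i]
      · rw [coeff_finTwo_monomial, if_pos ⟨rfl, rfl⟩]
        exact sub_self _
      · intro j _ hj
        rw [coeff_finTwo_monomial, if_neg fun h => hj h.1.symm]
      · intro h
        exact absurd (Finset.mem_range.2 (by omega)) h
  rw [subst_eq_evalHom hab]
  set Θ : MvPowerSeries (Fin 2) R →+* PowerSeries R := evalHom MvPowerSeries.C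
    ![PowerSeries.X * a, PowerSeries.X * b] with hΘ
  have h0 : Θ (MvPowerSeries.X 0) = PowerSeries.X * a := evalHom_X _ hab 0
  have h1 : Θ (MvPowerSeries.X 1) = PowerSeries.X * b := evalHom_X _ hab 1
  have hc (r : R) : Θ (MvPowerSeries.C r) = PowerSeries.C r := evalHom_C _ _ r
  have hdvd : PowerSeries.X ^ (n + 1) ∣ Θ (E - L) := by
    have := Ideal.mem_map_of_mem Θ hLE
    rw [Ideal.map_pow, Ideal.map_span] at this
    rw [← Ideal.mem_span_singleton, ← Ideal.span_singleton_pow]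
    refine Ideal.pow_right_mono (Ideal.span_le.2 ?_) _ this
    rintro _ ⟨_, ⟨i, rfl⟩, rfl⟩
    rw [SetLike.mem_coe, Ideal.mem_span_singleton]
    fin_cases i
    · exact h0 ▸ dvd_mul_right _ _
    · exact h1 ▸ dvd_mul_right _ _
  have hcoeff := PowerSeries.X_pow_dvd_iff.1 hdvd n (Nat.lt_succ_self n)
  rw [map_sub, map_sub, sub_eq_zero] at hcoeff
  rw [hcoeff, hL, map_sum, map_sum]
  refine Finset.sum_congr rfl fun i hi => ?_
  have hi' : i + (n - i) = n := by have := Finset.mem_range.1 hi; omega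
  rw [map_mul Θ, map_mul Θ, map_pow Θ, map_pow Θ, h0, h1, hc]
  have e : PowerSeries.C (formCoeff E n i) * (PowerSeries.X * a) ^ i *
      (PowerSeries.X * b) ^ (n - i) =
      PowerSeries.X ^ n * (PowerSeries.C (formCoeff E n i) * a ^ i * b ^ (n - i)) := by
    rw [mul_pow, mul_pow, ← hi', pow_add, hi']
    ring
  rw [e]
  have hn := PowerSeries.coeff_X_pow_mul
    (PowerSeries.C (formCoeff E n i) * a ^ i * b ^ (n - i)) n 0
  rw [zero_add] at hn
  rw [hn]
  simp [PowerSeries.coeff_succ_X_mul (R := R) 0]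

end Logarithm

/-! ### Removing the deviation from additivity degree by degree -/

section Logarithm

variable {R S : Type*} [CommRing R] [CommRing S] {τ υ : Type*}

theorem constantCoeff_X_fin (i : Fin 2) :
    (MvPowerSeries.X i : MvPowerSeries (Fin 2) R).constantCoeff = 0 := by simp

theorem map_X_fin (h : R →+* S) (i : Fin 2) :
    (MvPowerSeries.X i : MvPowerSeries (Fin 2) R).map h = MvPowerSeries.X i := by simp

/-- The deviation `P(F(x, y)) - P(x) - P(y)` of the series `P` from being additive for `F`. -/
def deviation (F : FormalGroup R) (P : PowerSeries R) : MvPowerSeries (Fin 2) R :=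
  P.subst (fadd F (MvPowerSeries.X 0) (MvPowerSeries.X 1)) -
    P.subst (MvPowerSeries.X 0 : MvPowerSeries (Fin 2) R) -
    P.subst (MvPowerSeries.X 1 : MvPowerSeries (Fin 2) R)

theorem subst_deviation (F : FormalGroup R) (P : PowerSeries R) {a b : MvPowerSeries τ R}
    (ha : a.constantCoeff = 0) (hb : b.constantCoeff = 0) :
    (deviation F P).subst ![a, b] = P.subst (fadd F a b) - P.subst a - P.subst b := by
  have hab := forall_pair ha hb
  have h0 : evalHom MvPowerSeries.C ![a, b] (MvPowerSeries.X 0) = a := evalHom_X _ hab 0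
  have h1 : evalHom MvPowerSeries.C ![a, b] (MvPowerSeries.X 1) = b := evalHom_X _ hab 1
  have hC (r : R) : evalHom (MvPowerSeries.C (σ := τ)) ![a, b] (MvPowerSeries.C r) =
      MvPowerSeries.C (RingHom.id R r) := evalHom_C _ _ r
  have hF : evalHom MvPowerSeries.C ![a, b]
      (fadd F (MvPowerSeries.X 0) (MvPowerSeries.X 1)) = fadd F a b := by
    rw [apply_fadd _ _ hC _ (constantCoeff_X_fin 0) (constantCoeff_X_fin 1) (by rwa [h0])
      (by rwa [h1]), h0, h1, map_id_law]
  have key {c : MvPowerSeries (Fin 2) R} (hc : c.constantCoeff = 0)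
      (hc' : (evalHom MvPowerSeries.C ![a, b] c).constantCoeff = 0) :
      evalHom MvPowerSeries.C ![a, b] (P.subst c) =
        P.subst (evalHom MvPowerSeries.C ![a, b] c) := by
    rw [apply_subst _ _ hC hc hc', PowerSeries.map_id]
    rfl
  rw [subst_eq_evalHom hab, deviation, map_sub, map_sub,
    key (constantCoeff_fadd F (constantCoeff_X_fin 0) (constantCoeff_X_fin 1))
      (by rw [hF]; exact constantCoeff_fadd F ha hb),
    key (constantCoeff_X_fin 0) (by rwa [h0]), key (constantCoeff_X_fin 1) (by rwa [h1]),
    h0, h1, hF]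

theorem map_deviation (h : R →+* S) (F : FormalGroup R) (P : PowerSeries R) :
    (deviation F P).map h = deviation (F.map h) (P.map h) := by
  have key {c : MvPowerSeries (Fin 2) R} (hc : c.constantCoeff = 0) :
      (P.subst c).map h = (P.map h).subst (c.map h) :=
    apply_subst (MvPowerSeries.map h) h (by simp) hc (by simp [hc]) P
  rw [deviation, map_sub, map_sub,
    key (constantCoeff_fadd F (constantCoeff_X_fin 0) (constantCoeff_X_fin 1)),
    key (constantCoeff_X_fin 0), key (constantCoeff_X_fin 1),
    map_fadd _ _ (constantCoeff_X_fin 0) (constantCoeff_X_fin 1), map_X_fin, map_X_fin]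
  rfl

theorem deviation_add (F : FormalGroup R) (P Q : PowerSeries R) :
    deviation F (P + Q) = deviation F P + deviation F Q := by
  have hF := constantCoeff_fadd F (constantCoeff_X_fin (R := R) 0) (constantCoeff_X_fin 1)
  simp only [deviation]
  rw [PowerSeries.subst_add (.of_constantCoeff_zero hF),
    PowerSeries.subst_add (.of_constantCoeff_zero (constantCoeff_X_fin 0)),
    PowerSeries.subst_add (.of_constantCoeff_zero (constantCoeff_X_fin 1))]
  ring

theorem mapped_mem_varIdeal_pow [Finite τ] (h : R →+* S) {E : MvPowerSeries τ R} {n : ℕ}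
    (hE : E ∈ varIdeal τ R ^ n) : E.map h ∈ varIdeal τ S ^ n := by
  rw [mem_varIdeal_pow_iff] at hE ⊢
  intro d hd
  rw [MvPowerSeries.coeff_map, hE d hd, map_zero]

theorem coeff_one_fadd (F : FormalGroup R) {a b : PowerSeries R}
    (ha : PowerSeries.constantCoeff a = 0) (hb : PowerSeries.constantCoeff b = 0) :
    PowerSeries.coeff 1 (fadd F a b : PowerSeries R) =
      PowerSeries.coeff 1 a + PowerSeries.coeff 1 b := by
  have hE : F.toPowerSeries ∈ varIdeal (Fin 2) R ^ 1 := by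
    rw [pow_one]
    exact mem_span_X_iff F.zero_constantCoeff
  rw [fadd, coeff_subst_pair hE ha hb]
  have e0 := F.lin_coeff_X
  have e1 := F.lin_coeff_Y
  simp [Finset.sum_range_succ, formCoeff, e0, e1, add_comm]

section Cocycle

variable {F : FormalGroup R} {P : PowerSeries R} {n : ℕ}
  (hE : deviation F P ∈ varIdeal (Fin 2) R ^ n)

include hE

/-- The base change along `h` makes room for indeterminates, so that coefficients of the leading
form can be compared afterwards. -/
theorem coeff_deviation (h : R →+* S) {a b : PowerSeries S}
    (ha : PowerSeries.constantCoeff a = 0) (hb : PowerSeries.constantCoeff b = 0) :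
    PowerSeries.coeff n ((deviation (F.map h) (P.map h)).subst ![a, b] : PowerSeries S) =
      ∑ i ∈ Finset.range (n + 1), h (formCoeff (deviation F P) n i) *
        PowerSeries.coeff 1 a ^ i * PowerSeries.coeff 1 b ^ (n - i) := by
  have := mapped_mem_varIdeal_pow h hE
  rw [map_deviation] at this
  rw [coeff_subst_pair this ha hb, ← map_deviation]
  simp only [formCoeff_map]

/-- The leading form of a deviation is a cocycle. -/
theorem form_cocycle (h : R →+* S) (α β γ : S) :
    ∑ i ∈ Finset.range (n + 1),
        h (formCoeff (deviation F P) n i) * (α + β) ^ i * γ ^ (n - i) +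
      ∑ i ∈ Finset.range (n + 1), h (formCoeff (deviation F P) n i) * α ^ i * β ^ (n - i) =
    ∑ i ∈ Finset.range (n + 1),
        h (formCoeff (deviation F P) n i) * α ^ i * (β + γ) ^ (n - i) +
      ∑ i ∈ Finset.range (n + 1), h (formCoeff (deviation F P) n i) * β ^ i * γ ^ (n - i) := by
  have h0 (α : S) : PowerSeries.constantCoeff (PowerSeries.C α * PowerSeries.X) = 0 := by simp
  have h1 (α : S) : PowerSeries.coeff 1 (PowerSeries.C α * PowerSeries.X) = α := by simp
  -- On these lines the deviation `E` satisfies `E(F(a,b), c) + E(a,b) = E(a, F(b,c)) + E(b,c)` by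
  -- associativity. In the coefficient of `X ^ n` only the linear parts of the arguments enter.
  set a : PowerSeries S := PowerSeries.C α * PowerSeries.X with ha
  set b : PowerSeries S := PowerSeries.C β * PowerSeries.X with hb
  set c : PowerSeries S := PowerSeries.C γ * PowerSeries.X with hc
  set G := F.map h
  have hab : PowerSeries.constantCoeff (fadd G a b : PowerSeries S) = 0 :=
    constantCoeff_fadd G (h0 α) (h0 β)
  have hbc : PowerSeries.constantCoeff (fadd G b c : PowerSeries S) = 0 :=
    constantCoeff_fadd G (h0 β) (h0 γ)
  have e1 := coeff_deviation hE h hab (h0 γ)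
  have e2 := coeff_deviation hE h (h0 α) (h0 β)
  have e3 := coeff_deviation hE h (h0 α) hbc
  have e4 := coeff_deviation hE h (h0 β) (h0 γ)
  rw [coeff_one_fadd G (h0 α) (h0 β), h1, h1, h1] at e1
  rw [coeff_one_fadd G (h0 β) (h0 γ), h1, h1, h1] at e3
  rw [h1, h1] at e2 e4
  rw [← e1, ← e2, ← e3, ← e4]
  rw [subst_deviation G _ hab (h0 γ), subst_deviation G _ (h0 α) (h0 β),
    subst_deviation G _ (h0 α) hbc, subst_deviation G _ (h0 β) (h0 γ),
    fadd_assoc G (h0 α) (h0 β) (h0 γ), ← map_add, ← map_add]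
  congr 1
  ring

theorem form_symm (hF : IsOrderTwo F) (h : R →+* S) (α β : S) :
    ∑ i ∈ Finset.range (n + 1), h (formCoeff (deviation F P) n i) * α ^ i * β ^ (n - i) =
    ∑ i ∈ Finset.range (n + 1), h (formCoeff (deviation F P) n i) * β ^ i * α ^ (n - i) := by
  have h0 (α : S) : PowerSeries.constantCoeff (PowerSeries.C α * PowerSeries.X) = 0 := by simp
  have h1 (α : S) : PowerSeries.coeff 1 (PowerSeries.C α * PowerSeries.X) = α := by simp
  have e1 := coeff_deviation hE h (h0 α) (h0 β)
  have e2 := coeff_deviation hE h (h0 β) (h0 α)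
  rw [h1, h1] at e1 e2
  rw [← e1, ← e2, subst_deviation _ _ (h0 α) (h0 β), subst_deviation _ _ (h0 β) (h0 α),
    (hF.map h).fadd_comm (h0 α) (h0 β)]
  congr 1
  ring

theorem formCoeff_symm (hF : IsOrderTwo F) {i j : ℕ} (hij : i + j = n) :
    formCoeff (deviation F P) n i = formCoeff (deviation F P) n j := by
  have := congrArg (fun p => Polynomial.coeff p i)
    (form_symm hE hF (Polynomial.C (R := R)) Polynomial.X 1)
  simp only [one_pow, mul_one, Polynomial.finsetSum_coeff, Polynomial.coeff_C_mul,
    Polynomial.coeff_X_pow, mul_ite, mul_zero] at this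
  rw [Finset.sum_ite_eq, if_pos (Finset.mem_range.2 (by omega)), Finset.sum_eq_single j] at this
  · rwa [if_pos (by omega)] at this
  · intro k hk hkj
    have := Finset.mem_range.1 hk
    rw [if_neg (by omega)]
  · intro hj
    exact absurd (Finset.mem_range.2 (by omega)) hj

/-- With `α = X`, `β = 1` and `γ = Y` over `R[X][Y]`, this is the coefficient of `X ^ i Y ^ k` in
`form_cocycle`; the two sums that lack one of the indeterminates do not contribute. -/
theorem formCoeff_cocycle {i j k : ℕ} (hi : 0 < i) (hj : 0 < j) (hk : 0 < k)
    (hijk : i + j + k = n) :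
    ((i + j).choose i : R) * formCoeff (deviation F P) n (i + j) =
      ((j + k).choose j : R) * formCoeff (deviation F P) n i := by
  have := congrArg (fun p => Polynomial.coeff (Polynomial.coeff p k) i)
    (form_cocycle hE (Polynomial.C.comp (Polynomial.C (R := R)))
      (Polynomial.C Polynomial.X) 1 Polynomial.X)
  set e := formCoeff (deviation F P) n
  have c1 (m : ℕ) : (Polynomial.C.comp Polynomial.C) (e m) *
      (Polynomial.C Polynomial.X + 1 : Polynomial (Polynomial R)) ^ m * Polynomial.X ^ (n - m) =
      Polynomial.C (Polynomial.C (e m) * (Polynomial.X + 1) ^ m) * Polynomial.X ^ (n - m) := by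
    simp
  have c2 (m : ℕ) : (Polynomial.C.comp Polynomial.C) (e m) *
      (Polynomial.C Polynomial.X : Polynomial (Polynomial R)) ^ m * 1 ^ (n - m) =
      Polynomial.C (Polynomial.C (e m) * Polynomial.X ^ m) := by
    simp
  have c3 (m : ℕ) : (Polynomial.C.comp Polynomial.C) (e m) *
      (Polynomial.C Polynomial.X : Polynomial (Polynomial R)) ^ m * (1 + Polynomial.X) ^ (n - m) =
      Polynomial.C (Polynomial.C (e m) * Polynomial.X ^ m) * (1 + Polynomial.X) ^ (n - m) := by
    simp
  have c4 (m : ℕ) : (Polynomial.C.comp Polynomial.C) (e m) *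
      (1 : Polynomial (Polynomial R)) ^ m * Polynomial.X ^ (n - m) =
      Polynomial.C (Polynomial.C (e m)) * Polynomial.X ^ (n - m) := by
    simp
  have hrange {m : ℕ} (hm : m ∉ Finset.range (n + 1)) : n < m := by
    simpa [Nat.lt_succ_iff] using hm
  simp only [c1, c2, c3, c4, Polynomial.coeff_add, Polynomial.finsetSum_coeff,
    Polynomial.coeff_C_mul, Polynomial.coeff_X_pow, Polynomial.coeff_one_add_X_pow,
    Polynomial.coeff_C_of_ne_zero hk.ne'] at this
  rw [Finset.sum_eq_single (i + j), Finset.sum_eq_zero (s := Finset.range (n + 1)),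
    Finset.sum_eq_single i, Finset.sum_eq_zero (s := Finset.range (n + 1))] at this
  · rw [if_pos (by omega), mul_one, Polynomial.coeff_C_mul, Polynomial.coeff_X_add_one_pow,
      Polynomial.coeff_mul_natCast, Polynomial.coeff_C_mul, Polynomial.coeff_X_pow_self,
      show n - i = k + j by omega] at this
    rw [add_comm j k, ← Nat.choose_symm_add (a := k)]
    linear_combination this
  · intro m _
    split_ifs
    · rw [Polynomial.coeff_one, if_neg hi.ne', mul_zero]
    · rw [Polynomial.coeff_zero, mul_zero]
  · intro m _ hm
    rw [Polynomial.coeff_mul_natCast, Polynomial.coeff_C_mul, Polynomial.coeff_X_pow,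
      if_neg (Ne.symm hm), mul_zero, zero_mul]
  · intro h
    exact absurd (hrange h) (by omega)
  · simp
  · intro m hm hne
    have := Finset.mem_range.1 hm
    rw [if_neg (by omega), mul_zero, Polynomial.coeff_zero]
  · intro h
    exact absurd (hrange h) (by omega)

/-- Setting `y = 0`, the deviation becomes `P(x) - P(x) - P(0) = 0`. -/
theorem formCoeff_right_end (hP : PowerSeries.constantCoeff P = 0) :
    formCoeff (deviation F P) n n = 0 := by
  have hX : PowerSeries.constantCoeff (PowerSeries.X : PowerSeries R) = 0 := by simp
  have h0 : PowerSeries.constantCoeff (0 : PowerSeries R) = 0 := map_zero _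
  have h := coeff_subst_pair hE hX h0
  have hz : P.subst (0 : PowerSeries R) = 0 := by
    exact PowerSeries.subst_zero_of_constantCoeff_zero hP
  have hd : (deviation F P).subst ![(PowerSeries.X : PowerSeries R), 0] = 0 := by
    rw [subst_deviation F P hX h0, hz, fadd_zero F hX, sub_self, sub_zero]
  rw [hd, map_zero, map_zero, Finset.sum_range_succ, Finset.sum_eq_zero] at h
  · simpa using h.symm
  · intro i hi
    have := Finset.mem_range.1 hi
    rw [zero_pow (by omega), mul_zero]

/-- On the diagonal `F(x, x) = 0`, so the deviation is `-2 P(x) = 0` and the coefficients of the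
leading form sum to zero. By symmetry those at `j` and `n - j` cancel in pairs and leave the middle
one. -/
theorem formCoeff_half (hP : PowerSeries.constantCoeff P = 0) (hF : IsOrderTwo F)
    (h2 : (2 : R) = 0) {i : ℕ} (hi : i + i = n) : formCoeff (deviation F P) n i = 0 := by
  have hX : PowerSeries.constantCoeff (PowerSeries.X : PowerSeries R) = 0 := by simp
  have h := coeff_subst_pair hE hX hX
  have hd : PowerSeries.coeff n
      ((deviation F P).subst ![(PowerSeries.X : PowerSeries R), PowerSeries.X] : PowerSeries R) =
        0 := by
    rw [subst_deviation F P hX hX, hF.fadd_self hX,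
      PowerSeries.subst_zero_of_constantCoeff_zero hP, map_sub, map_sub, map_zero]
    linear_combination -PowerSeries.coeff n (P.subst (PowerSeries.X : PowerSeries R)) * h2
  rw [hd] at h
  simp only [PowerSeries.coeff_one_X, one_pow, mul_one] at h
  rw [← Finset.add_sum_erase _ _ (Finset.mem_range.2 (show i < n + 1 by omega)),
    Finset.sum_involution (fun j _ => n - j), add_zero] at h
  · exact h.symm
  · intro j hj
    have hj' := Finset.mem_range.1 (Finset.mem_of_mem_erase hj)
    rw [formCoeff_symm hE hF (show j + (n - j) = n by omega), ← two_mul, h2, zero_mul]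
  · intro j hj _
    have := Finset.ne_of_mem_erase hj
    omega
  · intro j hj
    have hj' := Finset.mem_range.1 (Finset.mem_of_mem_erase hj)
    have := Finset.ne_of_mem_erase hj
    exact Finset.mem_erase.2 ⟨by omega, Finset.mem_range.2 (by omega)⟩
  · intro j hj
    have hj' := Finset.mem_range.1 (Finset.mem_of_mem_erase hj)
    exact Nat.sub_sub_self (by omega)

end Cocycle

theorem subst_X_pow {a : MvPowerSeries τ R} (ha : a.constantCoeff = 0) (n : ℕ) :
    (PowerSeries.X ^ n : PowerSeries R).subst a = a ^ n := by
  rw [PowerSeries.subst_pow (.of_constantCoeff_zero ha),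
    PowerSeries.subst_X (.of_constantCoeff_zero ha)]

theorem law_mem_varIdeal (F : FormalGroup R) :
    fadd F (MvPowerSeries.X 0) (MvPowerSeries.X 1) ∈ varIdeal (Fin 2) R := by
  rw [fadd_X_X]
  exact mem_span_X_iff F.zero_constantCoeff

theorem X_mem_varIdeal (i : τ) : MvPowerSeries.X i ∈ varIdeal τ R := Ideal.subset_span ⟨i, rfl⟩

theorem law_sub_mem (F : FormalGroup R) :
    fadd F (MvPowerSeries.X 0) (MvPowerSeries.X 1) -
      (MvPowerSeries.X 0 + MvPowerSeries.X 1) ∈ varIdeal (Fin 2) R ^ 2 := by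
  rw [fadd_X_X]
  refine mem_varIdeal_pow_succ (n := 1) ?_ fun i hi => ?_
  · rw [pow_one]
    exact mem_span_X_iff (by simp [F.zero_constantCoeff])
  · have e0 := F.lin_coeff_X
    have e1 := F.lin_coeff_Y
    interval_cases i
    · simp [formCoeff, e1, MvPowerSeries.coeff_index_single_X]
    · simp [formCoeff, e0, MvPowerSeries.coeff_index_single_X]

theorem law_pow_sub_mem (F : FormalGroup R) (n : ℕ) :
    fadd F (MvPowerSeries.X 0) (MvPowerSeries.X 1) ^ n -
      (MvPowerSeries.X 0 + MvPowerSeries.X 1) ^ n ∈ varIdeal (Fin 2) R ^ (n + 1) := by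
  induction n with
  | zero => simp
  | succ n ih =>
    have hs : (MvPowerSeries.X 0 + MvPowerSeries.X 1 : MvPowerSeries (Fin 2) R) ∈
      varIdeal (Fin 2) R := add_mem (X_mem_varIdeal 0) (X_mem_varIdeal 1)
    have h1 := Ideal.mul_mem_mul (Ideal.pow_mem_pow (law_mem_varIdeal F) n) (law_sub_mem F)
    have h2 := Ideal.mul_mem_mul ih hs
    rw [← pow_add] at h1
    rw [← pow_succ] at h2
    convert add_mem h1 h2 using 1
    ring

theorem deviation_dvd_mem (F : FormalGroup R) (n : ℕ) (Q : PowerSeries R) :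
    deviation F (PowerSeries.X ^ n * Q) ∈ varIdeal (Fin 2) R ^ n := by
  have key {c : MvPowerSeries (Fin 2) R} (hc : c ∈ varIdeal (Fin 2) R) :
      (PowerSeries.X ^ n * Q).subst c ∈ varIdeal (Fin 2) R ^ n := by
    have h0 := constantCoeff_of_mem_varIdeal hc
    rw [PowerSeries.subst_mul (.of_constantCoeff_zero h0), subst_X_pow h0]
    exact Ideal.mul_mem_right _ _ (Ideal.pow_mem_pow hc n)
  exact sub_mem (sub_mem (key (law_mem_varIdeal F)) (key (X_mem_varIdeal 0)))
    (key (X_mem_varIdeal 1))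

/-- Replacing `F(x, y)` by `x + y` changes its `n`th power only in higher degree, so the leading
form is `c ((x + y)^n - x^n - y^n)`. -/
theorem formCoeff_deviation_X_pow (F : FormalGroup R) (c : R) {n i : ℕ} (hi : 0 < i)
    (hin : i < n) :
    formCoeff (deviation F (PowerSeries.X ^ n * PowerSeries.C c)) n i = c * (n.choose i : R) := by
  have key {a : MvPowerSeries (Fin 2) R} (ha : a.constantCoeff = 0) :
      (PowerSeries.X ^ n * PowerSeries.C c).subst a = a ^ n * MvPowerSeries.C c := by
    rw [PowerSeries.subst_mul (.of_constantCoeff_zero ha), subst_X_pow ha]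
    congr 1
    rw [powerSeries_subst_eq_evalHom ha]
    exact evalP_C _ _ c
  have h := mem_varIdeal_pow_iff.1 (law_pow_sub_mem F n)
    (Finsupp.single 0 i + Finsupp.single 1 (n - i)) (by rw [degree_finTwo]; simp; omega)
  rw [map_sub, sub_eq_zero] at h
  have hpow (a b : ℕ) := coeff_finTwo_monomial a b i (n - i) (1 : R)
  simp only [map_one, one_mul] at hpow
  have hbin : MvPowerSeries.coeff (Finsupp.single 0 i + Finsupp.single 1 (n - i))
      ((MvPowerSeries.X 0 + MvPowerSeries.X 1 : MvPowerSeries (Fin 2) R) ^ n) = n.choose i := by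
    rw [add_pow, map_sum, Finset.sum_eq_single i]
    · rw [← map_natCast (MvPowerSeries.C (σ := Fin 2) (R := R)), MvPowerSeries.coeff_mul_C, hpow,
        if_pos ⟨rfl, rfl⟩, one_mul]
    · intro j _ hj
      rw [← map_natCast (MvPowerSeries.C (σ := Fin 2) (R := R)), MvPowerSeries.coeff_mul_C, hpow,
        if_neg fun h => hj h.1.symm, zero_mul]
    · intro h
      exact absurd (Finset.mem_range.2 (by omega)) h
  have h0 := hpow n 0
  have h1 := hpow 0 n
  rw [pow_zero, mul_one, if_neg (by omega)] at h0
  rw [pow_zero, one_mul, if_neg (by omega)] at h1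
  rw [formCoeff, deviation, key (constantCoeff_of_mem_varIdeal (law_mem_varIdeal F)),
    key (constantCoeff_X_fin 0), key (constantCoeff_X_fin 1), map_sub, map_sub,
    MvPowerSeries.coeff_mul_C, MvPowerSeries.coeff_mul_C, MvPowerSeries.coeff_mul_C, h, hbin,
    h0, h1]
  ring

/-- The obstruction in degree `n` is a symmetric cocycle with zero middle coefficient, hence a
coboundary, and a term in `X ^ n` produces the same coboundary. -/
theorem exists_deviation_mem (h2 : (2 : R) = 0) {F : FormalGroup R} (hF : IsOrderTwo F)
    {P : PowerSeries R} (hP : PowerSeries.constantCoeff P = 0) {n : ℕ} (hn : 2 ≤ n)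
    (hE : deviation F P ∈ varIdeal (Fin 2) R ^ n) :
    ∃ c, deviation F (P + PowerSeries.X ^ n * PowerSeries.C c) ∈
      varIdeal (Fin 2) R ^ (n + 1) := by
  obtain ⟨c, hc⟩ := exists_cocycle_eq h2 hn (b := formCoeff (deviation F P) n)
    (fun i j hij => formCoeff_symm hE hF hij)
    (fun i j k hi hj hk hijk => formCoeff_cocycle hE hi hj hk hijk)
    (fun i hi => formCoeff_half hE hP hF h2 hi)
  have hE' : deviation F (P + PowerSeries.X ^ n * PowerSeries.C c) ∈ varIdeal (Fin 2) R ^ n := by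
    rw [deviation_add]
    exact add_mem hE (deviation_dvd_mem F n _)
  have hP' : PowerSeries.constantCoeff (P + PowerSeries.X ^ n * PowerSeries.C c) = 0 := by
    simp [hP, show n ≠ 0 by omega]
  refine ⟨c, mem_varIdeal_pow_succ hE' fun i hi => ?_⟩
  have hend := formCoeff_right_end hE' hP'
  rcases Nat.eq_zero_or_pos i with rfl | hi0
  · rwa [formCoeff_symm hE' hF (zero_add n)]
  rcases hi.eq_or_lt with rfl | hi
  · exact hend
  · rw [deviation_add, formCoeff_add, hc i hi0 hi, formCoeff_deviation_X_pow F c hi0 hi]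
    -- In characteristic two, adding the correction cancels the obstruction.
    linear_combination c * (n.choose i : R) * h2

theorem exists_additive_series (h2 : (2 : R) = 0) {F : FormalGroup R} (hF : IsOrderTwo F) :
    ∃ P : PowerSeries R, PowerSeries.constantCoeff P = 0 ∧ PowerSeries.coeff 1 P = 1 ∧
      deviation F P = 0 := by
  let Good (n : ℕ) : Type _ := {P : PowerSeries R // PowerSeries.constantCoeff P = 0 ∧
    deviation F P ∈ varIdeal (Fin 2) R ^ (n + 2)}
  have hX : PowerSeries.constantCoeff (PowerSeries.X : PowerSeries R) = 0 ∧
      deviation F PowerSeries.X ∈ varIdeal (Fin 2) R ^ (0 + 2) := by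
    refine ⟨by simp, ?_⟩
    rw [deviation, PowerSeries.subst_X (.of_constantCoeff_zero (constantCoeff_X_fin 0)),
      PowerSeries.subst_X (.of_constantCoeff_zero (constantCoeff_X_fin 1)),
      PowerSeries.subst_X (.of_constantCoeff_zero
        (constantCoeff_of_mem_varIdeal (law_mem_varIdeal F))), sub_sub]
    exact law_sub_mem F
  have hstep (n : ℕ) (P : Good n) : ∃ Q : Good (n + 1),
      ∃ c, Q.1 = P.1 + PowerSeries.X ^ (n + 2) * PowerSeries.C c := by
    obtain ⟨c, hc⟩ := exists_deviation_mem h2 hF P.2.1 (by omega) P.2.2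
    exact ⟨⟨_, by simp [P.2.1], hc⟩, c, rfl⟩
  choose next hnext using hstep
  let seq (n : ℕ) : Good n := Nat.rec ⟨PowerSeries.X, hX⟩ next n
  have hdvd (n k : ℕ) : PowerSeries.X ^ (n + 2) ∣ (seq (n + k)).1 - (seq n).1 := by
    induction k with
    | zero => simp
    | succ k ih =>
      obtain ⟨c, hc⟩ := hnext (n + k) (seq (n + k))
      have e : (seq (n + (k + 1))).1 = (seq (n + k)).1 +
        PowerSeries.X ^ (n + k + 2) * PowerSeries.C c := hc
      rw [e, add_sub_right_comm]
      exact dvd_add ih (dvd_mul_of_dvd_left (pow_dvd_pow _ (by omega)) _)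
  -- The `X`-adic limit: all corrections after stage `k` have degree at least `k + 2`, so the
  -- coefficient in degree `k` is final there.
  let P : PowerSeries R := PowerSeries.mk fun k => PowerSeries.coeff k (seq k).1
  have hP (n : ℕ) : PowerSeries.X ^ (n + 2) ∣ P - (seq n).1 := by
    rw [PowerSeries.X_pow_dvd_iff]
    intro m hm
    rw [map_sub, PowerSeries.coeff_mk, sub_eq_zero]
    rcases le_total n m with h | h
    · obtain ⟨k, rfl⟩ := Nat.exists_eq_add_of_le h
      have := PowerSeries.X_pow_dvd_iff.1 (hdvd n k) (n + k) hm
      rwa [map_sub, sub_eq_zero] at this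
    · obtain ⟨k, rfl⟩ := Nat.exists_eq_add_of_le h
      have := PowerSeries.X_pow_dvd_iff.1 (hdvd m k) m (by omega)
      rwa [map_sub, sub_eq_zero, eq_comm] at this
  refine ⟨P, ?_, ?_, ?_⟩
  · rw [← PowerSeries.coeff_zero_eq_constantCoeff_apply, PowerSeries.coeff_mk,
      PowerSeries.coeff_zero_eq_constantCoeff_apply, (seq 0).2.1]
  · have := PowerSeries.X_pow_dvd_iff.1 (hP 0) 1 (by omega)
    rw [map_sub, sub_eq_zero] at this
    rw [this]
    exact PowerSeries.coeff_one_X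
  · ext d
    obtain ⟨q, hq⟩ := hP d.degree
    have hmem : deviation F P ∈ varIdeal (Fin 2) R ^ (d.degree + 2) := by
      rw [← sub_add_cancel P (seq d.degree).1, hq, deviation_add]
      exact add_mem (deviation_dvd_mem F _ q) (seq d.degree).2.2
    exact mem_varIdeal_pow_iff.1 hmem d (by omega)

/-- A formal group law of order two is isomorphic to the additive group law. -/
theorem exists_logarithm (h2 : (2 : R) = 0) {F : FormalGroup R} (hF : IsOrderTwo F) :
    ∃ g : Param R, g • F = FormalGroup.𝔾ₐ := by
  obtain ⟨P, hP0, hP1, hP⟩ := exists_additive_series h2 hF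
  let g : Param R := ⟨P, hP0, by rw [hP1]; exact isUnit_one⟩
  refine ⟨g, Param.smul_eq_of_fadd ?_⟩
  rw [fadd_additive (g.constantCoeff_app (constantCoeff_X_fin 0))
    (g.constantCoeff_app (constantCoeff_X_fin 1))]
  rw [deviation, sub_sub, sub_eq_zero] at hP
  exact hP

theorem universalLaw_map_augmentation :
    universalLaw.map (lazardAugmentation : Lazard →+* ZMod 2) = FormalGroup.𝔾ₐ :=
  universalLaw_map_lazardLift _ _

/-- Any logarithm `l` reduces under the augmentation to an automorphism of the additive law over
`ℤ/2`. Dividing by its constant extension to `N_*` normalises `l` without changing the transported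
law. -/
theorem exists_universal_logarithm : ∃ g : Param Lazard, g • universalLaw = FormalGroup.𝔾ₐ ∧
    Param.map (lazardAugmentation : Lazard →+* ZMod 2) g = 1 := by
  obtain ⟨l, hl⟩ := exists_logarithm (two_eq_zero_of_algebra Lazard) isOrderTwo_universalLaw
  let aug : Lazard →+* ZMod 2 := lazardAugmentation
  let inc : ZMod 2 →+* Lazard := algebraMap (ZMod 2) Lazard
  have hm : Param.map inc (Param.map aug l) • (FormalGroup.𝔾ₐ : FormalGroup Lazard) =
      FormalGroup.𝔾ₐ := by
    have := congrArg (fun F => (F.map aug).map inc) hl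
    simpa only [Param.map_smul, map_additive, universalLaw_map_augmentation, aug] using this
  refine ⟨(Param.map inc (Param.map aug l))⁻¹ * l, ?_, ?_⟩
  · rw [mul_smul, hl, inv_smul_eq_iff, hm]
  · rw [map_mul, map_inv, Param.map_map]
    have : aug.comp inc = RingHom.id _ := Subsingleton.elim _ _
    rw [show ((lazardAugmentation : Lazard →+* ZMod 2).comp inc) = RingHom.id _ from this,
      Param.map_id, inv_mul_cancel]

/-- A logarithm of the universal formal group law of order two which reduces to the identity under
the augmentation. -/
def universalLog : Param Lazard := exists_universal_logarithm.choose

theorem universalLog_smul : universalLog • universalLaw = FormalGroup.𝔾ₐ :=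
  exists_universal_logarithm.choose_spec.1

theorem map_augmentation_universalLog :
    Param.map (lazardAugmentation : Lazard →+* ZMod 2) universalLog = 1 :=
  exists_universal_logarithm.choose_spec.2

end Logarithm

/-! ### Points of the Hopf algebras and coactions -/

section TensorPoints

variable {A R S T : Type*} [CommRing A] [CommRing R] [CommRing S] [CommRing T]
  [Algebra (ZMod 2) A] [Algebra (ZMod 2) R] [Algebra (ZMod 2) S] [Algebra (ZMod 2) T]

/-- A ring homomorphism between `ℤ/2`-algebras is an algebra homomorphism. -/
def toAlg (f : R →+* S) : R →ₐ[ZMod 2] S :=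
  { f with
    commutes' := fun r => RingHom.congr_fun
      (Subsingleton.elim (f.comp (algebraMap (ZMod 2) R)) (algebraMap (ZMod 2) S)) r }

/-- The homomorphism out of a tensor product given by two homomorphisms. -/
def tens (f : A →+* S) (g : R →+* S) : A ⊗[ZMod 2] R →+* S :=
  (Algebra.TensorProduct.lift (toAlg f) (toAlg g) fun _ _ => Commute.all _ _ :
    A ⊗[ZMod 2] R →ₐ[ZMod 2] S)

theorem tens_tmul (f : A →+* S) (g : R →+* S) (a : A) (r : R) :
    tens f g (a ⊗ₜ r) = f a * g r :=
  Algebra.TensorProduct.lift_tmul _ _ (fun _ _ => Commute.all _ _) a r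

theorem tens_comp_inclL (f : A →+* S) (g : R →+* S) : (tens f g).comp (inclL A R) = f := by
  ext a
  change tens f g (a ⊗ₜ 1) = _
  rw [tens_tmul, map_one, mul_one]

theorem tens_comp_inclR (f : A →+* S) (g : R →+* S) : (tens f g).comp (inclR A R) = g := by
  ext a
  change tens f g (1 ⊗ₜ a) = _
  rw [tens_tmul, map_one, one_mul]

theorem tens_ext {h k : A ⊗[ZMod 2] R →+* S} (hl : h.comp (inclL A R) = k.comp (inclL A R))
    (hr : h.comp (inclR A R) = k.comp (inclR A R)) : h = k := by
  have : toAlg h = toAlg k := by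
    refine Algebra.TensorProduct.ext' fun a r => ?_
    have e : a ⊗ₜ[ZMod 2] r = inclL A R a * inclR A R r := by
      simp
    rw [e, map_mul, map_mul]
    exact congrArg₂ (· * ·) (RingHom.congr_fun hl a) (RingHom.congr_fun hr r)
  exact congrArg (fun f : A ⊗[ZMod 2] R →ₐ[ZMod 2] S => (f : A ⊗[ZMod 2] R →+* S)) this

theorem comp_tens (h : S →+* T) (f : A →+* S) (g : R →+* S) :
    h.comp (tens f g) = tens (h.comp f) (h.comp g) :=
  tens_ext (by rw [RingHom.comp_assoc, tens_comp_inclL, tens_comp_inclL])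
    (by rw [RingHom.comp_assoc, tens_comp_inclR, tens_comp_inclR])

theorem tens_inclL_inclR : tens (inclL A R) (inclR A R) = RingHom.id _ :=
  tens_ext (by rw [tens_comp_inclL]; rfl) (by rw [tens_comp_inclR]; rfl)

theorem eq_tens (h : A ⊗[ZMod 2] R →+* S) :
    h = tens (h.comp (inclL A R)) (h.comp (inclR A R)) := by
  rw [← comp_tens, tens_inclL_inclR, RingHom.comp_id]

theorem tens_comp_map {A' R' : Type*} [CommRing A'] [CommRing R'] [Algebra (ZMod 2) A']
    [Algebra (ZMod 2) R'] (f : A →+* S) (g : R →+* S) (α : A' →ₐ[ZMod 2] A)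
    (β : R' →ₐ[ZMod 2] R) :
    (tens f g).comp (Algebra.TensorProduct.map α β : A' ⊗[ZMod 2] R' →+* A ⊗[ZMod 2] R) =
      tens (f.comp (α : A' →+* A)) (g.comp (β : R' →+* R)) := by
  refine tens_ext ?_ ?_
  · rw [tens_comp_inclL]
    ext a
    change tens f g (Algebra.TensorProduct.map α β (a ⊗ₜ 1)) = f (α a)
    rw [Algebra.TensorProduct.map_tmul, tens_tmul, map_one, map_one, mul_one]
  · rw [tens_comp_inclR]
    ext a
    change tens f g (Algebra.TensorProduct.map α β (1 ⊗ₜ a)) = g (β a)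
    rw [Algebra.TensorProduct.map_tmul, tens_tmul, map_one, map_one, one_mul]

theorem map_eq_tens {A' R' : Type*} [CommRing A'] [CommRing R'] [Algebra (ZMod 2) A']
    [Algebra (ZMod 2) R'] (α : A' →ₐ[ZMod 2] A) (β : R' →ₐ[ZMod 2] R) :
    (Algebra.TensorProduct.map α β : A' ⊗[ZMod 2] R' →+* A ⊗[ZMod 2] R) =
      tens ((inclL A R).comp (α : A' →+* A)) ((inclR A R).comp (β : R' →+* R)) := by
  rw [← tens_comp_map, tens_inclL_inclR]
  rfl

/-- The action of a point `e` of `A` on a point `f` of a ring with a coaction of `A`. -/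
def act (φ : R →ₐ[ZMod 2] A ⊗[ZMod 2] R) (e : A →+* S) (f : R →+* S) : R →+* S :=
  (tens e f).comp (φ : R →+* A ⊗[ZMod 2] R)

theorem comp_act (φ : R →ₐ[ZMod 2] A ⊗[ZMod 2] R) (h : S →+* T) (e : A →+* S) (f : R →+* S) :
    h.comp (act φ e f) = act φ (h.comp e) (h.comp f) := by
  rw [act, ← RingHom.comp_assoc, comp_tens, act]

theorem act_universal (φ : R →ₐ[ZMod 2] A ⊗[ZMod 2] R) :
    act φ (inclL A R) (inclR A R) = (φ : R →+* A ⊗[ZMod 2] R) := by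
  rw [act, tens_inclL_inclR, RingHom.id_comp]

variable {δ : A →ₐ[ZMod 2] A ⊗[ZMod 2] A} {ε : A →ₐ[ZMod 2] ZMod 2}
  {φ : R →ₐ[ZMod 2] A ⊗[ZMod 2] R}

theorem tens_tens_comp_assoc (e₁ e₂ : A →+* S) (f : R →+* S) :
    (tens e₁ (tens e₂ f)).comp
        (Algebra.TensorProduct.assoc (ZMod 2) (ZMod 2) (ZMod 2) A A R :
          (A ⊗[ZMod 2] A) ⊗[ZMod 2] R →+* A ⊗[ZMod 2] (A ⊗[ZMod 2] R)) =
      tens (tens e₁ e₂) f := by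
  refine tens_ext (tens_ext ?_ ?_) ?_
  · rw [tens_comp_inclL, tens_comp_inclL]
    ext a
    change tens e₁ (tens e₂ f) (a ⊗ₜ (1 ⊗ₜ 1)) = _
    rw [tens_tmul, tens_tmul]
    simp
  · rw [tens_comp_inclL, tens_comp_inclR]
    ext a
    change tens e₁ (tens e₂ f) (1 ⊗ₜ (a ⊗ₜ 1)) = _
    rw [tens_tmul, tens_tmul]
    simp
  · rw [tens_comp_inclR]
    ext a
    change tens e₁ (tens e₂ f) (1 ⊗ₜ (1 ⊗ₜ a)) = _
    rw [tens_tmul, tens_tmul]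
    simp

/-- Coassociativity read on points: the diagonal encodes the product in the group of points of `A`.
-/
theorem IsCoaction.act_act (h : IsCoaction δ ε φ) (e₁ e₂ : A →+* S) (f : R →+* S) :
    act φ e₁ (act φ e₂ f) = act φ ((tens e₁ e₂).comp (δ : A →+* A ⊗[ZMod 2] A)) f := by
  have h1 : tens e₁ (act φ e₂ f) =
      (tens e₁ (tens e₂ f)).comp (Algebra.TensorProduct.map (AlgHom.id (ZMod 2) A) φ :
        A ⊗[ZMod 2] R →+* A ⊗[ZMod 2] (A ⊗[ZMod 2] R)) := by
    rw [tens_comp_map]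
    rfl
  have h2 : tens ((tens e₁ e₂).comp (δ : A →+* A ⊗[ZMod 2] A)) f =
      (tens (tens e₁ e₂) f).comp (Algebra.TensorProduct.map δ (AlgHom.id (ZMod 2) R) :
        A ⊗[ZMod 2] R →+* (A ⊗[ZMod 2] A) ⊗[ZMod 2] R) := by
    rw [tens_comp_map]
    rfl
  change (tens e₁ (act φ e₂ f)).comp _ = (tens _ f).comp _
  rw [h1, h2, ← tens_tens_comp_assoc]
  ext r
  exact congrArg (tens e₁ (tens e₂ f)) (h.coassoc r).symm

theorem IsCoaction.act_counit (h : IsCoaction δ ε φ) (f : R →+* S) :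
    act φ ((algebraMap (ZMod 2) S).comp (ε : A →+* ZMod 2)) f = f := by
  have h1 : tens ((algebraMap (ZMod 2) S).comp (ε : A →+* ZMod 2)) f =
      (f.comp (Algebra.TensorProduct.lid (ZMod 2) R : ZMod 2 ⊗[ZMod 2] R →+* R)).comp
        (Algebra.TensorProduct.map ε (AlgHom.id (ZMod 2) R) :
          A ⊗[ZMod 2] R →+* ZMod 2 ⊗[ZMod 2] R) := by
    refine tens_ext ?_ ?_
    · rw [tens_comp_inclL]
      ext a
      change algebraMap (ZMod 2) S (ε a) = f (Algebra.TensorProduct.lid (ZMod 2) R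
        (Algebra.TensorProduct.map ε (AlgHom.id (ZMod 2) R) (a ⊗ₜ 1)))
      rw [Algebra.TensorProduct.map_tmul, map_one, Algebra.TensorProduct.lid_tmul,
        Algebra.smul_def, mul_one]
      exact (RingHom.congr_fun (Subsingleton.elim (f.comp (algebraMap (ZMod 2) R))
        (algebraMap (ZMod 2) S)) (ε a)).symm
    · rw [tens_comp_inclR]
      ext r
      change f r = f (Algebra.TensorProduct.lid (ZMod 2) R
        (Algebra.TensorProduct.map ε (AlgHom.id (ZMod 2) R) (1 ⊗ₜ r)))
      simp
  rw [act, h1]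
  ext r
  exact congrArg f (h.counit r)

/-- A Yoneda argument: coassociativity is the case of the universal points, the three inclusions
into `A ⊗ (A ⊗ R)`. -/
theorem isCoaction_of_act
    (h1 : act φ ((algebraMap (ZMod 2) R).comp (ε : A →+* ZMod 2)) (RingHom.id R) = RingHom.id R)
    (h2 : ∀ e₁ e₂ : A →+* A ⊗[ZMod 2] (A ⊗[ZMod 2] R), ∀ f : R →+* A ⊗[ZMod 2] (A ⊗[ZMod 2] R),
      act φ e₁ (act φ e₂ f) = act φ ((tens e₁ e₂).comp (δ : A →+* A ⊗[ZMod 2] A)) f) :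
    IsCoaction δ ε φ where
  counit r := by
    refine Eq.trans ?_ (RingHom.congr_fun h1 r)
    change _ = tens _ _ (φ r)
    generalize φ r = z
    induction z with
    | zero => simp
    | add x y hx hy => rw [map_add, map_add, map_add, hx, hy]
    | tmul a s =>
      rw [tens_tmul, Algebra.TensorProduct.map_tmul, Algebra.TensorProduct.lid_tmul,
        Algebra.smul_def]
      rfl
  coassoc r := by
    have h := RingHom.congr_fun (h2 (inclL A _) ((inclR A _).comp (inclL A R))
      ((inclR A _).comp (inclR A R))) r
    have hid : tens (inclL A (A ⊗[ZMod 2] R))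
        (tens ((inclR A _).comp (inclL A R)) ((inclR A _).comp (inclR A R))) =
          RingHom.id _ := by
      rw [← comp_tens, tens_inclL_inclR, RingHom.comp_id, tens_inclL_inclR]
    have e1 : Algebra.TensorProduct.map (AlgHom.id (ZMod 2) A) φ (φ r) =
        act φ (inclL A _) (act φ ((inclR A _).comp (inclL A R))
          ((inclR A _).comp (inclR A R))) r := by
      change (Algebra.TensorProduct.map (AlgHom.id (ZMod 2) A) φ :
        A ⊗[ZMod 2] R →+* A ⊗[ZMod 2] (A ⊗[ZMod 2] R)) (φ r) = tens _ _ (φ r)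
      rw [map_eq_tens, ← comp_act, act_universal]
      rfl
    have e2 : Algebra.TensorProduct.assoc (ZMod 2) (ZMod 2) (ZMod 2) A A R
        (Algebra.TensorProduct.map δ (AlgHom.id (ZMod 2) R) (φ r)) =
        act φ ((tens (inclL A _) ((inclR A _).comp (inclL A R))).comp
          (δ : A →+* A ⊗[ZMod 2] A)) ((inclR A _).comp (inclR A R)) r := by
      change _ = tens _ _ (φ r)
      have h3 := tens_comp_map (tens (inclL A _) ((inclR A _).comp (inclL A R)))
        ((inclR A _).comp (inclR A R)) δ (AlgHom.id (ZMod 2) R)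
      have h4 := tens_tens_comp_assoc (inclL A _) ((inclR A _).comp (inclL A R))
        ((inclR A _).comp (inclR A R))
      rw [hid, RingHom.id_comp] at h4
      rw [← h4] at h3
      exact RingHom.congr_fun h3 (φ r)
    rw [e1, e2, h]

end TensorPoints

/-! ### Points of `B_*` and `A_*` as changes of parameter -/

section ParamPoints

variable {R S T : Type*} [CommRing R] [CommRing S] [CommRing T]
  [Algebra (ZMod 2) R] [Algebra (ZMod 2) S] [Algebra (ZMod 2) T]

omit [Algebra (ZMod 2) S] in
theorem laurent_ext {f g : LaurentRing →+* S} (h : ∀ n, f (laurentGen n) = g (laurentGen n)) :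
    f = g := by
  refine IsLocalization.ringHom_ext (Submonoid.powers (MvPolynomial.X 0 : MvPolynomial ℕ (ZMod 2)))
    (MvPolynomial.ringHom_ext (fun r => ?_) fun n => h n)
  exact RingHom.congr_fun (Subsingleton.elim
    ((f.comp (algebraMap (MvPolynomial ℕ (ZMod 2)) LaurentRing)).comp MvPolynomial.C)
    ((g.comp (algebraMap (MvPolynomial ℕ (ZMod 2)) LaurentRing)).comp MvPolynomial.C)) r

/-- The universal change of parameter. -/
def hParam : Param FaaDiBruno := ⟨hSeries, constantCoeff_hSeries, isUnit_coeff_one_hSeries⟩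

/-- The universal additive change of parameter. -/
def xiParam : Param Milnor := ⟨xiSeries, constantCoeff_xiSeries, isUnit_coeff_one_xiSeries⟩

/-- The point of `B_*` given by a change of parameter. -/
def evB (g : Param S) : FaaDiBruno →+* S :=
  (laurentLift (fun n => PowerSeries.coeff (n + 1) g.toSeries) g.isUnit_coeff :
    LaurentRing →ₐ[ZMod 2] S)

/-- The point of `A_*` given by the coefficients of `x^(2^i)` of a change of parameter. -/
def evA (g : Param S) : Milnor →+* S :=
  (laurentLift (fun n => PowerSeries.coeff (2 ^ n) g.toSeries) g.isUnit_coeff :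
    LaurentRing →ₐ[ZMod 2] S)

theorem evB_gen (g : Param S) (n : ℕ) :
    evB g (laurentGen n) = PowerSeries.coeff (n + 1) g.toSeries :=
  laurentLift_gen (fun n => PowerSeries.coeff (n + 1) g.toSeries) g.isUnit_coeff n

theorem evA_gen (g : Param S) (n : ℕ) :
    evA g (laurentGen n) = PowerSeries.coeff (2 ^ n) g.toSeries :=
  laurentLift_gen (fun n => PowerSeries.coeff (2 ^ n) g.toSeries) g.isUnit_coeff n

theorem map_evB (g : Param S) : Param.map (evB g) hParam = g := by
  ext n
  rw [Param.toSeries_map, PowerSeries.coeff_map]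
  rcases n with _ | n
  · rw [PowerSeries.coeff_zero_eq_constantCoeff_apply, PowerSeries.coeff_zero_eq_constantCoeff_apply,
      g.constantCoeff_eq, hParam.constantCoeff_eq, map_zero]
  · change evB g (PowerSeries.coeff (n + 1) hSeries) = _
    rw [coeff_succ_hSeries, evB_gen]

theorem evB_map (e : FaaDiBruno →+* S) : evB (Param.map e hParam) = e := by
  refine laurent_ext fun n => ?_
  rw [evB_gen, Param.toSeries_map, PowerSeries.coeff_map]
  exact congrArg e (coeff_succ_hSeries n)

theorem evA_map (e : Milnor →+* S) : evA (Param.map e xiParam) = e := by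
  refine laurent_ext fun n => ?_
  rw [evA_gen, Param.toSeries_map, PowerSeries.coeff_map]
  exact congrArg e (coeff_two_pow_xiSeries n)

theorem comp_evB (h : S →+* T) (g : Param S) : h.comp (evB g) = evB (Param.map h g) := by
  rw [← evB_map (h.comp (evB g)), ← Param.map_map, map_evB]

theorem comp_evA (h : S →+* T) (g : Param S) : h.comp (evA g) = evA (Param.map h g) := by
  refine laurent_ext fun n => ?_
  rw [RingHom.comp_apply, evA_gen, evA_gen, Param.toSeries_map, PowerSeries.coeff_map]

/-- The changes of parameter which are additive. -/
def Param.IsAdditive (g : Param S) : Prop :=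
  g • (FormalGroup.𝔾ₐ : FormalGroup S) = FormalGroup.𝔾ₐ

omit [Algebra (ZMod 2) S] in
theorem Param.IsAdditive.mul {g k : Param S} (hg : g.IsAdditive) (hk : k.IsAdditive) :
    (g * k).IsAdditive := by
  rw [IsAdditive, mul_smul, hk, hg]

omit [Algebra (ZMod 2) S] in
theorem Param.isAdditive_one : (1 : Param S).IsAdditive := one_smul _ _

omit [Algebra (ZMod 2) S] [Algebra (ZMod 2) T] in
theorem Param.IsAdditive.map (h : S →+* T) {g : Param S} (hg : g.IsAdditive) :
    (Param.map h g).IsAdditive := by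
  have := congrArg (FormalGroup.map · h) hg
  simpa only [Param.map_smul, map_additive] using! this

theorem isOrderTwo_additive_of_algebra (S : Type*) [CommRing S] [Algebra (ZMod 2) S] :
    IsOrderTwo (FormalGroup.𝔾ₐ : FormalGroup S) := by
  have := (isOrderTwo_additive (R := ZMod 2)).map (algebraMap (ZMod 2) S)
  rwa [map_additive] at this

-- The condition is the vanishing of the mixed coefficients of `g(x + y) - g(x) - g(y)`.
omit [Algebra (ZMod 2) S] in
theorem Param.isAdditive_iff (g : Param S) : g.IsAdditive ↔
    ∀ i j, 0 < i → 0 < j → ((i + j).choose i : S) * PowerSeries.coeff (i + j) g.toSeries = 0 := by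
  have h0 (i : Fin 2) : g.app (MvPowerSeries.X i) = g.toSeries.subst (MvPowerSeries.X i) := rfl
  have hcoeff (e : Fin 2 →₀ ℕ) : MvPowerSeries.coeff e
      (g.toSeries.subst (MvPowerSeries.X 0 + MvPowerSeries.X 1 : MvPowerSeries (Fin 2) S)) =
      (e 0 + e 1).choose (e 0) * PowerSeries.coeff (e 0 + e 1) g.toSeries :=
    PowerSeries.coeff_subst_X_zero_add_X_one _ e
  have hsingle (i : Fin 2) (e : Fin 2 →₀ ℕ) : MvPowerSeries.coeff e
      (g.toSeries.subst (MvPowerSeries.X i : MvPowerSeries (Fin 2) S)) =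
      if e = Finsupp.single i (e i) then PowerSeries.coeff (e i) g.toSeries else 0 :=
    (PowerSeries.coeff_subst_single i _ e).trans (by congr)
  have hadd : g.IsAdditive ↔
      g.toSeries.subst (MvPowerSeries.X 0 + MvPowerSeries.X 1 : MvPowerSeries (Fin 2) S) =
        g.toSeries.subst (MvPowerSeries.X 0) + g.toSeries.subst (MvPowerSeries.X 1) := by
    have h1 := fadd_additive (constantCoeff_X_fin (R := S) 0) (constantCoeff_X_fin 1)
    have h2 := fadd_additive (g.constantCoeff_app (constantCoeff_X_fin (R := S) 0))
      (g.constantCoeff_app (constantCoeff_X_fin 1))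
    refine ⟨fun h => ?_, fun h => smul_eq_of_fadd ?_⟩
    · have := fadd_smul_app g FormalGroup.𝔾ₐ (constantCoeff_X_fin (R := S) 0)
        (constantCoeff_X_fin 1)
      rw [show g • FormalGroup.𝔾ₐ = FormalGroup.𝔾ₐ from h, h2, h1] at this
      exact this.symm
    · rw [h1, h2]
      exact h
  rw [hadd]
  refine ⟨fun h i j hi hj => ?_, fun h => ?_⟩
  · have := congrArg (MvPowerSeries.coeff (Finsupp.single 0 i + Finsupp.single 1 j)) h
    rw [hcoeff, map_add, hsingle, hsingle, if_neg, if_neg] at this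
    · simpa using this
    · intro h'
      have := DFunLike.congr_fun h' 0
      simp at this
      omega
    · intro h'
      have := DFunLike.congr_fun h' 1
      simp at this
      omega
  · ext e
    rw [hcoeff, map_add, hsingle, hsingle]
    have hg0 : PowerSeries.coeff 0 g.toSeries = 0 := by
      rw [PowerSeries.coeff_zero_eq_constantCoeff_apply, g.constantCoeff_eq]
    obtain ⟨i, j, rfl⟩ : ∃ i j, e = Finsupp.single 0 i + Finsupp.single 1 j :=
      ⟨_, _, finsupp_fin_two_eq e⟩
    rcases Nat.eq_zero_or_pos i with rfl | hi
    · rcases Nat.eq_zero_or_pos j with rfl | hj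
      · simp [hg0]
      · simp [hj.ne']
    · rcases Nat.eq_zero_or_pos j with rfl | hj
      · simp [hi.ne']
      · rw [if_neg, if_neg]
        · simpa using h i j hi hj
        · intro h'
          have := DFunLike.congr_fun h' 0
          simp at this
          omega
        · intro h'
          have := DFunLike.congr_fun h' 1
          simp at this
          omega

/-- Write `n = 2 ^ u r` with `r > 1` odd: the binomial coefficient of `n` over `2 ^ u` is odd, yet
it annihilates the coefficient of `x ^ n`. -/
theorem Param.IsAdditive.coeff_eq_zero {g : Param S} (hg : g.IsAdditive) {n : ℕ}
    (hn : ∀ i, n ≠ 2 ^ i) : PowerSeries.coeff n g.toSeries = 0 := by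
  rcases Nat.eq_zero_or_pos n with rfl | hpos
  · rw [PowerSeries.coeff_zero_eq_constantCoeff_apply, g.constantCoeff_eq]
  obtain ⟨u, r, hr, hnr⟩ := Nat.exists_eq_two_pow_mul_odd hpos.ne'
  have hr1 : 1 < r := by
    rcases Nat.lt_or_ge 1 r with h | h
    · exact h
    · have := hr.pos
      exact absurd (by rw [hnr, show r = 1 by omega, mul_one]) (hn u)
  have hlt : 2 ^ u < n := by
    rw [hnr]
    exact lt_mul_of_one_lt_right (by positivity) hr1
  have := g.isAdditive_iff.1 hg (2 ^ u) (n - 2 ^ u) (by positivity) (by omega)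
  rw [Nat.add_sub_cancel' hlt.le] at this
  refine eq_zero_of_choose_two_pow (two_eq_zero_of_algebra S) (x := n) (u := u) ?_ this
  rw [hnr, Nat.mul_div_cancel_left _ (by positivity)]
  exact Nat.odd_iff.1 hr

theorem isAdditive_xiParam : xiParam.IsAdditive := by
  rw [Param.isAdditive_iff]
  intro i j hi hj
  change _ * PowerSeries.coeff (i + j) xiSeries = 0
  rw [xiSeries, PowerSeries.coeff_mk]
  split_ifs with h
  · have hdvd : 2 ∣ (i + j).choose i := by
      rw [h]
      refine Nat.prime_two.dvd_choose_pow hi.ne' ?_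
      rw [← h]
      omega
    rw [natCast_of_even (two_eq_zero_of_algebra Milnor) ((Nat.modEq_zero_iff_dvd).2 hdvd), zero_mul]
  · rw [mul_zero]

/-- An additive series is determined by its coefficients at powers of two. Together with `evA_map`
this identifies the points of `A_*` with the additive changes of parameter. -/
theorem Param.IsAdditive.map_evA {g : Param S} (hg : g.IsAdditive) :
    Param.map (evA g) xiParam = g := by
  ext n
  by_cases hn : ∃ i, n = 2 ^ i
  · obtain ⟨i, rfl⟩ := hn
    rw [Param.toSeries_map, PowerSeries.coeff_map, ← evA_gen g]
    exact congrArg (evA g) (coeff_two_pow_xiSeries i)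
  · push Not at hn
    rw [hg.coeff_eq_zero hn, (isAdditive_xiParam.map _).coeff_eq_zero hn]

theorem tens_comp_comulB (g k : Param S) :
    (tens (evB g) (evB k)).comp (comulB : FaaDiBruno →+* _) = evB (g * k) := by
  rw [← evB_map ((tens (evB g) (evB k)).comp _), ← Param.map_map]
  congr 1
  have h : Param.map (comulB : FaaDiBruno →+* FaaDiBruno ⊗[ZMod 2] FaaDiBruno) hParam =
      Param.map (inclL _ _) hParam * Param.map (inclR _ _) hParam :=
    Param.ext map_comulB_hSeries
  rw [h, map_mul, Param.map_map, Param.map_map, tens_comp_inclL, tens_comp_inclR, map_evB, map_evB]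

/-- Additivity is essential, because `evA` remembers only the coefficients at powers of two and
these do not determine a composite of general series. -/
theorem tens_comp_comulA {g k : Param S} (hg : g.IsAdditive) (hk : k.IsAdditive) :
    (tens (evA g) (evA k)).comp (comulA : Milnor →+* _) = evA (g * k) := by
  refine laurent_ext fun n => ?_
  have h : Param.map (tens (evA g) (evA k))
      (Param.map (inclL _ _) xiParam * Param.map (inclR _ _) xiParam) = g * k := by
    rw [map_mul, Param.map_map, Param.map_map, tens_comp_inclL, tens_comp_inclR, hg.map_evA,
      hk.map_evA]
  rw [evA_gen, ← h, Param.toSeries_map, PowerSeries.coeff_map]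
  refine congrArg (tens (evA g) (evA k)) ?_
  exact laurentLift_gen (fun i => PowerSeries.coeff (2 ^ i) (diagSeries xiSeries))
    (isUnit_coeff_one_diagSeries constantCoeff_xiSeries isUnit_coeff_one_xiSeries) n

theorem algebraMap_comp_counitB :
    (algebraMap (ZMod 2) S).comp (counitB : FaaDiBruno →+* ZMod 2) = evB 1 := by
  refine laurent_ext fun n => ?_
  have : counitB (laurentGen n) = if n = 0 then 1 else 0 := laurentLift_gen _ _ n
  rw [evB_gen, Param.toSeries_one, PowerSeries.coeff_X]
  change algebraMap (ZMod 2) S (counitB (laurentGen n)) = _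
  rw [this]
  rcases n with _ | n <;> simp

theorem algebraMap_comp_counitA :
    (algebraMap (ZMod 2) S).comp (counitA : Milnor →+* ZMod 2) = evA 1 := by
  refine laurent_ext fun n => ?_
  have : counitA (laurentGen n) = if n = 0 then 1 else 0 := laurentLift_gen _ _ n
  rw [evA_gen, Param.toSeries_one, PowerSeries.coeff_X]
  change algebraMap (ZMod 2) S (counitA (laurentGen n)) = _
  rw [this]
  rcases n with _ | n <;> simp

/-- On points, `ε` is the inclusion of the additive changes of parameter into all of them. -/
theorem Param.IsAdditive.evA_comp_epsilon {g : Param S} (hg : g.IsAdditive) :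
    (evA g).comp (epsilon : FaaDiBruno →+* Milnor) = evB g := by
  rw [← evB_map ((evA g).comp _), ← Param.map_map]
  have h : Param.map (epsilon : FaaDiBruno →+* Milnor) hParam = xiParam :=
    Param.ext map_epsilon_hSeries
  rw [h, hg.map_evA]

section Actions

variable {φ : R →ₐ[ZMod 2] FaaDiBruno ⊗[ZMod 2] R} {α : R →ₐ[ZMod 2] Milnor ⊗[ZMod 2] R}

variable (φ) in
/-- The action of changes of parameter on the points of a comodule algebra over `B_*`. -/
def bAct (g : Param S) (f : R →+* S) : R →+* S := act φ (evB g) f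

variable (α) in
/-- The action of additive changes of parameter on the points of a comodule algebra over `A_*`. -/
def aAct (g : Param S) (f : R →+* S) : R →+* S := act α (evA g) f

theorem bAct_mul (h : IsCoaction comulB counitB φ) (g k : Param S) (f : R →+* S) :
    bAct φ (g * k) f = bAct φ g (bAct φ k f) := by
  rw [bAct, bAct, bAct, h.act_act, tens_comp_comulB]

theorem bAct_one (h : IsCoaction comulB counitB φ) (f : R →+* S) : bAct φ 1 f = f := by
  rw [bAct, ← algebraMap_comp_counitB, h.act_counit]

theorem comp_bAct (h : S →+* T) (g : Param S) (f : R →+* S) :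
    h.comp (bAct φ g f) = bAct φ (Param.map h g) (h.comp f) := by
  rw [bAct, bAct, comp_act, comp_evB]

theorem aAct_mul (h : IsCoaction comulA counitA α) {g k : Param S} (hg : g.IsAdditive)
    (hk : k.IsAdditive) (f : R →+* S) : aAct α (g * k) f = aAct α g (aAct α k f) := by
  rw [aAct, aAct, aAct, h.act_act, tens_comp_comulA hg hk]

theorem aAct_one (h : IsCoaction comulA counitA α) (f : R →+* S) : aAct α 1 f = f := by
  rw [aAct, ← algebraMap_comp_counitA, h.act_counit]

theorem comp_aAct (h : S →+* T) (g : Param S) (f : R →+* S) :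
    h.comp (aAct α g f) = aAct α (Param.map h g) (h.comp f) := by
  rw [aAct, aAct, comp_act, comp_evA]

theorem coe_eq_bAct : (φ : R →+* FaaDiBruno ⊗[ZMod 2] R) =
    bAct φ (Param.map (inclL _ _) hParam) (inclR _ _) := by
  rw [bAct, evB_map, act_universal]

theorem coe_eq_aAct : (α : R →+* Milnor ⊗[ZMod 2] R) =
    aAct α (Param.map (inclL _ _) xiParam) (inclR _ _) := by
  rw [aAct, evA_map, act_universal]

end Actions

/-! ### Points of the Lazard ring -/

theorem coeff_genericLaw (i j : ℕ) :
    MvPowerSeries.coeff (Finsupp.single 0 (i + 1) + Finsupp.single 1 (j + 1)) genericLaw =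
      MvPolynomial.X (i, j) := by
  have hX : (MvPowerSeries.X 0 * MvPowerSeries.X 1 * genericTail :
      MvPowerSeries (Fin 2) LazardPoly) =
      MvPowerSeries.monomial (Finsupp.single 0 1 + Finsupp.single 1 1) 1 * genericTail := by
    simp [MvPowerSeries.X, MvPowerSeries.monomial_mul_monomial]
  have hd : Finsupp.single (0 : Fin 2) (i + 1) + Finsupp.single 1 (j + 1) =
      (Finsupp.single 0 1 + Finsupp.single 1 1) + (Finsupp.single 0 i + Finsupp.single 1 j) := by
    ext k
    fin_cases k <;> simp [add_comm]
  have hne (k : Fin 2) : Finsupp.single (0 : Fin 2) (i + 1) + Finsupp.single 1 (j + 1) ≠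
      Finsupp.single k 1 := by
    intro h
    have h0 := DFunLike.congr_fun h 0
    have h1 := DFunLike.congr_fun h 1
    fin_cases k <;> simp at h0 h1
  rw [genericLaw, hX, map_add, map_add, MvPowerSeries.coeff_X, MvPowerSeries.coeff_X,
    if_neg (hne 0), if_neg (hne 1), hd, MvPowerSeries.coeff_add_monomial_mul, one_mul, zero_add,
    zero_add]
  change MvPolynomial.X _ = _
  simp

-- The generators of the Lazard ring are themselves coefficients of the universal law.
omit [Algebra (ZMod 2) S] in
theorem lazard_ext {f g : Lazard →+* S} (h : universalLaw.map f = universalLaw.map g) : f = g := by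
  refine Ideal.Quotient.ringHom_ext (MvPolynomial.ringHom_ext (fun r => ?_) fun p => ?_)
  · exact RingHom.congr_fun (Subsingleton.elim
      ((f.comp (Ideal.Quotient.mk lazardIdeal)).comp MvPolynomial.C)
      ((g.comp (Ideal.Quotient.mk lazardIdeal)).comp MvPolynomial.C)) r
  · have hp := congrArg (fun F => MvPowerSeries.coeff
      (Finsupp.single 0 (p.1 + 1) + Finsupp.single 1 (p.2 + 1)) F.toPowerSeries) h
    simp only [FormalGroup.map_toPowerSeries, MvPowerSeries.coeff_map] at hp
    rw [universalLaw, MvPowerSeries.coeff_map, coeff_genericLaw] at hp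
    exact hp

/-- The point of the Lazard ring given by a formal group law of order two. -/
def lazardHom {F : FormalGroup S} (hF : IsOrderTwo F) : Lazard →+* S := lazardLift F hF

theorem map_lazardHom {F : FormalGroup S} (hF : IsOrderTwo F) :
    universalLaw.map (lazardHom hF) = F :=
  universalLaw_map_lazardLift F hF

theorem tens_comp_lazardCoaction (g : Param S) (n : Lazard →+* S) :
    universalLaw.map ((tens (evB g) n).comp
      lazardCoaction.toRingHom) =
      g • universalLaw.map n := by
  have h : universalLaw.map lazardCoaction.toRingHom =
      Param.map (inclL FaaDiBruno Lazard) hParam • universalLaw.map (inclR FaaDiBruno Lazard) := by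
    exact universalLaw_map_lazardLift _
      (isOrderTwo_conjLaw _ _ _ _ (isOrderTwo_universalLaw.map _))
  rw [← map_map_law, h, Param.map_smul, Param.map_map, tens_comp_inclL, map_evB, map_map_law,
    tens_comp_inclR]

end ParamPoints

/-! ### Total squares and the Nishida relations on points -/

section NishidaPoints

variable {H R S T : Type*} [CommRing H] [CommRing R] [CommRing S] [CommRing T]
  [Algebra (ZMod 2) H] [Algebra (ZMod 2) R] [Algebra (ZMod 2) S] [Algebra (ZMod 2) T]

theorem normParam_congr {F G : FormalGroup S} (hF : IsOrderTwo F) (hG : IsOrderTwo G) (h : F = G)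
    (g : Param S) : normParam hF g = normParam hG g := by
  subst h
  rfl

/-- The composite of a total square with a point. -/
def sqAt (D : R →+* PowerSeries R) (f : R →+* S) : R →+* PowerSeries S := (PowerSeries.map f).comp D

omit [Algebra (ZMod 2) R] [Algebra (ZMod 2) S] in
theorem sqAt_apply (D : R →+* PowerSeries R) (f : R →+* S) (r : R) :
    sqAt D f r = PowerSeries.map f (D r) := rfl

omit [Algebra (ZMod 2) R] [Algebra (ZMod 2) S] [Algebra (ZMod 2) T] in
theorem powerSeries_map_comp (f : R →+* S) (g : S →+* T) :
    (PowerSeries.map g).comp (PowerSeries.map f) = PowerSeries.map (g.comp f) := by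
  ext r n
  simp

omit [Algebra (ZMod 2) R] [Algebra (ZMod 2) S] [Algebra (ZMod 2) T] in
theorem map_comp_sqAt (D : R →+* PowerSeries R) (f : R →+* S) (g : S →+* T) :
    (PowerSeries.map g).comp (sqAt D f) = sqAt D (g.comp f) := by
  rw [sqAt, sqAt, ← RingHom.comp_assoc, powerSeries_map_comp]

omit [Algebra (ZMod 2) R] in
theorem powerSeries_map_id : PowerSeries.map (RingHom.id R) = RingHom.id _ := by
  ext r n
  simp

omit [Algebra (ZMod 2) R] in
theorem sqAt_id (D : R →+* PowerSeries R) : sqAt D (RingHom.id R) = D := by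
  rw [sqAt, powerSeries_map_id, RingHom.id_comp]

omit [Algebra (ZMod 2) R] in
theorem IsTotalSquare.isQuotientLaw {F : FormalGroup R} {D : R →+* PowerSeries R}
    (h : IsTotalSquare F D) : IsQuotientLaw F (F.map D) := by
  have := h.law
  rw [extendSquare_eq] at this
  exact this

omit [Algebra (ZMod 2) R] [Algebra (ZMod 2) S] in
theorem IsQuotientLaw.map (h : R →+* S) {F : FormalGroup R} {G : FormalGroup (PowerSeries R)}
    (hG : IsQuotientLaw F G) : IsQuotientLaw (F.map h) (G.map (PowerSeries.map h)) := by
  have hx (i : Fin 2) :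
      (MvPowerSeries.X (some i) : MvPowerSeries (Option (Fin 2)) R).constantCoeff = 0 := by
    simp
  have ht : (MvPowerSeries.X none : MvPowerSeries (Option (Fin 2)) R).constantCoeff = 0 := by
    simp
  have := congrArg (MvPowerSeries.map h) hG
  rw [map_isogenyEval, map_mul, map_fadd h F (hx 0) (hx 1),
    map_fadd h F (constantCoeff_fadd F (hx 0) (hx 1)) ht, map_fadd h F (hx 0) (hx 1)] at this
  simp only [MvPowerSeries.map_X] at this
  exact this

omit [Algebra (ZMod 2) R] [Algebra (ZMod 2) S] in
theorem IsTotalSquare.isQuotientLaw_map {F : FormalGroup R} {D : R →+* PowerSeries R}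
    (h : IsTotalSquare F D) (f : R →+* S) : IsQuotientLaw (F.map f) (F.map (sqAt D f)) := by
  have := h.isQuotientLaw.map f
  rwa [map_map_law] at this

omit [Algebra (ZMod 2) R] [Algebra (ZMod 2) S] in
theorem extendSquare_map {σ : Type*} [Finite σ] {F : FormalGroup R} {D : R →+* PowerSeries R}
    {E : S →+* PowerSeries S} {m : R →+* S} (h : E.comp m = sqAt D m) (f : MvPowerSeries σ R) :
    extendSquare (F.map m) E (f.map m) = (extendSquare F D f).map m := by
  rw [extendSquare_eq, extendSquare_eq, map_isogenyEval]
  congr 1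
  ext n : 1
  simp only [MvPowerSeries.coeff_map]
  exact RingHom.congr_fun h _

omit [Algebra (ZMod 2) R] in
theorem nishida_rhs (F : FormalGroup R) (u : Param R) :
    u.toSeries.subst (MvPowerSeries.X (some ()) : MvPowerSeries (Option Unit) R) *
      u.toSeries.subst (F.toPowerSeries.subst
        ![(MvPowerSeries.X (some ()) : MvPowerSeries (Option Unit) R), MvPowerSeries.X none]) =
      normProd F u := rfl

/-- Composing `E` with the point `(e, f)` gives a point of `H ⊗ R` over `S[[t]]`. Its component on
`R` is the square of `f`, and uniqueness of the norm identifies the series of its component `e'` on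
`H`. -/
theorem SatisfiesNishida.exists_point {u : Param H} {F : FormalGroup R}
    {D : R →+* PowerSeries R} {φ : R →ₐ[ZMod 2] H ⊗[ZMod 2] R}
    (h : SatisfiesNishida u.toSeries F D φ) (e : H →+* S) (f : R →+* S)
    (hf : IsOrderTwo (F.map f)) :
    ∃ e' : H →+* PowerSeries S, Param.map e' u = normParam hf (Param.map e u) ∧
      (reparam (Param.map e u)).comp (sqAt D (act φ e f)) = act φ e' (sqAt D f) := by
  obtain ⟨E, hE1, hE2, hE3⟩ := h
  have hL : (tens e f).comp (inclL H R) = e := tens_comp_inclL e f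
  have hR : (tens e f).comp (inclR H R) = f := tens_comp_inclR e f
  have hER : ((PowerSeries.map (tens e f)).comp E).comp (inclR H R) = sqAt D f := by
    rw [RingHom.comp_assoc, show E.comp (inclR H R) = sqAt D (inclR H R) from RingHom.ext hE1,
      map_comp_sqAt, hR]
  refine ⟨((PowerSeries.map (tens e f)).comp E).comp (inclL H R), ?_, ?_⟩
  · refine Param.ext (eq_normParam hf ?_)
    have := congrArg (MvPowerSeries.map (tens e f)) hE2
    change _ = MvPowerSeries.map (tens e f)
      (normProd (F.map (inclR H R)) (Param.map (inclL H R) u)) at this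
    rw [map_normProd, extendSquare_eq, map_isogenyEval, map_map_law, hR, Param.map_map, hL] at this
    rw [← this]
    rfl
  · rw [← hER]
    change _ = (tens _ _).comp _
    rw [← eq_tens ((PowerSeries.map (tens e f)).comp E)]
    ext r : 1
    have := congrArg (PowerSeries.map (tens e f)) (hE3 r)
    change PowerSeries.map (tens e f) (PowerSeries.subst (Param.map (inclL H R) u).toSeries _) =
      _ at this
    rw [← reparam_apply, map_reparam, Param.map_map, hL] at this
    exact (congrArg (reparam (Param.map e u)) (RingHom.congr_fun
      (powerSeries_map_comp (φ : R →+* H ⊗[ZMod 2] R) (tens e f)) (D r)).symm).trans this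

/-- It is enough to test the universal point of `H ⊗ R`: the pair of `e'` and the square of the
inclusion of `R` assembles to the required `E`. -/
theorem satisfiesNishida_of_point {u : Param H} {F : FormalGroup R} (hF : IsOrderTwo F)
    {D : R →+* PowerSeries R} {φ : R →ₐ[ZMod 2] H ⊗[ZMod 2] R}
    (e' : H →+* PowerSeries (H ⊗[ZMod 2] R))
    (h1 : Param.map e' u = normParam (hF.map (inclR H R)) (Param.map (inclL H R) u))
    (h2 : (reparam (Param.map (inclL H R) u)).comp (sqAt D (act φ (inclL H R) (inclR H R))) =
      act φ e' (sqAt D (inclR H R))) : SatisfiesNishida u.toSeries F D φ := by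
  refine ⟨tens e' (sqAt D (inclR H R)), fun r => ?_, ?_, fun r => ?_⟩
  · exact RingHom.congr_fun (tens_comp_inclR e' (sqAt D (inclR H R))) r
  · refine Eq.trans ?_ (nishida_rhs (F.map (inclR H R)) (Param.map (inclL H R) u)).symm
    rw [extendSquare_eq, ← isogenyEval_normParam (hF.map (inclR H R)), ← h1]
    congr 1
    have := congrArg (fun e => (Param.map e u).toSeries) (tens_comp_inclL e' (sqAt D (inclR H R)))
    rw [← Param.map_map] at this
    exact this
  · have := RingHom.congr_fun h2 r
    rw [act_universal] at this
    change PowerSeries.subst (Param.map (inclL H R) u).toSeries _ = _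
    rw [← reparam_apply]
    exact this

theorem nishida_bAct {F : FormalGroup R} {D : R →+* PowerSeries R}
    {φ : R →ₐ[ZMod 2] FaaDiBruno ⊗[ZMod 2] R}
    (h : SatisfiesNishida hSeries F D φ) (g : Param S) (f : R →+* S) (hf : IsOrderTwo (F.map f)) :
    (reparam g).comp (sqAt D (bAct φ g f)) = bAct φ (normParam hf g) (sqAt D f) := by
  obtain ⟨e', h1, h2⟩ := SatisfiesNishida.exists_point (u := hParam) h (evB g) f hf
  rw [map_evB] at h1 h2
  rw [bAct, h2, ← h1, bAct, evB_map]

theorem nishida_aAct {F : FormalGroup R} {D : R →+* PowerSeries R}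
    {φ : R →ₐ[ZMod 2] Milnor ⊗[ZMod 2] R}
    (h : SatisfiesNishida xiSeries F D φ) {g : Param S} (hg : g.IsAdditive) (f : R →+* S)
    (hf : IsOrderTwo (F.map f)) :
    (reparam g).comp (sqAt D (aAct φ g f)) = aAct φ (normParam hf g) (sqAt D f) := by
  obtain ⟨e', h1, h2⟩ := SatisfiesNishida.exists_point (u := xiParam) h (evA g) f hf
  rw [hg.map_evA] at h1 h2
  rw [aAct, h2, ← h1, aAct, evA_map]

theorem satisfiesNishida_of_bAct {F : FormalGroup R} (hF : IsOrderTwo F) {D : R →+* PowerSeries R}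
    {φ : R →ₐ[ZMod 2] FaaDiBruno ⊗[ZMod 2] R}
    (h : ∀ g : Param (FaaDiBruno ⊗[ZMod 2] R),
      (reparam g).comp (sqAt D (bAct φ g (inclR _ _))) =
        bAct φ (normParam (hF.map (inclR _ _)) g) (sqAt D (inclR _ _))) :
    SatisfiesNishida hSeries F D φ := by
  refine satisfiesNishida_of_point (u := hParam) hF (evB _) (map_evB _) ?_
  have := h (Param.map (inclL _ _) hParam)
  rwa [bAct, bAct, evB_map] at this

/-- Testing additive `g` suffices because `ξ` is additive; its norm is additive too, hence comes
from a point of `A_*`. -/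
theorem satisfiesNishida_of_aAct {D : R →+* PowerSeries R}
    {φ : R →ₐ[ZMod 2] Milnor ⊗[ZMod 2] R}
    (h : ∀ g : Param (Milnor ⊗[ZMod 2] R), g.IsAdditive →
      (reparam g).comp (sqAt D (aAct φ g (inclR _ _))) =
        aAct φ (normParam (isOrderTwo_additive_of_algebra _) g) (sqAt D (inclR _ _))) :
    SatisfiesNishida xiSeries FormalGroup.𝔾ₐ D φ := by
  have hxi := isAdditive_xiParam.map (inclL Milnor R)
  have hN : (normParam (isOrderTwo_additive_of_algebra _) (Param.map (inclL Milnor R)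
    xiParam)).IsAdditive := normParam_additive hxi (isOrderTwo_additive_of_algebra _)
  refine satisfiesNishida_of_point (u := xiParam) (isOrderTwo_additive_of_algebra _)
    (evA (normParam (isOrderTwo_additive_of_algebra _) (Param.map (inclL Milnor R) xiParam))) ?_ ?_
  · rw [hN.map_evA]
    exact normParam_congr _ _ (map_additive _).symm _
  · have := h _ hxi
    rwa [aAct, aAct, evA_map] at this

end NishidaPoints

/-! ### The structures of the two categories on points -/

namespace DRing

variable (R : DRing.{u}) {S T : Type*} [CommRing S] [CommRing T] [Algebra (ZMod 2) S]
  [Algebra (ZMod 2) T]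

theorem isOrderTwo_lawOf : IsOrderTwo (lawOf R) := isOrderTwo_universalLaw.map _

omit [Algebra (ZMod 2) S] in
theorem map_lawOf (f : R →+* S) :
    (lawOf R).map f = universalLaw.map (f.comp (algebraMap Lazard R)) := map_map_law _ _ _

/-- Linearity of the coaction over `N_*`, applied to the unit of `R`, says that the structure map
`N_* → R` respects the coactions, and on `N_*` the action is transport of laws. -/
theorem lawOf_bAct (g : Param S) (f : R →+* S) :
    (lawOf R).map (bAct R.coaction g f) = g • (lawOf R).map f := by
  have h : (R.coaction : R →+* FaaDiBruno ⊗[ZMod 2] R).comp (algebraMap Lazard R) =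
      (Algebra.TensorProduct.map (AlgHom.id (ZMod 2) FaaDiBruno)
        (IsScalarTower.toAlgHom (ZMod 2) Lazard R)).toRingHom.comp
        lazardCoaction.toRingHom := by
    refine RingHom.ext fun n => ?_
    have := R.coaction_smul n 1
    rw [map_one, mul_one, Algebra.smul_def, mul_one] at this
    exact this
  have h' := tens_comp_map (evB g) f (AlgHom.id (ZMod 2) FaaDiBruno)
    (IsScalarTower.toAlgHom (ZMod 2) Lazard R)
  rw [map_lawOf, bAct, act, RingHom.comp_assoc, h, ← RingHom.comp_assoc]
  refine (congrArg (fun k => universalLaw.map (k.comp lazardCoaction.toRingHom)) h').trans ?_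
  rw [map_lawOf]
  exact tens_comp_lazardCoaction g _

theorem bAct_square (g : Param S) (f : R →+* S) (hf : IsOrderTwo ((lawOf R).map f)) :
    (reparam g).comp (sqAt R.square (bAct R.coaction g f)) =
      bAct R.coaction (normParam hf g) (sqAt R.square f) :=
  nishida_bAct R.nishida g f hf

variable {R} {R' : DRing.{u}}

/-- The underlying ring homomorphism of a morphism. -/
def Hom.toRingHom (m : Hom R R') : R →+* R' := (m.toAlgHom : R →+* R')

theorem Hom.square_comp (m : Hom R R') : R'.square.comp m.toRingHom = sqAt R.square m.toRingHom :=
  RingHom.ext m.square_comm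

omit [Algebra (ZMod 2) S] in
theorem Hom.sqAt_comp (m : Hom R R') (f : R' →+* S) :
    (sqAt R'.square f).comp m.toRingHom = sqAt R.square (f.comp m.toRingHom) := by
  rw [sqAt, RingHom.comp_assoc, m.square_comp, map_comp_sqAt]

theorem Hom.bAct_comp (m : Hom R R') (g : Param S) (f : R' →+* S) :
    (bAct R'.coaction g f).comp m.toRingHom = bAct R.coaction g (f.comp m.toRingHom) := by
  have h : (R'.coaction : R' →+* FaaDiBruno ⊗[ZMod 2] R').comp m.toRingHom =
      (Algebra.TensorProduct.map (AlgHom.id (ZMod 2) FaaDiBruno)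
        (m.toAlgHom.restrictScalars (ZMod 2)) :
          FaaDiBruno ⊗[ZMod 2] R →+* FaaDiBruno ⊗[ZMod 2] R').comp
        (R.coaction : R →+* FaaDiBruno ⊗[ZMod 2] R) := RingHom.ext m.coaction_comm
  rw [bAct, act, RingHom.comp_assoc, h, ← RingHom.comp_assoc, tens_comp_map]
  rfl

theorem Hom.lawOf_map (m : Hom R R') : (lawOf R).map m.toRingHom = lawOf R' := by
  rw [map_lawOf]
  congr 1
  exact m.toAlgHom.comp_algebraMap

end DRing

namespace QRing

variable {P P' : QRing.{u}} {S T : Type*} [CommRing S] [CommRing T] [Algebra (ZMod 2) S]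
  [Algebra (ZMod 2) T]

theorem aAct_square (P : QRing.{u}) {g : Param S} (hg : g.IsAdditive) (f : P →+* S) :
    (reparam g).comp (sqAt P.square (aAct P.coaction g f)) =
      aAct P.coaction (normParam (isOrderTwo_additive_of_algebra S) g) (sqAt P.square f) := by
  have hf : IsOrderTwo ((FormalGroup.𝔾ₐ : FormalGroup P).map f) := by
    rw [map_additive]
    exact isOrderTwo_additive_of_algebra S
  rw [nishida_aAct P.nishida hg f hf, normParam_congr hf _ (map_additive f)]

/-- The underlying ring homomorphism of a morphism. -/
def Hom.toRingHom (m : Hom P P') : P →+* P' := (m.toAlgHom : P →+* P')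

theorem Hom.square_comp (m : Hom P P') : P'.square.comp m.toRingHom = sqAt P.square m.toRingHom :=
  RingHom.ext m.square_comm

omit [Algebra (ZMod 2) S] in
theorem Hom.sqAt_comp (m : Hom P P') (f : P' →+* S) :
    (sqAt P'.square f).comp m.toRingHom = sqAt P.square (f.comp m.toRingHom) := by
  rw [sqAt, RingHom.comp_assoc, m.square_comp, map_comp_sqAt]

theorem Hom.aAct_comp (m : Hom P P') (g : Param S) (f : P' →+* S) :
    (aAct P'.coaction g f).comp m.toRingHom = aAct P.coaction g (f.comp m.toRingHom) := by
  have h : (P'.coaction : P' →+* Milnor ⊗[ZMod 2] P').comp m.toRingHom =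
      (Algebra.TensorProduct.map (AlgHom.id (ZMod 2) Milnor) m.toAlgHom :
          Milnor ⊗[ZMod 2] P →+* Milnor ⊗[ZMod 2] P').comp
        (P.coaction : P →+* Milnor ⊗[ZMod 2] P) := RingHom.ext m.coaction_comm
  rw [aAct, act, RingHom.comp_assoc, h, ← RingHom.comp_assoc, tens_comp_map]
  rfl

end QRing

/-! ### The functor `T` -/

namespace DRing

variable (R : DRing.{u}) {R' R'' : DRing.{u}} {S T : Type*} [CommRing S] [CommRing T]
  [Algebra (ZMod 2) S] [Algebra (ZMod 2) T]

/-- The ring `R ⊗_{N_*} ℤ/2`. -/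
abbrev Reduced : Type u := R ⊗[Lazard] ZMod 2

/-- The projection `R → R ⊗_{N_*} ℤ/2`. -/
def proj : R →+* R.Reduced := Algebra.TensorProduct.includeLeftRingHom

theorem proj_apply (r : R) : R.proj r = r ⊗ₜ[Lazard] 1 := rfl

theorem algebraMap_zmod_eq (a : ZMod 2) : algebraMap Lazard (ZMod 2) (algebraMap (ZMod 2) Lazard a) =
    a :=
  RingHom.congr_fun (Subsingleton.elim
    ((algebraMap Lazard (ZMod 2)).comp (algebraMap (ZMod 2) Lazard)) (RingHom.id _)) a

/-- Scalars in `ℤ/2` lift to `N_*` and can be moved to the left factor. -/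
theorem proj_surjective : Function.Surjective R.proj := by
  intro x
  induction x using TensorProduct.induction_on with
  | zero => exact ⟨0, map_zero _⟩
  | add x y hx hy =>
    obtain ⟨a, rfl⟩ := hx
    obtain ⟨b, rfl⟩ := hy
    exact ⟨a + b, map_add _ _ _⟩
  | tmul r a =>
    refine ⟨algebraMap (ZMod 2) Lazard a • r, ?_⟩
    refine (TensorProduct.smul_tmul (R := Lazard) (algebraMap (ZMod 2) Lazard a) r
      (1 : ZMod 2)).trans ?_
    rw [Algebra.smul_def, mul_one, algebraMap_zmod_eq]

omit [Algebra (ZMod 2) S] in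
theorem comp_proj_injective {f g : R.Reduced →+* S} (h : f.comp R.proj = g.comp R.proj) : f = g :=
  (RingHom.cancel_right R.proj_surjective).1 h

omit [Algebra (ZMod 2) S] in
theorem universalLaw_map_augmentation_comp (h : ZMod 2 →+* S) :
    universalLaw.map (h.comp (algebraMap Lazard (ZMod 2))) = FormalGroup.𝔾ₐ := by
  rw [← map_map_law]
  exact (congrArg (FormalGroup.map · h) universalLaw_map_augmentation).trans (map_additive h)

theorem lawOf_proj : (lawOf R).map R.proj = FormalGroup.𝔾ₐ := by
  rw [map_lawOf, ← universalLaw_map_augmentation_comp (algebraMap (ZMod 2) R.Reduced)]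
  congr 1
  refine RingHom.ext fun n => ?_
  have h1 : R.proj (algebraMap Lazard R n) =
      (1 : R) ⊗ₜ[Lazard] (algebraMap Lazard (ZMod 2) n) := by
    rw [proj_apply, Algebra.algebraMap_eq_smul_one]
    refine (TensorProduct.smul_tmul (R := Lazard) n (1 : R) (1 : ZMod 2)).trans ?_
    rw [Algebra.smul_def, mul_one]
  have h2 := RingHom.congr_fun (Subsingleton.elim
    ((Algebra.TensorProduct.includeRight : ZMod 2 →ₐ[Lazard] R.Reduced) : ZMod 2 →+* R.Reduced)
    (algebraMap (ZMod 2) R.Reduced)) (algebraMap Lazard (ZMod 2) n)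
  exact h1.trans h2

omit [Algebra (ZMod 2) S] in
theorem lawOf_comp_proj (p : R.Reduced →+* S) :
    (lawOf R).map (p.comp R.proj) = FormalGroup.𝔾ₐ := by
  rw [← map_map_law, lawOf_proj, map_additive]

/-- A point of `R` with additive law restricts on `N_*` to a homomorphism through the augmentation,
so it descends to the base change. -/
theorem exists_desc (f : R →+* S) (hf : (lawOf R).map f = FormalGroup.𝔾ₐ) :
    ∃ p : R.Reduced →+* S, p.comp R.proj = f := by
  let _ : Algebra Lazard S := (f.comp (algebraMap Lazard R)).toAlgebra
  let f' : R →ₐ[Lazard] S := { f with commutes' := fun n => rfl }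
  have h : (algebraMap (ZMod 2) S).comp (algebraMap Lazard (ZMod 2)) =
      f.comp (algebraMap Lazard R) := by
    refine lazard_ext ?_
    rw [universalLaw_map_augmentation_comp, ← map_lawOf, hf]
  let a' : ZMod 2 →ₐ[Lazard] S :=
    { algebraMap (ZMod 2) S with commutes' := fun n => RingHom.congr_fun h n }
  refine ⟨(Algebra.TensorProduct.productMap f' a' : R.Reduced →ₐ[Lazard] S), ?_⟩
  ext r
  change Algebra.TensorProduct.productMap f' a' (r ⊗ₜ 1) = _
  rw [Algebra.TensorProduct.productMap_apply_tmul, map_one, mul_one]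
  rfl

/-- The descent of a point of `R` with additive formal group law. -/
def desc (f : R →+* S) (hf : (lawOf R).map f = FormalGroup.𝔾ₐ) : R.Reduced →+* S :=
  (R.exists_desc f hf).choose

theorem desc_comp (f : R →+* S) (hf : (lawOf R).map f = FormalGroup.𝔾ₐ) :
    (R.desc f hf).comp R.proj = f :=
  (R.exists_desc f hf).choose_spec

/-- The law at the squared point is the Lubin quotient of the additive law, which is additive. -/
theorem lawOf_square_of_additive {f : R →+* S} (hf : (lawOf R).map f = FormalGroup.𝔾ₐ) :
    (lawOf R).map (sqAt R.square f) = FormalGroup.𝔾ₐ := by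
  have h := R.isTotalSquare.isQuotientLaw_map f
  rw [hf] at h
  exact h.unique isQuotientLaw_additive

/-- The total square of `R ⊗_{N_*} ℤ/2`. -/
def reducedSquare : R.Reduced →+* PowerSeries R.Reduced :=
  R.desc (sqAt R.square R.proj) (R.lawOf_square_of_additive R.lawOf_proj)

theorem reducedSquare_comp : R.reducedSquare.comp R.proj = sqAt R.square R.proj := R.desc_comp _ _

omit [Algebra (ZMod 2) S] in
theorem sqAt_reducedSquare (p : R.Reduced →+* S) :
    (sqAt R.reducedSquare p).comp R.proj = sqAt R.square (p.comp R.proj) := by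
  rw [sqAt, RingHom.comp_assoc, R.reducedSquare_comp, map_comp_sqAt]

theorem lawOf_xi : (lawOf R).map (bAct R.coaction (Param.map (inclL Milnor R.Reduced) xiParam)
    ((inclR Milnor R.Reduced).comp R.proj)) = FormalGroup.𝔾ₐ := by
  rw [lawOf_bAct, lawOf_comp_proj]
  exact isAdditive_xiParam.map _

/-- The coaction on `R ⊗_{N_*} ℤ/2`. -/
def reducedCoaction : R.Reduced →ₐ[ZMod 2] Milnor ⊗[ZMod 2] R.Reduced :=
  toAlg (R.desc _ R.lawOf_xi)

/-- The points of `T(R)` are those of `R` with additive law, and there `A_*` acts by restriction of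
the action of `B_*`. The axioms for `T(R)` are deduced from those for `R` through this formula. -/
theorem aAct_reducedCoaction {a : Param S} (ha : a.IsAdditive) (p : R.Reduced →+* S) :
    (aAct R.reducedCoaction a p).comp R.proj = bAct R.coaction a (p.comp R.proj) := by
  rw [aAct, act, RingHom.comp_assoc]
  refine (congrArg ((tens (evA a) p).comp) (R.desc_comp _ R.lawOf_xi)).trans ?_
  rw [comp_bAct, Param.map_map, tens_comp_inclL, ha.map_evA, ← RingHom.comp_assoc, tens_comp_inclR]

theorem isCoaction_reducedCoaction : IsCoaction comulA counitA R.reducedCoaction := by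
  refine isCoaction_of_act (R.comp_proj_injective ?_) fun e₁ e₂ f => R.comp_proj_injective ?_
  · rw [algebraMap_comp_counitA]
    refine (R.aAct_reducedCoaction Param.isAdditive_one _).trans ?_
    rw [bAct_one R.isCoaction]
  · have h1 := isAdditive_xiParam.map e₁
    have h2 := isAdditive_xiParam.map e₂
    rw [← evA_map e₁, ← evA_map e₂, tens_comp_comulA h1 h2]
    refine (R.aAct_reducedCoaction h1 _).trans ?_
    refine Eq.trans ?_ (R.aAct_reducedCoaction (h1.mul h2) f).symm
    rw [bAct_mul R.isCoaction, ← R.aAct_reducedCoaction h2]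
    rfl

theorem isTotalSquare_reducedSquare : IsTotalSquare FormalGroup.𝔾ₐ R.reducedSquare where
  sq a := by
    obtain ⟨r, rfl⟩ := R.proj_surjective a
    have := RingHom.congr_fun R.reducedSquare_comp r
    rw [RingHom.comp_apply] at this
    rw [this, sqAt_apply, ← PowerSeries.coeff_zero_eq_constantCoeff_apply, PowerSeries.coeff_map,
      PowerSeries.coeff_zero_eq_constantCoeff_apply, R.isTotalSquare.sq, map_pow]
  law := by
    rw [extendSquare_eq, ← FormalGroup.map_toPowerSeries, map_additive]
    exact isQuotientLaw_additive
  symm a := by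
    obtain ⟨r, rfl⟩ := R.proj_surjective a
    have h1 : R.reducedSquare (R.proj r) = (R.square r).map R.proj :=
      RingHom.congr_fun R.reducedSquare_comp r
    have h2 := extendSquare_map (σ := Unit) (F := lawOf R) R.reducedSquare_comp (R.square r)
    rw [lawOf_proj] at h2
    have h3 : extendSquare (σ := Unit) FormalGroup.𝔾ₐ R.reducedSquare (R.reducedSquare (R.proj r)) =
      (extendSquare (lawOf R) R.square (R.square r)).map R.proj := by
      rw [h1]; exact h2
    rw [h3]
    -- The iterated square of the image of `r` is the image of the iterated square of `r`, and the
    -- exchange of variables commutes with base change.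
    have hs := R.isTotalSquare.symm r
    have hsw : ∀ i, (MvPowerSeries.X (Equiv.swap none (some ()) i) :
      MvPowerSeries (Option Unit) R).constantCoeff = 0 := by simp
    conv_rhs => rw [← hs]
    rw [MvPowerSeries.map_subst (MvPowerSeries.hasSubst_of_constantCoeff_zero hsw)]
    congr 1
    funext i
    simp

theorem nishida_reduced :
    SatisfiesNishida xiSeries FormalGroup.𝔾ₐ R.reducedSquare R.reducedCoaction := by
  refine satisfiesNishida_of_aAct fun g hg => R.comp_proj_injective ?_
  have hN : (normParam (isOrderTwo_additive_of_algebra _) g).IsAdditive :=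
    normParam_additive hg (isOrderTwo_additive_of_algebra _)
  have h0 := R.lawOf_comp_proj (inclR Milnor R.Reduced)
  rw [RingHom.comp_assoc, sqAt_reducedSquare, aAct_reducedCoaction R hg,
    aAct_reducedCoaction R hN, sqAt_reducedSquare, R.bAct_square g _ (by
      rw [h0]; exact isOrderTwo_additive_of_algebra _), normParam_congr _ _ h0]

/-- The object `T(R)`. -/
def reduce : QRing.{u} where
  carrier := R.Reduced
  square := R.reducedSquare
  isTotalSquare := R.isTotalSquare_reducedSquare
  coaction := R.reducedCoaction
  isCoaction := R.isCoaction_reducedCoaction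
  nishida := R.nishida_reduced

end DRing

/-- The homomorphism `π : R → P` makes `P` into the object `T(R)`. -/
structure IsReduction (R : DRing.{u}) (P : QRing.{u}) (π : R →+* P) : Prop where
  surjective : Function.Surjective π
  law : (lawOf R).map π = FormalGroup.𝔾ₐ
  exists_desc : ∀ {S : Type u} [CommRing S] [Algebra (ZMod 2) S] (f : R →+* S),
    (lawOf R).map f = FormalGroup.𝔾ₐ → ∃ p : P →+* S, p.comp π = f
  square : P.square.comp π = sqAt R.square π
  act_comp : ∀ {S : Type u} [CommRing S] [Algebra (ZMod 2) S] {a : Param S}, a.IsAdditive →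
    ∀ p : P →+* S, (aAct P.coaction a p).comp π = bAct R.coaction a (p.comp π)

/-- The projection from `R` to the object `T(R)`. -/
def DRing.projReduce (R : DRing.{u}) : R →+* R.reduce := R.proj

theorem DRing.isReduction (R : DRing.{u}) : IsReduction R R.reduce R.projReduce where
  surjective := R.proj_surjective
  law := R.lawOf_proj
  exists_desc f hf := R.exists_desc f hf
  square := R.reducedSquare_comp
  act_comp ha p := R.aAct_reducedCoaction ha p

namespace IsReduction

variable {R R' : DRing.{u}} {P P' : QRing.{u}} {π : R →+* P} {π' : R' →+* P'}
  {S : Type u} [CommRing S] [Algebra (ZMod 2) S]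

omit [Algebra (ZMod 2) S] in
theorem comp_injective (h : IsReduction R P π) {f g : P →+* S} (hfg : f.comp π = g.comp π) :
    f = g :=
  (RingHom.cancel_right h.surjective).1 hfg

omit [Algebra (ZMod 2) S] in
theorem law_comp (h : IsReduction R P π) (p : P →+* S) :
    (lawOf R).map (p.comp π) = FormalGroup.𝔾ₐ := by
  rw [← map_map_law, h.law, map_additive]

omit [Algebra (ZMod 2) S] in
theorem sqAt_comp (h : IsReduction R P π) (p : P →+* S) :
    (sqAt P.square p).comp π = sqAt R.square (p.comp π) := by
  rw [sqAt, RingHom.comp_assoc, h.square, map_comp_sqAt]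

/-- A ring homomorphism out of `T(R)` is a morphism if it is compatible with the total squares and
the actions after composition with the projection. -/
def homOfComp (h : IsReduction R P π) {k : P →+* P'}
    (h1 : P'.square.comp (k.comp π) = sqAt R.square (k.comp π))
    (h2 : ∀ a : Param (Milnor ⊗[ZMod 2] P'), a.IsAdditive →
      (aAct P'.coaction a (inclR Milnor P')).comp (k.comp π) =
        bAct R.coaction a ((inclR Milnor P').comp (k.comp π))) : P ⟶ P' where
  toAlgHom := toAlg k
  square_comm r := by
    refine RingHom.congr_fun (h.comp_injective (f := P'.square.comp k)
      (g := sqAt P.square k) ?_) r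
    rw [h.sqAt_comp, ← h1]
    rfl
  coaction_comm r := by
    refine (RingHom.congr_fun (h.comp_injective
      (f := (P'.coaction : P' →+* Milnor ⊗[ZMod 2] P').comp k)
      (g := aAct P.coaction (Param.map (inclL Milnor P') xiParam)
        ((inclR Milnor P').comp k)) ?_) r).trans ?_
    · have hxi := isAdditive_xiParam.map (inclL Milnor P')
      rw [h.act_comp hxi, RingHom.comp_assoc, RingHom.comp_assoc, coe_eq_aAct, h2 _ hxi]
    · rw [aAct, evA_map, act]
      exact (RingHom.congr_fun (map_eq_tens (AlgHom.id (ZMod 2) Milnor) (toAlg k))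
        (P.coaction r)).symm

theorem exists_map (h : IsReduction R P π) (h' : IsReduction R' P' π') (m : R ⟶ R') :
    ∃ k : P ⟶ P', (QRing.Hom.toRingHom k).comp π = π'.comp (DRing.Hom.toRingHom m) := by
  obtain ⟨k, hk⟩ := h.exists_desc (π'.comp (DRing.Hom.toRingHom m)) (by
    rw [← map_map_law, DRing.Hom.lawOf_map, h'.law])
  refine ⟨h.homOfComp (k := k) ?_ fun a ha => ?_, hk⟩
  · rw [hk, ← RingHom.comp_assoc, h'.square, DRing.Hom.sqAt_comp]
  · rw [hk, ← RingHom.comp_assoc, h'.act_comp ha, DRing.Hom.bAct_comp, RingHom.comp_assoc]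

end IsReduction

theorem QRing.hom_ext {P P' : QRing.{u}} {k l : P ⟶ P'}
    (h : QRing.Hom.toRingHom k = QRing.Hom.toRingHom l) : k = l :=
  QRing.Hom.ext (AlgHom.ext fun r => RingHom.congr_fun h r)

theorem DRing.hom_ext {R R' : DRing.{u}} {k l : R ⟶ R'}
    (h : DRing.Hom.toRingHom k = DRing.Hom.toRingHom l) : k = l :=
  DRing.Hom.ext (AlgHom.ext fun r => RingHom.congr_fun h r)

theorem QRing.toRingHom_comp {P P' P'' : QRing.{u}} (k : P ⟶ P') (l : P' ⟶ P'') :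
    QRing.Hom.toRingHom (k ≫ l) = (QRing.Hom.toRingHom l).comp (QRing.Hom.toRingHom k) := rfl

theorem DRing.toRingHom_comp {R R' R'' : DRing.{u}} (k : R ⟶ R') (l : R' ⟶ R'') :
    DRing.Hom.toRingHom (k ≫ l) = (DRing.Hom.toRingHom l).comp (DRing.Hom.toRingHom k) := rfl

theorem QRing.toRingHom_id (P : QRing.{u}) : QRing.Hom.toRingHom (𝟙 P) = RingHom.id P := rfl

theorem DRing.toRingHom_id (R : DRing.{u}) : DRing.Hom.toRingHom (𝟙 R) = RingHom.id R := rfl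

/-- The morphism `T(m)`. -/
def reduceMap {R R' : DRing.{u}} (m : R ⟶ R') : R.reduce ⟶ R'.reduce :=
  (R.isReduction.exists_map R'.isReduction m).choose

theorem reduceMap_comp {R R' : DRing.{u}} (m : R ⟶ R') :
    (QRing.Hom.toRingHom (reduceMap m)).comp R.projReduce =
      R'.projReduce.comp (DRing.Hom.toRingHom m) :=
  (R.isReduction.exists_map R'.isReduction m).choose_spec

/-- The functor `T`. -/
def reduceFunctor : DRing.{u} ⥤ QRing.{u} where
  obj R := R.reduce
  map m := reduceMap m
  map_id R := QRing.hom_ext <| R.isReduction.comp_injective <| by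
    rw [reduceMap_comp]
    rfl
  map_comp {R R' R''} k l := QRing.hom_ext <| R.isReduction.comp_injective <| by
    rw [reduceMap_comp, DRing.toRingHom_comp, ← RingHom.comp_assoc, ← reduceMap_comp,
      RingHom.comp_assoc, ← reduceMap_comp, QRing.toRingHom_comp, RingHom.comp_assoc]

theorem isThomReduction_reduce (R : DRing.{u}) :
    IsThomReduction R R.reduce (AlgEquiv.refl : (R ⊗[Lazard] ZMod 2) ≃ₐ[ZMod 2] R.Reduced) where
  coaction_comm r := by
    have h0 : bAct R.coaction (Param.map (inclL Milnor R.Reduced) xiParam)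
        ((inclR Milnor R.Reduced).comp R.proj) =
        act R.coaction ((inclL Milnor R.Reduced).comp (epsilon : FaaDiBruno →+* Milnor))
          ((inclR Milnor R.Reduced).comp R.proj) := by
      rw [bAct, ← (isAdditive_xiParam.map (inclL Milnor R.Reduced)).evA_comp_epsilon, evA_map]
    have h1 := (R.desc_comp _ R.lawOf_xi).trans h0
    have h2 := map_eq_tens epsilon
      (reduction (S := R.reduce) (AlgEquiv.refl : (R ⊗[Lazard] ZMod 2) ≃ₐ[ZMod 2] R.Reduced))
    exact (RingHom.congr_fun h1 r).trans (RingHom.congr_fun h2 (R.coaction r)).symm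
  square_comm r := RingHom.congr_fun R.reducedSquare_comp r

/-! ### The functor `T` is fully faithful -/

namespace DRing

variable (R : DRing.{u})

/-- The logarithm of the formal group law of `R`. -/
def log : Param R := Param.map (algebraMap Lazard R) universalLog

theorem log_smul : R.log • lawOf R = FormalGroup.𝔾ₐ := by
  have := congrArg (FormalGroup.map · (algebraMap Lazard R)) universalLog_smul
  simpa only [Param.map_smul, map_additive] using! this

theorem log_inv_smul : R.log⁻¹ • (FormalGroup.𝔾ₐ : FormalGroup R) = lawOf R := by
  rw [inv_smul_eq_iff, log_smul]

end DRing

namespace IsReduction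

variable {R R' : DRing.{u}} {P P' : QRing.{u}} {π : R →+* P} {π' : R' →+* P'}
  {S : Type u} [CommRing S] [Algebra (ZMod 2) S]

/-- The logarithm moves the identity point of `R` to one with additive law, which descends to `P`;
the inverse logarithm moves it back. -/
theorem exists_section (h : IsReduction R P π) :
    ∃ s : P →+* R, bAct R.coaction R.log⁻¹ (s.comp π) = RingHom.id R := by
  obtain ⟨s, hs⟩ := h.exists_desc (bAct R.coaction R.log (RingHom.id R)) (by
    rw [DRing.lawOf_bAct, map_id_law, DRing.log_smul])
  exact ⟨s, by rw [hs, ← bAct_mul R.isCoaction, inv_mul_cancel, bAct_one R.isCoaction]⟩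

/-- Morphisms commute with the action, so `m` is recovered from its reduction by applying the
section and then acting with the inverse logarithm. -/
theorem hom_ext (h' : IsReduction R' P' π') {m n : R ⟶ R'}
    (hmn : π'.comp (DRing.Hom.toRingHom m) = π'.comp (DRing.Hom.toRingHom n)) : m = n := by
  obtain ⟨s, hs⟩ := h'.exists_section
  have key (m : R ⟶ R') : DRing.Hom.toRingHom m =
      bAct R.coaction R'.log⁻¹ (s.comp (π'.comp (DRing.Hom.toRingHom m))) := by
    rw [← RingHom.comp_assoc, ← DRing.Hom.bAct_comp, hs, RingHom.id_comp]
  refine DRing.hom_ext ?_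
  rw [key m, key n, hmn]

/-- The candidate for the lift of `k` carries the point `κ · (q π')` of `R'` to `κ · (q k π)`, as a
morphism over `k` must. In the computation `y s` differs from `q` by the change of parameter `a =
y(log) κ`. This `a` is additive, so its action passes through `k`; then `y(log)⁻¹ a = κ`. -/
theorem comp_lift (h : IsReduction R P π) (h' : IsReduction R' P' π') (k : P ⟶ P')
    {s : P' →+* R'} (hs : bAct R'.coaction R'.log⁻¹ (s.comp π') = RingHom.id R')
    (κ : Param S) (q : P' →+* S) :
    (bAct R'.coaction κ (q.comp π')).comp
        (bAct R.coaction R'.log⁻¹ ((s.comp (QRing.Hom.toRingHom k)).comp π)) =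
      bAct R.coaction κ ((q.comp (QRing.Hom.toRingHom k)).comp π) := by
  set y := bAct R'.coaction κ (q.comp π') with hy
  set a : Param S := Param.map y R'.log * κ with ha
  have hs' : s.comp π' = bAct R'.coaction R'.log (RingHom.id R') := by
    rw [← hs, ← bAct_mul R'.isCoaction, mul_inv_cancel, bAct_one R'.isCoaction]
  have hys : (y.comp s).comp π' = bAct R'.coaction a (q.comp π') := by
    rw [RingHom.comp_assoc, hs', comp_bAct, RingHom.comp_id, hy, ← hy, ha,
      bAct_mul R'.isCoaction]
  -- `a` carries a point with additive law to another one.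
  have haa : a.IsAdditive := by
    have := R'.lawOf_bAct a (q.comp π')
    rw [← hys, h'.law_comp, h'.law_comp] at this
    exact this.symm
  have hya : y.comp s = aAct P'.coaction a q :=
    h'.comp_injective (by rw [hys, h'.act_comp haa])
  rw [comp_bAct, ← RingHom.comp_assoc, ← RingHom.comp_assoc, hya, QRing.Hom.aAct_comp,
    h.act_comp haa, ← bAct_mul R.isCoaction, ha, map_inv, inv_mul_cancel_left]

/-- The lift is forced by the formula in `hom_ext`. Compatibility with the coactions and with the
squares follows from `comp_lift` at suitable points of `R'`. -/
theorem exists_lift (h : IsReduction R P π) (h' : IsReduction R' P' π') (k : P ⟶ P') :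
    ∃ m : R ⟶ R', π'.comp (DRing.Hom.toRingHom m) = (QRing.Hom.toRingHom k).comp π := by
  obtain ⟨s, hs⟩ := h'.exists_section
  set k' := QRing.Hom.toRingHom k with hk'
  set m : R →+* R' := bAct R.coaction R'.log⁻¹ ((s.comp k').comp π) with hm
  have hlaw : m.comp (algebraMap Lazard R) = algebraMap Lazard R' := by
    refine lazard_ext ?_
    rw [← DRing.map_lawOf, hm, DRing.lawOf_bAct, h.law_comp, DRing.log_inv_smul]
    rfl
  have hcoaction : (R'.coaction : R' →+* FaaDiBruno ⊗[ZMod 2] R').comp m =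
      bAct R.coaction (Param.map (inclL _ _) hParam) ((inclR _ _).comp m) := by
    set y := inclR FaaDiBruno R' with hy
    -- This writes the universal point `y` as an action on a point that factors through `π'`, the
    -- form required by `comp_lift`.
    have e : bAct R'.coaction (Param.map y R'.log⁻¹) ((y.comp s).comp π') = y := by
      rw [RingHom.comp_assoc, ← comp_bAct, hs, RingHom.comp_id]
    have e' : y.comp m = bAct R.coaction (Param.map y R'.log⁻¹) (((y.comp s).comp k').comp π) := by
      rw [← comp_lift h h' k hs, e]
    rw [coe_eq_bAct, ← hy, ← e, ← bAct_mul R'.isCoaction, comp_lift h h' k hs, e, e',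
      bAct_mul R.isCoaction]
  have hsquare : R'.square.comp m = sqAt R.square m := by
    have hF' : IsOrderTwo ((lawOf R').map (s.comp π')) := R'.isOrderTwo_lawOf.map _
    have hF : IsOrderTwo ((lawOf R).map ((s.comp k').comp π)) := R.isOrderTwo_lawOf.map _
    -- The Nishida relations for the inverse logarithm express both squares, after the same
    -- reparametrisation, as actions of the same norm on corresponding points.
    have e := R'.bAct_square R'.log⁻¹ (s.comp π') hF'
    rw [hs, sqAt_id, ← h'.sqAt_comp] at e
    have e' := R.bAct_square R'.log⁻¹ ((s.comp k').comp π) hF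
    rw [← hm, ← h.sqAt_comp, ← QRing.Hom.sqAt_comp] at e'
    have e2 : ((reparam R'.log⁻¹).comp R'.square).comp m =
        (reparam R'.log⁻¹).comp (sqAt R.square m) := by
      rw [e, e', comp_lift h h' k hs,
        normParam_congr hF' hF ((h'.law_comp s).trans (h.law_comp (s.comp k')).symm)]
    have hinv := reparam_comp_inv R'.log
    have e3 := congrArg ((reparam R'.log).comp ·) e2
    simp only [RingHom.comp_assoc] at e3
    rwa [← RingHom.comp_assoc, ← RingHom.comp_assoc, hinv, RingHom.id_comp, ← RingHom.comp_assoc,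
      hinv, RingHom.id_comp] at e3
  refine ⟨{ toAlgHom := { m with commutes' := RingHom.congr_fun hlaw }
            square_comm := RingHom.congr_fun hsquare
            coaction_comm := fun r => (RingHom.congr_fun hcoaction r).trans ?_ }, ?_⟩
  · rw [bAct, evB_map]
    exact (RingHom.congr_fun (map_eq_tens (AlgHom.id (ZMod 2) FaaDiBruno) (toAlg m))
        (R.coaction r)).symm
  · change π'.comp m = _
    have := comp_lift h h' k hs (S := P') 1 (RingHom.id _)
    rwa [bAct_one R'.isCoaction, bAct_one R.isCoaction, RingHom.id_comp, RingHom.id_comp] at this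

/-- Both objects have the same universal property; lifting the identity of `R` in either direction
gives mutually inverse maps. -/
theorem nonempty_iso {P' : QRing.{u}} {π' : R →+* P'} (h : IsReduction R P π)
    (h' : IsReduction R P' π') : Nonempty (P ≅ P') := by
  obtain ⟨k, hk⟩ := h.exists_map h' (𝟙 R)
  obtain ⟨l, hl⟩ := h'.exists_map h (𝟙 R)
  rw [DRing.toRingHom_id, RingHom.comp_id] at hk hl
  refine ⟨⟨k, l, QRing.hom_ext (h.comp_injective ?_), QRing.hom_ext (h'.comp_injective ?_)⟩⟩
  · rw [QRing.toRingHom_comp, RingHom.comp_assoc, hk, hl, QRing.toRingHom_id, RingHom.id_comp]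
  · rw [QRing.toRingHom_comp, RingHom.comp_assoc, hl, hk, QRing.toRingHom_id, RingHom.id_comp]

end IsReduction

instance : reduceFunctor.{u}.Faithful where
  map_injective {R R' m n} hmn := R'.isReduction.hom_ext <| by
    rw [← reduceMap_comp, ← reduceMap_comp]
    exact congrArg (fun k => (QRing.Hom.toRingHom k).comp R.projReduce) hmn

instance : reduceFunctor.{u}.Full where
  map_surjective {R R'} k := by
    obtain ⟨m, hm⟩ := R.isReduction.exists_lift R'.isReduction k
    refine ⟨m, QRing.hom_ext (R.isReduction.comp_injective ?_)⟩
    exact (reduceMap_comp m).trans hm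

/-! ### The functor `T` is essentially surjective -/

section ScalarExtension

variable (H R : Type*) [CommRing H] [CommRing R] [Algebra (ZMod 2) H] [Algebra (ZMod 2) R]
  {S T : Type*} [CommRing S] [CommRing T] [Algebra (ZMod 2) S] [Algebra (ZMod 2) T]

/-- The tensor product `H ⊗ R`, as an algebra over `H`. -/
def ScalarExtension : Type _ := H ⊗[ZMod 2] R

instance : CommRing (ScalarExtension H R) := inferInstanceAs (CommRing (H ⊗[ZMod 2] R))

instance : Algebra (ZMod 2) (ScalarExtension H R) :=
  inferInstanceAs (Algebra (ZMod 2) (H ⊗[ZMod 2] R))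

instance : Algebra H (ScalarExtension H R) := inferInstanceAs (Algebra H (H ⊗[ZMod 2] R))

instance : IsScalarTower (ZMod 2) H (ScalarExtension H R) :=
  inferInstanceAs (IsScalarTower (ZMod 2) H (H ⊗[ZMod 2] R))

namespace ScalarExtension

/-- The inclusion of `R`. -/
def incl : R →+* ScalarExtension H R := inclR H R

variable {H R}

/-- The homomorphism out of `H ⊗ R` given by two homomorphisms. -/
def lift (f : H →+* S) (g : R →+* S) : ScalarExtension H R →+* S := tens f g

theorem lift_comp_algebraMap (f : H →+* S) (g : R →+* S) :
    (lift f g).comp (algebraMap H (ScalarExtension H R)) = f := tens_comp_inclL f g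

theorem lift_comp_incl (f : H →+* S) (g : R →+* S) : (lift f g).comp (incl H R) = g :=
  tens_comp_inclR f g

theorem comp_lift (h : S →+* T) (f : H →+* S) (g : R →+* S) :
    h.comp (lift f g) = lift (h.comp f) (h.comp g) := comp_tens h f g

theorem eq_lift (h : ScalarExtension H R →+* S) :
    h = lift (h.comp (algebraMap H (ScalarExtension H R))) (h.comp (incl H R)) := eq_tens h

end ScalarExtension

end ScalarExtension

namespace QRing

variable (P : QRing.{u}) {S T : Type*} [CommRing S] [CommRing T] [Algebra (ZMod 2) S]
  [Algebra (ZMod 2) T]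

/-- The ring `N_* ⊗ P`. -/
abbrev Induced : Type u := ScalarExtension Lazard P

/-- The point of `N_*` given by the law `g • (x + y)`. -/
def cls (g : Param S) : Lazard →+* S :=
  lazardHom (Param.isOrderTwo_smul g (isOrderTwo_additive_of_algebra S))

theorem map_cls (g : Param S) : universalLaw.map (cls g) = g • FormalGroup.𝔾ₐ := map_lazardHom _

theorem cls_congr {g k : Param S}
    (h : g • (FormalGroup.𝔾ₐ : FormalGroup S) = k • FormalGroup.𝔾ₐ) : cls g = cls k :=
  lazard_ext (by rw [map_cls, map_cls, h])

theorem comp_cls (h : S →+* T) (g : Param S) : h.comp (cls g) = cls (Param.map h g) :=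
  lazard_ext (by rw [← map_map_law, map_cls, map_cls, Param.map_smul, map_additive])

omit [Algebra (ZMod 2) S] in
theorem log_smul_law (n : Lazard →+* S) :
    Param.map n universalLog • universalLaw.map n = FormalGroup.𝔾ₐ := by
  rw [← Param.map_smul, universalLog_smul, map_additive]

/-- `g` leads from the additive law to the law it defines, and the logarithm leads back. -/
theorem isAdditive_log_mul (g : Param S) :
    (Param.map (cls g) universalLog * g).IsAdditive := by
  rw [Param.IsAdditive, mul_smul, ← map_cls, log_smul_law]

variable {P}

/-- The point of `N_* ⊗ P` obtained by transport of the point `p` of `P` along `g`. -/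
def pt (g : Param S) (p : P →+* S) : P.Induced →+* S :=
  -- The pair `(g, p)` is normalised: `g` becomes the inverse logarithm of its law, and the additive
  -- discrepancy `log · g` acts on `p`.
  ScalarExtension.lift (cls g) (aAct P.coaction (Param.map (cls g) universalLog * g) p)

theorem pt_comp_algebraMap (g : Param S) (p : P →+* S) : (pt g p).comp (algebraMap Lazard P.Induced) = cls g :=
  ScalarExtension.lift_comp_algebraMap _ _

theorem pt_comp_incl (g : Param S) (p : P →+* S) : (pt g p).comp (ScalarExtension.incl Lazard P) =
    aAct P.coaction (Param.map (cls g) universalLog * g) p :=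
  ScalarExtension.lift_comp_incl _ _

/-- Only the class of `(g, p)` matters, with additive changes of parameter moved across: multiplying
`g` by `a` leaves its law unchanged. -/
theorem pt_mul (g : Param S) {a : Param S} (ha : a.IsAdditive) (p : P →+* S) :
    pt (g * a) p = pt g (aAct P.coaction a p) := by
  have h : cls (g * a) = cls g := cls_congr (by
    rw [mul_smul, show a • FormalGroup.𝔾ₐ = FormalGroup.𝔾ₐ from ha])
  rw [pt, pt, h, ← aAct_mul P.isCoaction (isAdditive_log_mul g) ha, mul_assoc]

theorem comp_pt (h : S →+* T) (g : Param S) (p : P →+* S) :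
    h.comp (pt g p) = pt (Param.map h g) (h.comp p) := by
  rw [pt, pt, ScalarExtension.comp_lift, comp_cls, comp_aAct, map_mul, Param.map_map, comp_cls]

variable (P) in
/-- The exponential series over `N_* ⊗ P`. -/
def exp : Param P.Induced := Param.map (algebraMap Lazard P.Induced) universalLog⁻¹

omit [Algebra (ZMod 2) S] in
theorem map_exp (x : P.Induced →+* S) :
    Param.map x P.exp = (Param.map (x.comp (algebraMap Lazard P.Induced)) universalLog)⁻¹ := by
  rw [exp, Param.map_map, map_inv]

/-- When `g` is the inverse logarithm, the additive discrepancy is trivial. Hence every point is in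
the image of `pt`, and identities on `N_* ⊗ P` may be tested there. -/
theorem eq_pt (x : P.Induced →+* S) : x = pt (Param.map x P.exp) (x.comp (ScalarExtension.incl Lazard P)) := by
  have h : cls (Param.map x P.exp) = x.comp (algebraMap Lazard P.Induced) := by
    refine lazard_ext ?_
    rw [map_cls, map_exp, inv_smul_eq_iff, log_smul_law]
  rw [pt, h, map_exp, mul_inv_cancel, aAct_one P.isCoaction, ← ScalarExtension.eq_lift]

theorem id_eq_pt : RingHom.id P.Induced = pt P.exp (ScalarExtension.incl Lazard P) := by
  refine (eq_pt (RingHom.id P.Induced)).trans ?_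
  rw [Param.map_id, RingHom.id_comp]

theorem map_pt_exp_mul (g : Param S) (p : P →+* S) :
    Param.map (pt g p) P.exp * (Param.map (cls g) universalLog * g) = g := by
  rw [map_exp, pt_comp_algebraMap, inv_mul_cancel_left]

theorem lawOf_induced : lawOf P.Induced = P.exp • FormalGroup.𝔾ₐ := by
  have h := log_smul_law (algebraMap Lazard P.Induced)
  rw [exp, map_inv, eq_inv_smul_iff]
  exact h

theorem lawOf_map_pt (g : Param S) (p : P →+* S) :
    (lawOf P.Induced).map (pt g p) = g • FormalGroup.𝔾ₐ := by
  rw [← map_cls, ← pt_comp_algebraMap g p]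
  exact map_map_law _ _ _

/-! #### The coaction on `N_* ⊗ P` -/

variable (P) in
/-- The coaction of `B_*` on `N_* ⊗ P`. -/
def inducedCoaction : P.Induced →ₐ[ZMod 2] FaaDiBruno ⊗[ZMod 2] P.Induced :=
  -- The universal point corresponds to the pair of `exp` and the inclusion of `P`; the coaction
  -- multiplies its change of parameter by `h`.
  toAlg (pt (Param.map (inclL FaaDiBruno P.Induced) hParam *
    Param.map (inclR FaaDiBruno P.Induced) P.exp)
      ((inclR FaaDiBruno P.Induced).comp (ScalarExtension.incl Lazard P)))

/-- `pt g p` has normalised pair `(g', a · p)` with `g' a = g` and `a` additive, so moving `a` back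
across turns `(k g', a · p)` into `(k g, p)`. -/
theorem bAct_pt (k g : Param S) (p : P →+* S) :
    bAct P.inducedCoaction k (pt g p) = pt (k * g) p := by
  rw [bAct, act]
  refine (comp_pt (tens (evB k) (pt g p)) _ _).trans ?_
  rw [map_mul, Param.map_map, Param.map_map, tens_comp_inclL, tens_comp_inclR, map_evB,
    ← RingHom.comp_assoc, tens_comp_inclR, pt_comp_incl, ← pt_mul _ (isAdditive_log_mul g),
    mul_assoc, map_pt_exp_mul]

theorem isCoaction_induced : IsCoaction comulB counitB P.inducedCoaction := by
  refine isCoaction_of_act ?_ fun e₁ e₂ f => ?_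
  · rw [algebraMap_comp_counitB, id_eq_pt]
    refine (bAct_pt 1 _ _).trans ?_
    rw [one_mul]
  · rw [eq_pt f, ← evB_map e₁, ← evB_map e₂, tens_comp_comulB]
    have h (k g : Param (FaaDiBruno ⊗[ZMod 2] (FaaDiBruno ⊗[ZMod 2] P.Induced))) (p : P →+* _) :=
      bAct_pt k g p
    simp only [bAct] at h
    rw [h, h, h, mul_assoc]

theorem inducedCoaction_smul (n : Lazard) (r : P.Induced) : P.inducedCoaction (n • r) =
    Algebra.TensorProduct.map (AlgHom.id (ZMod 2) FaaDiBruno)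
      (IsScalarTower.toAlgHom (ZMod 2) Lazard P.Induced) (lazardCoaction n) *
        P.inducedCoaction r := by
  rw [Algebra.smul_def, map_mul]
  congr 1
  have h1 : P.inducedCoaction.toRingHom.comp (algebraMap Lazard P.Induced) =
      cls (Param.map (inclL FaaDiBruno P.Induced) hParam *
        Param.map (inclR FaaDiBruno P.Induced) P.exp) := pt_comp_algebraMap _ _
  have h2 := map_eq_tens (AlgHom.id (ZMod 2) FaaDiBruno)
    (IsScalarTower.toAlgHom (ZMod 2) Lazard P.Induced)
  have h3 : cls (Param.map (inclL FaaDiBruno P.Induced) hParam *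
      Param.map (inclR FaaDiBruno P.Induced) P.exp) =
      (tens (inclL FaaDiBruno P.Induced) ((inclR FaaDiBruno P.Induced).comp
        (algebraMap Lazard P.Induced))).comp lazardCoaction.toRingHom := by
    refine lazard_ext ?_
    have h4 := tens_comp_lazardCoaction (Param.map (inclL FaaDiBruno P.Induced) hParam)
      ((inclR FaaDiBruno P.Induced).comp (algebraMap Lazard P.Induced))
    rw [evB_map] at h4
    rw [h4, map_cls, mul_smul, ← map_map_law,
      ← map_additive (inclR FaaDiBruno P.Induced), ← Param.map_smul, ← lawOf_induced]
    rfl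
  exact (RingHom.congr_fun (h1.trans h3) n).trans
    (RingHom.congr_fun h2 (lazardCoaction n)).symm

end QRing

namespace QRing

variable {P : QRing.{u}} {S T : Type*} [CommRing S] [CommRing T] [Algebra (ZMod 2) S]
  [Algebra (ZMod 2) T]

/-! #### The total square on `N_* ⊗ P` -/

/-- The norm of a change of parameter for the additive group law. -/
abbrev addNorm (g : Param S) : Param (PowerSeries S) :=
  normParam (isOrderTwo_additive_of_algebra S) g

theorem map_addNorm (h : S →+* T) (g : Param S) :
    Param.map (PowerSeries.map h) (addNorm g) = addNorm (Param.map h g) := by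
  rw [addNorm, map_normParam]
  exact normParam_congr _ _ (map_additive h) _

theorem addNorm_mul_of_additive (g : Param S) {a : Param S} (ha : a.IsAdditive) :
    addNorm (g * a) = Param.map (reparam a) (addNorm g) * addNorm a := by
  rw [addNorm, normParam_mul, normParam_congr _ _ ha]

theorem isAdditive_addNorm {a : Param S} (ha : a.IsAdditive) : (addNorm a).IsAdditive :=
  normParam_additive ha _

variable (P) in
/-- The total square of `N_* ⊗ P`. -/
def inducedSquare : P.Induced →+* PowerSeries P.Induced :=
  -- This is the value forced by the Nishida relation at the universal point, the pair of `exp` and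
  -- the inclusion of `P`.
  (reparam P.exp⁻¹).comp (pt (addNorm P.exp) (sqAt P.square (ScalarExtension.incl Lazard P)))

theorem reparam_comp_inducedSquare : (reparam P.exp).comp P.inducedSquare =
    pt (addNorm P.exp) (sqAt P.square (ScalarExtension.incl Lazard P)) := by
  rw [inducedSquare, ← RingHom.comp_assoc, reparam_comp_inv, RingHom.id_comp]

/-- The formula holds by construction for the normalised pair. It passes to `(g' a, p)` because the
norm is a cocycle and `P` itself satisfies the Nishida relations for additive `a`. -/
theorem reparam_sqAt_pt (g : Param S) (p : P →+* S) :
    (reparam g).comp (sqAt P.inducedSquare (pt g p)) = pt (addNorm g) (sqAt P.square p) := by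
  set x := pt g p with hx
  set g' := Param.map x P.exp with hg'
  set a := Param.map (cls g) universalLog * g with ha
  have haa : a.IsAdditive := isAdditive_log_mul g
  have hga : g' * a = g := map_pt_exp_mul g p
  have h1 : (reparam g').comp (sqAt P.inducedSquare x) =
      pt (addNorm g') (sqAt P.square (aAct P.coaction a p)) := by
    rw [sqAt, ← RingHom.comp_assoc, hg', ← map_comp_reparam, RingHom.comp_assoc,
      reparam_comp_inducedSquare, comp_pt, map_addNorm, map_comp_sqAt, hx, pt_comp_incl]
  rw [← hga, reparam_mul, RingHom.comp_assoc, h1, comp_pt, P.aAct_square haa,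
    ← pt_mul _ (isAdditive_addNorm haa), addNorm_mul_of_additive g' haa]

omit [Algebra (ZMod 2) S] in
theorem reparam_comp_injective (g : Param S) {R : Type*} [CommRing R] {f k : R →+* PowerSeries S}
    (h : (reparam g).comp f = (reparam g).comp k) : f = k := by
  have := congrArg ((reparam g⁻¹).comp ·) h
  simp only [← RingHom.comp_assoc] at this
  rwa [reparam_inv_comp, RingHom.id_comp, RingHom.id_comp] at this

theorem isOrderTwo_induced : IsOrderTwo (lawOf P.Induced) := isOrderTwo_universalLaw.map _

/-- For the point `pt g p`, and after a further reparametrisation by `g`, both sides are the point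
with change of parameter `N(k g)` over the square of `p`; this is the cocycle rule for norms. -/
theorem nishida_induced :
    SatisfiesNishida hSeries (lawOf P.Induced) P.inducedSquare P.inducedCoaction := by
  refine satisfiesNishida_of_bAct isOrderTwo_induced fun k => ?_
  set y := inclR FaaDiBruno P.Induced with hy
  set g := Param.map y P.exp
  set p := y.comp (ScalarExtension.incl Lazard P)
  have hyp : y = pt g p := eq_pt y
  have hlaw : (lawOf P.Induced).map y = g • FormalGroup.𝔾ₐ := by
    rw [hyp, lawOf_map_pt]
  refine reparam_comp_injective g ?_
  rw [← RingHom.comp_assoc, ← reparam_mul]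
  have h1 : (reparam (k * g)).comp (sqAt P.inducedSquare (bAct P.inducedCoaction k y)) =
      pt (addNorm (k * g)) (sqAt P.square p) := by
    rw [← reparam_sqAt_pt, hyp]
    exact congrArg (fun f => (reparam (k * g)).comp (sqAt P.inducedSquare f)) (bAct_pt k g p)
  rw [h1, comp_bAct]
  have h2 : (reparam g).comp (sqAt P.inducedSquare y) = pt (addNorm g) (sqAt P.square p) := by
    rw [← reparam_sqAt_pt, ← hyp]
  rw [h2, bAct_pt, addNorm, normParam_mul,
    normParam_congr _ (isOrderTwo_induced.map y) hlaw.symm]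

/-- At `t = 0` the norm of `exp` is its Frobenius twist and the square on `P` is Frobenius, so the
universal point becomes its own Frobenius twist. -/
theorem constantCoeff_inducedSquare (r : P.Induced) :
    PowerSeries.constantCoeff (P.inducedSquare r) = r ^ 2 := by
  have h1 : PowerSeries.constantCoeff.comp (reparam P.exp⁻¹) =
    PowerSeries.constantCoeff (R := P.Induced) := RingHom.ext (constantCoeff_reparam _)
  have h2 : PowerSeries.constantCoeff.comp (sqAt P.square (ScalarExtension.incl Lazard P)) =
      (BordismNishida.square P.Induced).comp (ScalarExtension.incl Lazard P) := by
    ext r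
    rw [RingHom.comp_apply, sqAt_apply, ← PowerSeries.coeff_zero_eq_constantCoeff_apply,
      PowerSeries.coeff_map, PowerSeries.coeff_zero_eq_constantCoeff_apply, P.isTotalSquare.sq,
      map_pow, RingHom.comp_apply, BordismNishida.square_apply]
  have h : PowerSeries.constantCoeff.comp P.inducedSquare = BordismNishida.square P.Induced := by
    rw [inducedSquare, ← RingHom.comp_assoc, h1, comp_pt, h2, map_constantCoeff_normParam,
      ← comp_pt, ← id_eq_pt, RingHom.comp_id]
  exact RingHom.congr_fun h r

theorem isQuotientLaw_inducedSquare :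
    IsQuotientLaw (lawOf P.Induced) ((lawOf P.Induced).map P.inducedSquare) := by
  have h := (isQuotientLaw_additive (S := P.Induced)).smul (isOrderTwo_additive_of_algebra _) P.exp
  rw [← lawOf_induced] at h
  rwa [inducedSquare, ← map_map_law, lawOf_map_pt]

/-! #### Symmetry of the iterated total square -/

end QRing

section Symmetry

variable {S T : Type*} [CommRing S] [CommRing T] [Algebra (ZMod 2) S] [Algebra (ZMod 2) T]
  {τ : Type*}

-- Unlike in `evalP_normParam`, the coefficients go through an arbitrary `θ`; for the iterated norm
-- they are themselves power series which have to be evaluated.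
omit [Algebra (ZMod 2) T] in
theorem evalP_addNorm (θ : S →+* MvPowerSeries τ T) (g : Param S) {a b : MvPowerSeries τ T}
    (ha : a.constantCoeff = 0) (hb : b.constantCoeff = 0) :
    evalP (evalP θ b) (a * (a + b)) (QRing.addNorm g).toSeries =
      evalP θ a g.toSeries * evalP θ (a + b) g.toSeries := by
  have h0 : ∀ i : Option Unit, (i.elim b fun _ => a).constantCoeff = 0 := by
    rintro (_ | _) <;> simpa
  let Θ : MvPowerSeries (Option Unit) S →+* MvPowerSeries τ T :=
    evalHom θ fun i => i.elim b fun _ => a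
  have hx : Θ (serX S) = a := evalHom_X _ h0 (some ())
  have ht : Θ (serT S) = b := evalHom_X _ h0 none
  have hC : Θ.comp MvPowerSeries.C = θ := RingHom.ext fun r => evalHom_C _ _ r
  have hs0 : (serX S).constantCoeff = 0 := by simp
  have ht0 : (serT S).constantCoeff = 0 := by simp
  have hab0 : (a + b).constantCoeff = 0 := by rw [map_add, ha, hb, add_zero]
  have hab : (a * (a + b)).constantCoeff = 0 := by rw [map_mul, ha, zero_mul]
  have happ {c : MvPowerSeries (Option Unit) S} (hc : c.constantCoeff = 0)
      (hc' : (Θ c).constantCoeff = 0) : Θ (g.app c) = evalP θ (Θ c) g.toSeries := by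
    rw [Param.app, powerSeries_subst_eq_evalHom hc]
    refine (apply_evalP _ hc Θ hc' _).trans ?_
    rw [hC]
  have hl := congrArg Θ (isogenyEval_normParam (isOrderTwo_additive_of_algebra S) g)
  rw [normProd, map_mul, fadd_additive hs0 ht0, happ hs0 (by rwa [hx]),
    happ (by rw [map_add, hs0, ht0, add_zero]) (by rwa [map_add, hx, ht]), map_add, hx, ht] at hl
  rw [← hl]
  have hX : isogenyEval (σ := Unit) FormalGroup.𝔾ₐ (PowerSeries.X : PowerSeries (PowerSeries S)) =
    serX S * fadd FormalGroup.𝔾ₐ (serX S) (serT S) := isogenyEval_X _ ()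
  suffices evalP (evalP θ b) (a * (a + b)) =
      Θ.comp (isogenyEval (σ := Unit) FormalGroup.𝔾ₐ) from RingHom.congr_fun this _
  refine powerSeries_ringHom_ext (by rwa [evalP_X _ hab]) (fun c => ?_) ?_
  · rw [evalP_C]
    refine Eq.trans ?_ (congrArg Θ (isogenyEval_C (σ := Unit) _ c).symm)
    rw [apply_evalP _ (by simp) Θ (by rw [ht, hb]), ht, hC]
  · rw [evalP_X _ hab, RingHom.comp_apply, hX, fadd_additive hs0 ht0, map_mul, map_add, hx, ht]

/-- The iterated norm for the additive group law. -/
def doubleNorm (g : Param S) : Param (MvPowerSeries (Option Unit) S) :=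
  Param.map (isogenyEval (σ := Unit) FormalGroup.𝔾ₐ) (QRing.addNorm (QRing.addNorm g))

/-- The evaluation `s ↦ b`, `t ↦ c`. -/
def evalST (b c : MvPowerSeries τ S) : MvPowerSeries (Option Unit) S →+* MvPowerSeries τ S :=
  evalHom MvPowerSeries.C fun i => i.elim c fun _ => b

omit [Algebra (ZMod 2) S] in
theorem evalST_X {b c : MvPowerSeries τ S} (hb : b.constantCoeff = 0) (hc : c.constantCoeff = 0)
    (i : Option Unit) : evalST b c (MvPowerSeries.X i) = i.elim c fun _ => b :=
  evalHom_X _ (by rintro (_ | _) <;> simpa) i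

omit [Algebra (ZMod 2) S] in
theorem evalST_comp_isogenyEval {b c : MvPowerSeries τ S} (hb : b.constantCoeff = 0)
    (hc : c.constantCoeff = 0) :
    (evalST b c).comp (isogenyEval (σ := Unit) FormalGroup.𝔾ₐ) =
      evalP (evalP MvPowerSeries.C c) (b * (b + c)) := by
  have hx : evalST b c (serX S) = b := evalST_X hb hc (some ())
  have ht : evalST b c (serT S) = c := evalST_X hb hc none
  have hC : (evalST b c).comp MvPowerSeries.C = MvPowerSeries.C := RingHom.ext fun r =>
    evalHom_C _ _ r
  have hbc : (b * (b + c)).constantCoeff = 0 := by rw [map_mul, hb, zero_mul]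
  have hX : isogenyEval (σ := Unit) FormalGroup.𝔾ₐ (PowerSeries.X : PowerSeries (PowerSeries S)) =
    serX S * fadd FormalGroup.𝔾ₐ (serX S) (serT S) := isogenyEval_X _ ()
  have hX' : evalST b c (isogenyEval (σ := Unit) FormalGroup.𝔾ₐ
      (PowerSeries.X : PowerSeries (PowerSeries S))) = b * (b + c) := by
    rw [hX, fadd_additive (by simp) (by simp), map_mul, map_add, hx, ht]
  refine powerSeries_ringHom_ext ?_ (fun r => ?_) ?_
  · exact (congrArg MvPowerSeries.constantCoeff hX').trans hbc
  · rw [evalP_C, RingHom.comp_apply]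
    refine (congrArg (evalST b c) (isogenyEval_C (σ := Unit) _ r)).trans ?_
    rw [apply_evalP _ (by simp) _ (by rw [ht, hc]), ht, hC]
  · exact hX'.trans (evalP_X _ hbc).symm

/-- The iterated norm is the product of `g` over the translates of `a` by the group spanned by `b`
and `c`. In characteristic two the composite of the two isogenies is the product of these four
translates, which is `hAB`. -/
theorem evalP_doubleNorm (g : Param S) {a b c : MvPowerSeries τ S}
    (ha : a.constantCoeff = 0) (hb : b.constantCoeff = 0) (hc : c.constantCoeff = 0) :
    evalP (evalST b c) (a * (a + c) * ((a + b) * (a + b + c))) (doubleNorm g).toSeries =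
      g.app a * g.app (a + c) * (g.app (a + b) * g.app (a + b + c)) := by
  have hbc : (b * (b + c)).constantCoeff = 0 := by rw [map_mul, hb, zero_mul]
  have hA : (a * (a + c)).constantCoeff = 0 := by rw [map_mul, ha, zero_mul]
  have hab : (a + b).constantCoeff = 0 := by rw [map_add, ha, hb, add_zero]
  have hac : (a + c).constantCoeff = 0 := by rw [map_add, ha, hc, add_zero]
  have habc : (a + b + c).constantCoeff = 0 := by rw [map_add, hab, hc, add_zero]
  have hAB : a * (a + c) + b * (b + c) = (a + b) * (a + b + c) := by
    linear_combination (- a * b) * two_eq_zero_of_algebra (MvPowerSeries τ S)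
  have hp : (a * (a + c) * ((a + b) * (a + b + c))).constantCoeff = 0 := by
    rw [map_mul, hA, zero_mul]
  have happ {d : MvPowerSeries τ S} (hd : d.constantCoeff = 0) :
      evalP MvPowerSeries.C d g.toSeries = g.app d := (powerSeries_subst_eq_evalHom hd _).symm
  have h1 : evalP (evalST b c) (a * (a + c) * ((a + b) * (a + b + c))) (doubleNorm g).toSeries =
      evalP (evalP (evalP MvPowerSeries.C c) (b * (b + c)))
        (a * (a + c) * (a * (a + c) + b * (b + c))) (QRing.addNorm (QRing.addNorm g)).toSeries := by
    rw [← evalST_comp_isogenyEval hb hc, hAB]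
    exact evalP_map (isogenyEval (σ := Unit) FormalGroup.𝔾ₐ) (evalST b c) hp
      (QRing.addNorm (QRing.addNorm g)).toSeries
  rw [h1, evalP_addNorm _ _ hA hbc, hAB, evalP_addNorm _ _ ha hc, evalP_addNorm _ _ hab hc,
    happ ha, happ hab, happ hac, happ habc]

/-- The substitution `X i ↦ X i + c`, which fixes `c`, is an involution in characteristic two and
carries the regular element `X i` to `X i + c`. -/
theorem X_add_regular {σ : Type*} [Finite σ] [DecidableEq σ] (i : σ) {c : MvPowerSeries σ S}
    (hc : c.constantCoeff = 0)
    (hci : evalHom MvPowerSeries.C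
      (Function.update MvPowerSeries.X i (MvPowerSeries.X i + c)) c = c) :
    MvPowerSeries.X i + c ∈ nonZeroDivisors (MvPowerSeries σ S) := by
  have h0 (j : σ) : (Function.update MvPowerSeries.X i (MvPowerSeries.X i + c) j :
      MvPowerSeries σ S).constantCoeff = 0 := by
    by_cases h : j = i
    · subst h; simp [hc]
    · simp [h]
  obtain ⟨Θ, hΘ⟩ : ∃ Θ : MvPowerSeries σ S →+* MvPowerSeries σ S, Θ = evalHom MvPowerSeries.C
    (Function.update MvPowerSeries.X i (MvPowerSeries.X i + c)) := ⟨_, rfl⟩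
  rw [← hΘ] at hci
  have hΘC (r : S) : Θ (MvPowerSeries.C r) = MvPowerSeries.C r := by rw [hΘ, evalHom_C]
  have hi : Θ (MvPowerSeries.X i) = MvPowerSeries.X i + c := by
    rw [hΘ, evalHom_X _ h0, Function.update_self]
  have hj {j : σ} (h : j ≠ i) : Θ (MvPowerSeries.X j) = MvPowerSeries.X j := by
    rw [hΘ, evalHom_X _ h0, Function.update_of_ne h]
  have hinv : Θ.comp Θ = RingHom.id _ := by
    have hXX (j : σ) : Θ (Θ (MvPowerSeries.X j)) = MvPowerSeries.X j := by
      by_cases h : j = i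
      · subst h
        rw [hi, map_add, hi, hci, add_assoc, add_self_eq_zero, add_zero]
      · rw [hj h, hj h]
    refine ringHom_ext (fun j => ?_) (fun r => ?_) fun j => ?_
    · rw [RingHom.comp_apply, hXX, MvPowerSeries.constantCoeff_X]
    · rw [RingHom.comp_apply, hΘC, hΘC, RingHom.id_apply]
    · rw [RingHom.comp_apply, hXX, RingHom.id_apply]
  have hinv' (f : MvPowerSeries σ S) : Θ (Θ f) = f := RingHom.congr_fun hinv f
  have hic : Θ (MvPowerSeries.X i + c) = MvPowerSeries.X i := by
    rw [← hi, hinv']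
  refine mem_nonZeroDivisors_iff_right.2 fun f hf => ?_
  have h1 : Θ f * MvPowerSeries.X i = 0 := by
    rw [← hic, ← map_mul, hf, map_zero]
  have h2 : Θ f = 0 := by
    refine MvPowerSeries.ext fun m => ?_
    have h3 := congrArg (MvPowerSeries.coeff (m + Finsupp.single i 1)) h1
    rwa [MvPowerSeries.X, MvPowerSeries.coeff_add_mul_monomial, mul_one, map_zero] at h3
  rw [← hinv' f, h2, map_zero]

-- The retraction `ι` kills `p` and so reads off the constant coefficient of a series in the kernel.
-- That coefficient vanishes, and regularity of `p` permits division and repetition.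
omit [Algebra (ZMod 2) S] in
theorem evalP_injective_of_regular {W : Type*} [CommRing W] {θ : W →+* MvPowerSeries τ S}
    {p : MvPowerSeries τ S} (hp0 : p.constantCoeff = 0)
    (hp : p ∈ nonZeroDivisors (MvPowerSeries τ S)) (ι : MvPowerSeries τ S →+* W)
    (hι : ι.comp θ = RingHom.id W) (hιp : ι p = 0) : Function.Injective (evalP θ p) := by
  have step (f : PowerSeries W) (hf : evalP θ p f = 0) : ∃ f', f = PowerSeries.X * f' ∧
      evalP θ p f' = 0 := by
    obtain ⟨f', hf'⟩ : PowerSeries.X ∣ f - PowerSeries.C (PowerSeries.constantCoeff f) := by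
      rw [PowerSeries.X_dvd_iff]
      simp
    have e : evalP θ p f = p * evalP θ p f' + θ (PowerSeries.constantCoeff f) := by
      conv_lhs => rw [← sub_add_cancel f (PowerSeries.C (PowerSeries.constantCoeff f)), hf']
      rw [map_add, map_mul, evalP_X _ hp0, evalP_C]
    have hc : PowerSeries.constantCoeff f = 0 := by
      have := congrArg ι e
      rw [hf, map_zero, map_add, map_mul, hιp, zero_mul, zero_add] at this
      exact (RingHom.congr_fun hι _).symm.trans this.symm
    refine ⟨f', by rw [← hf', hc, map_zero, sub_zero], ?_⟩
    rw [hf, hc, map_zero, add_zero, mul_comm] at e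
    exact (mem_nonZeroDivisors_iff_right.1 hp) _ e.symm
  have key (n : ℕ) (f : PowerSeries W) (hf : evalP θ p f = 0) : PowerSeries.coeff n f = 0 := by
    induction n generalizing f with
    | zero =>
      obtain ⟨f', rfl, -⟩ := step f hf
      simp
    | succ n ih =>
      obtain ⟨f', rfl, hf'⟩ := step f hf
      rw [PowerSeries.coeff_succ_X_mul]
      exact ih f' hf'
  rw [injective_iff_map_eq_zero]
  intro f hf
  ext n
  simpa using key n f hf

end Symmetry

section Symmetry

variable {S T : Type*} [CommRing S] [CommRing T] [Algebra (ZMod 2) S] [Algebra (ZMod 2) T]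
  {τ υ : Type*}

omit [Algebra (ZMod 2) S] in
theorem comp_evalST {b c : MvPowerSeries τ S} (hb : b.constantCoeff = 0)
    (hc : c.constantCoeff = 0) {Θ : MvPowerSeries τ S →+* MvPowerSeries υ S}
    (hΘ : Θ.comp MvPowerSeries.C = MvPowerSeries.C) (hb' : (Θ b).constantCoeff = 0)
    (hc' : (Θ c).constantCoeff = 0) : Θ.comp (evalST b c) = evalST (Θ b) (Θ c) := by
  rw [evalST, comp_evalHom _ (by rintro (_ | _) <;> simpa) Θ (by rintro (_ | _) <;> simpa), hΘ,
    evalST]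
  congr 1
  ext1 i
  cases i <;> rfl

omit [Algebra (ZMod 2) S] in
theorem evalST_comp_C (b c : MvPowerSeries τ S) :
    (evalST b c).comp MvPowerSeries.C = MvPowerSeries.C :=
  RingHom.ext fun r => evalHom_C _ _ r

variable (S) in
/-- The exchange of the variables `s` and `t`. -/
abbrev exchange : MvPowerSeries (Option Unit) S →+* MvPowerSeries (Option Unit) S :=
  evalST (serT S) (serX S)

variable (S) in
omit [Algebra (ZMod 2) S] in
theorem evalST_serX_serT : evalST (serX S) (serT S) = RingHom.id _ := by
  refine ringHom_ext (fun i => ?_) (fun r => evalHom_C _ _ r) fun i => ?_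
  all_goals rw [evalST_X (by simp) (by simp)]; cases i <;> simp

/-- With `a`, `b`, `c` independent, the four-fold product formula is symmetric in `b` and `c`.
Evaluation at the product of the translates of `a` is injective, because that product is regular and
setting `a = 0` gives the required retraction. -/
theorem doubleNorm_exchange (g : Param S) :
    Param.map (exchange S) (doubleNorm g) = doubleNorm g := by
  obtain ⟨a, ha⟩ : ∃ a : MvPowerSeries (Fin 3) S, a = MvPowerSeries.X 0 := ⟨_, rfl⟩
  obtain ⟨b, hb⟩ : ∃ b : MvPowerSeries (Fin 3) S, b = MvPowerSeries.X 1 := ⟨_, rfl⟩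
  obtain ⟨c, hc⟩ : ∃ c : MvPowerSeries (Fin 3) S, c = MvPowerSeries.X 2 := ⟨_, rfl⟩
  have ha0 : a.constantCoeff = 0 := by rw [ha, MvPowerSeries.constantCoeff_X]
  have hb0 : b.constantCoeff = 0 := by rw [hb, MvPowerSeries.constantCoeff_X]
  have hc0 : c.constantCoeff = 0 := by rw [hc, MvPowerSeries.constantCoeff_X]
  have hbc0 : (b + c).constantCoeff = 0 := by rw [map_add, hb0, hc0, add_zero]
  have h0 {d : MvPowerSeries (Fin 3) S} (hd : d.constantCoeff = 0) (j : Fin 3) :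
      (Function.update MvPowerSeries.X 0 (MvPowerSeries.X 0 + d) j :
        MvPowerSeries (Fin 3) S).constantCoeff = 0 := by
    fin_cases j <;> simp [hd]
  have hfix {d : MvPowerSeries (Fin 3) S} (hd : d.constantCoeff = 0) {j : Fin 3} (hj : j ≠ 0) :
      evalHom MvPowerSeries.C
        (Function.update MvPowerSeries.X 0 (MvPowerSeries.X 0 + d)) (MvPowerSeries.X j) =
      (MvPowerSeries.X j : MvPowerSeries (Fin 3) S) := by
    rw [evalHom_X _ (h0 hd), Function.update_of_ne hj]
  have ra : a ∈ nonZeroDivisors (MvPowerSeries (Fin 3) S) := by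
    have h := X_add_regular (S := S) (0 : Fin 3) (c := 0) (map_zero _) (map_zero _)
    rwa [add_zero, ← ha] at h
  have rb : a + b ∈ nonZeroDivisors (MvPowerSeries (Fin 3) S) := by
    rw [ha]
    refine X_add_regular 0 hb0 ?_
    nth_rw 2 [hb]
    rw [hfix hb0 (by decide), hb]
  have rc : a + c ∈ nonZeroDivisors (MvPowerSeries (Fin 3) S) := by
    rw [ha]
    refine X_add_regular 0 hc0 ?_
    nth_rw 2 [hc]
    rw [hfix hc0 (by decide), hc]
  have rbc : a + b + c ∈ nonZeroDivisors (MvPowerSeries (Fin 3) S) := by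
    rw [ha, add_assoc]
    refine X_add_regular 0 hbc0 ?_
    nth_rw 2 [hb, hc]
    rw [map_add, hfix hbc0 (by decide), hfix hbc0 (by decide), hb, hc]
  have hp : a * (a + c) * ((a + b) * (a + b + c)) ∈ nonZeroDivisors (MvPowerSeries (Fin 3) S) :=
    mul_mem (mul_mem ra rc) (mul_mem rb rbc)
  have hp0 : (a * (a + c) * ((a + b) * (a + b + c))).constantCoeff = 0 := by
    rw [map_mul, map_mul, ha0, zero_mul, zero_mul]
  have hv (i : Fin 3) : (![0, serX S, serT S] i).constantCoeff = 0 := by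
    fin_cases i <;> simp
  obtain ⟨ι, hι⟩ : ∃ ι : MvPowerSeries (Fin 3) S →+* MvPowerSeries (Option Unit) S,
    ι = evalHom MvPowerSeries.C ![0, serX S, serT S] := ⟨_, rfl⟩
  have hιC : ι.comp MvPowerSeries.C = MvPowerSeries.C := by
    rw [hι]
    exact RingHom.ext fun r => evalHom_C _ _ r
  have hιa : ι a = 0 := by rw [hι, ha, evalHom_X _ hv]; rfl
  have hιb : ι b = serX S := by rw [hι, hb, evalHom_X _ hv]; rfl
  have hιc : ι c = serT S := by rw [hι, hc, evalHom_X _ hv]; rfl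
  have hret : ι.comp (evalST b c) = RingHom.id _ := by
    rw [comp_evalST hb0 hc0 hιC (by simp [hιb]) (by simp [hιc]), hιb, hιc, evalST_serX_serT]
  have hexch : (evalST b c).comp (exchange S) = evalST c b := by
    have h1 : evalST b c (serX S) = b := evalST_X hb0 hc0 (some ())
    have h2 : evalST b c (serT S) = c := evalST_X hb0 hc0 none
    rw [exchange, comp_evalST (by simp) (by simp) (evalST_comp_C b c) (by rw [h2, hc0])
      (by rw [h1, hb0]), h1, h2]
  refine Param.ext (evalP_injective_of_regular hp0 hp ι hret
    (by rw [map_mul, map_mul, hιa, zero_mul, zero_mul]) ?_)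
  rw [evalP_doubleNorm g ha0 hb0 hc0]
  refine (evalP_map (exchange S) (evalST b c) hp0 (doubleNorm g).toSeries).trans ?_
  rw [hexch]
  have hpp : a * (a + c) * ((a + b) * (a + b + c)) = a * (a + b) * ((a + c) * (a + c + b)) := by
    ring
  rw [hpp, evalP_doubleNorm g ha0 hc0 hb0, add_right_comm a c b]
  ring

omit [Algebra (ZMod 2) S] in
theorem subst_exchange (f : MvPowerSeries (Option Unit) S) :
    f.subst (fun i => (MvPowerSeries.X (Equiv.swap none (some ()) i) :
      MvPowerSeries (Option Unit) S)) = exchange S f := by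
  rw [subst_eq_evalHom (by simp), exchange, evalST]
  congr 2
  ext1 i
  cases i <;> simp

omit [Algebra (ZMod 2) S] in
theorem exchange_serX : exchange S (serX S) = serT S := evalST_X (by simp) (by simp) (some ())

omit [Algebra (ZMod 2) S] in
theorem exchange_serT : exchange S (serT S) = serX S := evalST_X (by simp) (by simp) none

omit [Algebra (ZMod 2) S] [Algebra (ZMod 2) T] in
theorem exchange_comp_map (h : S →+* T) :
    (exchange T).comp (MvPowerSeries.map h) = (MvPowerSeries.map h).comp (exchange S) := by
  have hX (i : Option Unit) : exchange T (MvPowerSeries.map h (MvPowerSeries.X i)) =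
      MvPowerSeries.map h (exchange S (MvPowerSeries.X i)) := by
    rw [MvPowerSeries.map_X, evalST_X (by simp) (by simp), evalST_X (by simp) (by simp)]
    cases i <;> simp
  refine ringHom_ext (fun i => ?_) (fun r => ?_) hX
  · rw [RingHom.comp_apply, MvPowerSeries.map_X, evalST_X (by simp) (by simp)]
    cases i <;> simp
  · rw [RingHom.comp_apply, RingHom.comp_apply, MvPowerSeries.map_C, exchange, evalST, evalHom_C,
      exchange, evalST, evalHom_C, MvPowerSeries.map_C]

omit [Algebra (ZMod 2) S] in
theorem exchange_app (g : Param S) {a : MvPowerSeries (Option Unit) S}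
    (ha : a.constantCoeff = 0) (ha' : (exchange S a).constantCoeff = 0) :
    exchange S (g.app a) = g.app (exchange S a) := by
  rw [Param.app, Param.app, powerSeries_subst_eq_evalHom ha, powerSeries_subst_eq_evalHom ha']
  refine (apply_evalP _ ha _ ha' _).trans ?_
  rw [evalST_comp_C]

omit [Algebra (ZMod 2) S] in
theorem exchange_comp_appHom (g : Param S) :
    (exchange S).comp (appHom (Option Unit) g) = (appHom (Option Unit) g).comp (exchange S) := by
  have hX (i : Option Unit) : exchange S (appHom _ g (MvPowerSeries.X i)) =
      appHom _ g (exchange S (MvPowerSeries.X i)) := by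
    have h0 : (MvPowerSeries.X i : MvPowerSeries (Option Unit) S).constantCoeff = 0 := by simp
    rcases i with _ | ⟨⟩
    · rw [appHom_X, exchange_app g h0 (by rw [exchange_serT]; simp), exchange_serT, appHom_X]
    · rw [appHom_X, exchange_app g h0 (by rw [exchange_serX]; simp), exchange_serX, appHom_X]
  refine ringHom_ext (fun i => ?_) (fun r => ?_) hX
  · rw [RingHom.comp_apply, hX]
    refine constantCoeff_appHom g ?_
    rw [evalST_X (by simp) (by simp)]
    cases i <;> simp
  · have hC := RingHom.congr_fun (evalST_comp_C (serT S) (serX S)) r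
    rw [RingHom.comp_apply] at hC
    rw [RingHom.comp_apply, RingHom.comp_apply, appHom_C, RingHom.id_apply, hC, appHom_C,
      RingHom.id_apply]

omit [Algebra (ZMod 2) S] in
theorem appHom_unit (g : Param S) : appHom Unit g = reparam g := by
  have hX : g.app (MvPowerSeries.X () : MvPowerSeries Unit S) = g.toSeries := g.app_X
  exact congrArg (evalHom (σ := Unit) MvPowerSeries.C) (funext fun _ => hX)

end Symmetry

namespace QRing

variable {P : QRing.{u}} {S : Type*} [CommRing S] [Algebra (ZMod 2) S]

/-- The iterated total square of `P`, with values in power series over `S`. -/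
def iteratedSquare (p : P →+* S) : P →+* MvPowerSeries (Option Unit) S :=
  (isogenyEval (σ := Unit) FormalGroup.𝔾ₐ).comp (sqAt P.square (sqAt P.square p))

omit [Algebra (ZMod 2) S] in
theorem iteratedSquare_apply (p : P →+* S) (r : P) : iteratedSquare p r =
    (extendSquare (σ := Unit) FormalGroup.𝔾ₐ P.square (P.square r)).map p := by
  rw [extendSquare_eq, map_isogenyEval, map_additive]
  refine congrArg (isogenyEval (σ := Unit) FormalGroup.𝔾ₐ) ?_
  ext n : 1
  rfl

omit [Algebra (ZMod 2) S] in
theorem exchange_comp_iteratedSquare (p : P →+* S) :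
    (exchange S).comp (iteratedSquare p) = iteratedSquare p := by
  ext1 r
  have h := P.isTotalSquare.symm r
  rw [subst_exchange] at h
  rw [RingHom.comp_apply, iteratedSquare_apply, ← RingHom.comp_apply, exchange_comp_map,
    RingHom.comp_apply, h]

/-- Applying the formula for the square of `pt g p` twice, first with `g = exp` and then with its
norm, transports the iterated square of `N_* ⊗ P` to that of `P`. Symmetry then splits into symmetry
of the iterated norm and symmetry on `P`. -/
theorem appHom_extendSquare_inducedSquare (r : P.Induced) :
    appHom (Option Unit) P.exp
      (extendSquare (σ := Unit) (lawOf P.Induced) P.inducedSquare (P.inducedSquare r)) =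
    pt (doubleNorm P.exp) (iteratedSquare (ScalarExtension.incl Lazard P)) r := by
  have h1 : ((P.inducedSquare r).map P.inducedSquare).map (reparam P.exp) =
      sqAt P.inducedSquare (pt (addNorm P.exp)
        (sqAt P.square (ScalarExtension.incl Lazard P))) r := by
    rw [← reparam_comp_inducedSquare]
    ext n : 1
    rfl
  have h2 := RingHom.congr_fun (reparam_sqAt_pt (addNorm P.exp)
    (sqAt P.square (ScalarExtension.incl Lazard P))) r
  rw [extendSquare_eq, lawOf_induced, appHom_isogenyEval (isOrderTwo_additive_of_algebra _),
    appHom_unit]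
  refine (congrArg (isogenyEval (σ := Unit) FormalGroup.𝔾ₐ)
    ((congrArg (reparam (addNorm P.exp)) h1).trans h2)).trans ?_
  rw [← RingHom.comp_apply, comp_pt]
  rfl

theorem isTotalSquare_induced : IsTotalSquare (lawOf P.Induced) P.inducedSquare where
  sq := constantCoeff_inducedSquare
  law := by
    rw [extendSquare_eq]
    exact isQuotientLaw_inducedSquare
  symm r := by
    rw [subst_exchange]
    refine appHom_injective P.exp ?_
    rw [← RingHom.comp_apply, ← exchange_comp_appHom, RingHom.comp_apply,
      appHom_extendSquare_inducedSquare, ← RingHom.comp_apply, comp_pt, doubleNorm_exchange,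
      exchange_comp_iteratedSquare]

end QRing

namespace QRing

variable (P : QRing.{u}) {S : Type*} [CommRing S] [Algebra (ZMod 2) S]

/-- The object `N_* ⊗ P` of `[B_* N_*]^D`. -/
def induced : DRing.{u} where
  carrier := P.Induced
  square := P.inducedSquare
  isTotalSquare := isTotalSquare_induced
  coaction := P.inducedCoaction
  isCoaction := isCoaction_induced
  coaction_smul := inducedCoaction_smul
  nishida := nishida_induced

/-- The identity defines the additive law, classified by the augmentation; the normalisation of the
universal logarithm is used here. -/
theorem map_cls_one_universalLog : Param.map (cls (1 : Param S)) universalLog = 1 := by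
  have h : cls (1 : Param S) =
      (algebraMap (ZMod 2) S).comp (lazardAugmentation : Lazard →+* ZMod 2) := by
    refine lazard_ext ?_
    rw [map_cls, one_smul, ← map_map_law, universalLaw_map_augmentation, map_additive]
  rw [h, ← Param.map_map, map_augmentation_universalLog, map_one]

theorem pt_one_comp_incl (p : P →+* S) : (pt 1 p).comp (ScalarExtension.incl Lazard P) = p := by
  rw [pt_comp_incl, map_cls_one_universalLog, one_mul, aAct_one P.isCoaction]

theorem comp_pt_one (p : P →+* S) : p.comp (pt 1 (RingHom.id P)) = pt 1 p := by
  rw [comp_pt, map_one, RingHom.comp_id]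

/-- A point of `N_* ⊗ P` with additive law is a pair whose change of parameter is additive; moving
that across leaves a pair with trivial change of parameter. -/
theorem exists_comp_pt_one (f : P.Induced →+* S) (hf : (lawOf P.Induced).map f = FormalGroup.𝔾ₐ) :
    ∃ p : P →+* S, p.comp (pt 1 (RingHom.id P)) = f := by
  have ha : (Param.map f P.exp).IsAdditive := by
    refine Eq.trans ?_ hf
    rw [← map_additive f, ← Param.map_smul, ← lawOf_induced]
  refine ⟨aAct P.coaction (Param.map f P.exp) (f.comp (ScalarExtension.incl Lazard P)), ?_⟩
  rw [comp_pt_one, ← pt_mul _ ha, one_mul]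
  exact (eq_pt f).symm

theorem square_comp_pt_one :
    P.square.comp (pt 1 (RingHom.id P)) = sqAt P.inducedSquare (pt 1 (RingHom.id P)) := by
  have h := reparam_sqAt_pt 1 (RingHom.id P)
  rw [reparam_one, RingHom.id_comp, addNorm, normParam_one, sqAt_id] at h
  rw [comp_pt_one, h]

theorem aAct_comp_pt_one {a : Param S} (ha : a.IsAdditive) (p : P →+* S) :
    (aAct P.coaction a p).comp (pt 1 (RingHom.id P)) =
      bAct P.inducedCoaction a (p.comp (pt 1 (RingHom.id P))) := by
  rw [comp_pt_one, comp_pt_one, ← pt_mul _ ha, one_mul, bAct_pt, mul_one]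

theorem isReduction_induced : IsReduction P.induced P (pt 1 (RingHom.id P)) where
  surjective r := ⟨_, RingHom.congr_fun (P.pt_one_comp_incl (RingHom.id P)) r⟩
  law := (lawOf_map_pt 1 (RingHom.id P)).trans (one_smul _ _)
  exists_desc := P.exists_comp_pt_one
  square := P.square_comp_pt_one
  act_comp := P.aAct_comp_pt_one

end QRing

instance : reduceFunctor.{u}.EssSurj where
  mem_essImage P := ⟨P.induced, P.induced.isReduction.nonempty_iso P.isReduction_induced⟩

instance : reduceFunctor.{u}.IsEquivalence where

end BordismNishida

end

theorem proposition2 :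
    ∃ (T : DRing.{u} ⥤ QRing.{u})
      (e : ∀ R : DRing.{u}, (R ⊗[Lazard] ZMod 2) ≃ₐ[ZMod 2] T.obj R),
      (∀ R : DRing.{u}, IsThomReduction R (T.obj R) (e R)) ∧
      (∀ {R S : DRing.{u}} (f : R ⟶ S) (r : R),
        QRing.Hom.toAlgHom (T.map f) (e R (r ⊗ₜ[Lazard] 1)) =
          e S (DRing.Hom.toAlgHom f r ⊗ₜ[Lazard] 1)) ∧
      T.IsEquivalence :=
  -- The carrier of `T(R)` is the tensor product itself, so the identification is the identity.
  ⟨reduceFunctor, fun _ => AlgEquiv.refl, isThomReduction_reduce,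
    fun f r => RingHom.congr_fun (reduceMap_comp f) r, inferInstance⟩
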